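/- **Setup.** Let $W_1,W_2,\dots$ be i.i.d. with law $F_0$ on a measurable space $\mathcal W$, and let $X_i=X(W_i)\in\mathcal X$ be covariates, where $X:\mathcal W\to\mathcal X$ is measurable (for instance $\mathcal W\subseteq\mathbf R^{d_w}$ and $X$ a sub-vector of $W$). Write $W$ for a generic observation. Let $T\subseteq\mathbf R^p$ be convex with nonempty interior, $\eta_0:\mathcal X\to T$ measurable, $\eta_i=\eta_0(X_i)$, and $$m(w,\theta,\eta)=\psi^b(w,\eta)-\psi^a(w,\eta)\,\theta ,$$ with $\psi^a,\psi^b$ jointly measurable. The parameter $\theta_0\in\mathbf R$ satisfies $E[m(W,\theta_0,\eta_0(X))]=0$. For each $n$ the indices $\{1,\dots,n\}$ are split into $K=K_n\le n$ folds $\mathcal I_1,\dots,\mathcal I_K$ of sizes $n_k\in\{\lfloor n/K\rfloor,\lfloor n/K\rfloor+1\}$, possibly at random but independently of the data. For each $k$, $\hat\eta_k:\mathcal X\to T$ is a measurable estimator that uses (given the split) only $\{W_i:i\notin\mathcal I_k\}$; put $\hat\eta_i=\hat\eta_k(X_i)$ for $i\in\mathcal I_k$, and let $n_0=n-n_k$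 be the number of observations used by $\hat\eta_k$. The DML1 estimator is $$\hat\theta_{n,1}=\frac1K\sum_{k=1}^K\frac{n_k^{-1}\sum_{i\in\mathcal I_k}\psi^b(W_i,\hat\eta_i)}{n_k^{-1}\sum_{i\in\mathcal I_k}\psi^a(W_i,\hat\eta_i)} .$$ **Assumption 1.** There are finite constants $M,C_0,C_1,C_2,C_3>0$ such that $|E[\psi^a(W,\eta_0(X))]|>C_0$ and, for $z=a,b$: $\psi^z(w,\cdot)$ is three times continuously differentiable on $T$ for every $w$; $E[\partial_\eta\psi^z(W,\eta_0(X))\mid X]=0$ a.s.; $E[\psi^z(W,\eta_0(X))^4]<M$ and $E[\|\partial_\eta\psi^z(W,\eta_0(X))\|^4]<M$; all entries of $E[\partial_\eta\psi^z(W,\eta_0(X))\,\partial_\eta\psi^z(W,\eta_0(X))^\top\mid X]$ are a.s. at most $C_1$ in absolute value; and, a.s., for all $\eta\in T$ all second- and third-order partial derivatives of $\psi^z(W,\cdot)$ at $\eta$ are at most $C_2$, respectively $C_3$, in absolute value. **Assumption 2** (with rates $\varphi_1,\varphi_2$). There are measurable functions $\delta_m:\mathcal W\times\mathcal X\to\mathbf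 R^p$ and $b_m:\mathcal X\times\mathcal X\to\mathbf R^p$ ($m\in\mathbf N$), constants $M_1,C_\delta,C_b>0$ and positive $\tau_m\to0$ such that, with $\hat R_k(x)$ defined by $$\hat\eta_k(x)-\eta_0(x)=n_0^{-1/2}\sum_{\ell\notin\mathcal I_k}n_0^{-\varphi_1}\delta_{n_0}(W_\ell,x)+n_0^{-1}\sum_{\ell\notin\mathcal I_k}n_0^{-\varphi_2}b_{n_0}(X_\ell,x)+n_0^{-2\min\{\varphi_1,\varphi_2\}}\hat R_k(x),$$ the following hold. (a) For every fixed $x\in\mathcal X$ and $k$, $\hat R_k(x)=O_p(1)$ as $n\to\infty$. For all sufficiently large $m$ and every $x\in\mathcal X$, $\delta_m(W,x)$ is integrable, $E[\delta_m(W,x)\mid X]=0$ a.s. and $E\|\delta_m(W,x)\|^2>C_\delta$. (b) For all sufficiently large $m$ and $i\ne j$: $E\big[E[\|\delta_m(W_j,X_i)\|^2\mid X_i]^2\big]\le M_1$; $E\big[E[\|m^{-\varphi_2}b_m(X_j,X_i)\|^2\mid X_i]^2\big]\le m^{2(1-2\varphi_1)}\tau_m$; $E\big[\|E[b_m(X_j,X_i)\mid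 X_i]\|^4\big]\in(C_b,M_1)$; and for $s=1,2$, $E\|\delta_m(W_j,X_i)\|^{2s}<m^{(s-1)(1-2\varphi_1)}M_1$ and $E\|m^{-\varphi_2}b_m(X_j,X_i)\|^{2s}<m^{(2s-1)(1-2\varphi_1)}\tau_m$. (c) With $\hat R(X_i)=\hat R_k(X_i)$ for $i\in\mathcal I_k$, there is $C$ with $E\|\hat R(X_i)\|^2\le C$ for all sufficiently large $n$ and all $i\le n$. (d) $n^{-1}\sum_{i=1}^n\|\hat R(X_i)\|^4=O_p\big(n^{4\min\{\varphi_1,\varphi_2\}}\big)$. **Theorem.** Suppose Assumptions 1 and 2 hold, $K\le n$, $K\to\infty$ and $K/\sqrt n\to c\in[0,\infty)$ as $n\to\infty$, $\varphi_1\le1/2$ and $\min\{\varphi_1,\varphi_2\}>1/4$. Then $$\sqrt n\,(\hat\theta_{n,1}-\theta_0)\ \xrightarrow{d}\ N(c\Lambda,\sigma^2),$$ where $$\Lambda=\frac{\operatorname{Cov}[m(W,\theta_0,\eta_0(X)),\,-\psi^a(W,\eta_0(X))]}{E[\psi^a(W,\eta_0(X))]^2},\qquad \sigma^2=\frac{E[m(W,\theta_0,\eta_0(X))^2]}{E[\psi^a(W,\eta_0(X))]^2},$$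 and $N(\mu,0)$ denotes the point mass at $\mu$. -/

import Mathlib

open MeasureTheory ProbabilityTheory Filter Topology
open scoped ENNReal

noncomputable section

namespace DML

variable {𝒲 𝒳 : Type*} {p : ℕ}

/-- The moment function `m(w, θ, η) = ψᵇ(w, η) - ψᵃ(w, η) θ`. -/
def moment (ψa ψb : 𝒲 → EuclideanSpace ℝ (Fin p) → ℝ) (w : 𝒲) (θ : ℝ)
    (η : EuclideanSpace ℝ (Fin p)) : ℝ :=
  ψb w η - ψa w η * θ

/-- The `j`-th standard basis vector of `ℝᵖ`. -/
def basisVec (j : Fin p) : EuclideanSpace ℝ (Fin p) := EuclideanSpace.single j 1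

/-- The conditions on one of the two functions `ψᵃ`, `ψᵇ`: smoothness in `η ∈ T`, strong Neyman
orthogonality, moment bounds, and bounds on the second and third partial derivatives.
Here `F₀` is the law of `W`, `X` maps `W` to its covariates and `η₀` is the true nuisance function;
all derivatives are taken with respect to `η`, within `T`. -/
structure MomentRegular [MeasurableSpace 𝒲] [MeasurableSpace 𝒳] (F₀ : Measure 𝒲) (X : 𝒲 → 𝒳)
    (T : Set (EuclideanSpace ℝ (Fin p))) (η₀ : 𝒳 → EuclideanSpace ℝ (Fin p))
    (M C₁ C₂ C₃ : ℝ) (ψ : 𝒲 → EuclideanSpace ℝ (Fin p) → ℝ) : Prop where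
  measurable : Measurable (Function.uncurry ψ)
  contDiffOn : ∀ w, ContDiffOn ℝ 3 (ψ w) T
  orthogonal :
    F₀[fun w => gradientWithin (ψ w) T (η₀ (X w)) | MeasurableSpace.comap X inferInstance]
      =ᵐ[F₀] 0
  memLp : MemLp (fun w => ψ w (η₀ (X w))) 4 F₀
  moment_lt : ∫ w, ψ w (η₀ (X w)) ^ 4 ∂F₀ < M
  memLp_grad : MemLp (fun w => gradientWithin (ψ w) T (η₀ (X w))) 4 F₀
  moment_grad_lt : ∫ w, ‖gradientWithin (ψ w) T (η₀ (X w))‖ ^ 4 ∂F₀ < M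
  condVar_le : ∀ i j : Fin p, ∀ᵐ w ∂F₀,
    |(F₀[fun w => gradientWithin (ψ w) T (η₀ (X w)) i * gradientWithin (ψ w) T (η₀ (X w)) j |
        MeasurableSpace.comap X inferInstance]) w| ≤ C₁
  deriv_two_le : ∀ᵐ w ∂F₀, ∀ η ∈ T, ∀ i j : Fin p,
    |iteratedFDerivWithin ℝ 2 (ψ w) T η ![basisVec i, basisVec j]| ≤ C₂
  deriv_three_le : ∀ᵐ w ∂F₀, ∀ η ∈ T, ∀ i j l : Fin p,
    |iteratedFDerivWithin ℝ 3 (ψ w) T η ![basisVec i, basisVec j, basisVec l]| ≤ C₃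

/-- The assumption on the moment function: identification, `|E ψᵃ(W, η₀(X))| > C₀ > 0`, and the
regularity conditions for both `ψᵃ` and `ψᵇ`. -/
def MomentAssumption [MeasurableSpace 𝒲] [MeasurableSpace 𝒳] (F₀ : Measure 𝒲) (X : 𝒲 → 𝒳)
    (T : Set (EuclideanSpace ℝ (Fin p))) (η₀ : 𝒳 → EuclideanSpace ℝ (Fin p))
    (ψa ψb : 𝒲 → EuclideanSpace ℝ (Fin p) → ℝ) : Prop :=
  ∃ M C₀ C₁ C₂ C₃ : ℝ, 0 < M ∧ 0 < C₀ ∧ 0 < C₁ ∧ 0 < C₂ ∧ 0 < C₃ ∧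
    C₀ < |∫ w, ψa w (η₀ (X w)) ∂F₀| ∧
    MomentRegular F₀ X T η₀ M C₁ C₂ C₃ ψa ∧
    MomentRegular F₀ X T η₀ M C₁ C₂ C₃ ψb

/-! ### Sample splitting, cross-fitting and the DML1 estimator

A split of `n` observations into `K` folds is a map `s : Fin n → Fin K`; the fold `𝓘ₖ` is the set
of `i` with `s i = k`. -/

/-- The fold sizes are `⌊n/K⌋` or `⌊n/K⌋ + 1` (so all are `n/K` when `K` divides `n`). -/
def IsBalanced {n K : ℕ} (s : Fin n → Fin K) : Prop :=
  ∀ k : Fin K, Fintype.card {i // s i = k} = n / K ∨ Fintype.card {i // s i = k} = n / K + 1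

/-- A rule producing, for every split `s` and every fold `k`, an estimate `η̂ₖ(·)` from the data
outside the fold `k` only. -/
abbrev NuisanceEstimator (𝒲 𝒳 : Type*) (p n K : ℕ) :=
  (s : Fin n → Fin K) → (k : Fin K) → ({i : Fin n // s i ≠ k} → 𝒲) → 𝒳 → EuclideanSpace ℝ (Fin p)

/-- The data outside the fold `k`. -/
def offFold {n K : ℕ} (s : Fin n → Fin K) (k : Fin K) (w : Fin n → 𝒲) :
    {i : Fin n // s i ≠ k} → 𝒲 :=
  fun i => w i

/-- The cross-fitted values `η̂ᵢ = η̂ₖ(Xᵢ)` for `i ∈ 𝓘ₖ`. -/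
def crossFit {n K : ℕ} (X : 𝒲 → 𝒳) (est : NuisanceEstimator 𝒲 𝒳 p n K) (s : Fin n → Fin K)
    (w : Fin n → 𝒲) (i : Fin n) : EuclideanSpace ℝ (Fin p) :=
  est s (s i) (offFold s (s i) w) (X (w i))

/-- The average of `v` over the fold `k`. -/
def foldMean {n K : ℕ} (s : Fin n → Fin K) (k : Fin K) (v : Fin n → ℝ) : ℝ :=
  (Fintype.card {i // s i = k} : ℝ)⁻¹ * ∑ i : {i // s i = k}, v i

/-- The DML1 estimator: the average over the folds of the solutions `θ̃ₖ` of the foldwise moment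
conditions. -/
def dml1 {n K : ℕ} (X : 𝒲 → 𝒳) (ψa ψb : 𝒲 → EuclideanSpace ℝ (Fin p) → ℝ)
    (est : NuisanceEstimator 𝒲 𝒳 p n K) (s : Fin n → Fin K) (w : Fin n → 𝒲) : ℝ :=
  (K : ℝ)⁻¹ * ∑ k : Fin K,
    foldMean s k (fun i => ψb (w i) (crossFit X est s w i)) /
      foldMean s k (fun i => ψa (w i) (crossFit X est s w i))

/-! ### The stochastic expansion of the nuisance estimator -/

/-- `Zₙ = O_p(rₙ)`. -/
def IsBigOInProb {Ω : Type*} [MeasurableSpace Ω] (P : Measure Ω) (Z : ℕ → Ω → ℝ) (r : ℕ → ℝ) :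
    Prop :=
  ∀ ε : ℝ, 0 < ε → ∃ B : ℝ, ∀ᶠ n in atTop, P {ω | B * r n < |Z n ω|} ≤ ENNReal.ofReal ε

/-- The remainder `R̂ₖ(x)` of the expansion, that is, the solution `R` of
`η̂ₖ(x) - η₀(x) = n₀^(-1/2) ∑_{ℓ ∉ 𝓘ₖ} n₀^(-φ₁) δ_{n₀}(W_ℓ, x)
  + n₀⁻¹ ∑_{ℓ ∉ 𝓘ₖ} n₀^(-φ₂) b_{n₀}(X_ℓ, x) + n₀^(-2 min(φ₁, φ₂)) R`,
where `n₀` is the number of observations outside the fold `k`. -/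
def remainder {n K : ℕ} (X : 𝒲 → 𝒳) (η₀ : 𝒳 → EuclideanSpace ℝ (Fin p)) (φ₁ φ₂ : ℝ)
    (δ : ℕ → 𝒲 → 𝒳 → EuclideanSpace ℝ (Fin p)) (b : ℕ → 𝒳 → 𝒳 → EuclideanSpace ℝ (Fin p))
    (est : NuisanceEstimator 𝒲 𝒳 p n K) (s : Fin n → Fin K) (k : Fin K) (w : Fin n → 𝒲)
    (x : 𝒳) : EuclideanSpace ℝ (Fin p) :=
  let n₀ : ℕ := Fintype.card {i // s i ≠ k}
  (n₀ : ℝ) ^ (2 * min φ₁ φ₂) •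
    (est s k (offFold s k w) x - η₀ x
      - (n₀ : ℝ) ^ (-(1 / 2) : ℝ) • ∑ l : {i // s i ≠ k}, (n₀ : ℝ) ^ (-φ₁) • δ n₀ (w l) x
      - (n₀ : ℝ)⁻¹ • ∑ l : {i // s i ≠ k}, (n₀ : ℝ) ^ (-φ₂) • b n₀ (X (w l)) x)

/-- The conditions on the functions `δ_m`, `b_m` of the expansion that only involve the law `F₀`
of `W`. Since `W_j` and `W_i` are independent for `i ≠ j`, a conditional expectation
`E[g(W_j, X_i) | X_i]` is the partial integral of `g` in its first argument, at `X_i`.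
`F₀.map X` is the law of the covariates. -/
structure ExpansionRegular [MeasurableSpace 𝒲] [MeasurableSpace 𝒳] (F₀ : Measure 𝒲) (X : 𝒲 → 𝒳)
    (φ₁ φ₂ M₁ Cδ Cb : ℝ) (τ : ℕ → ℝ) (m : ℕ)
    (δ : 𝒲 → 𝒳 → EuclideanSpace ℝ (Fin p)) (b : 𝒳 → 𝒳 → EuclideanSpace ℝ (Fin p)) : Prop where
  integrable_δ : ∀ x, Integrable (fun w => δ w x) F₀
  condExp_δ : ∀ x, F₀[fun w => δ w x | MeasurableSpace.comap X inferInstance] =ᵐ[F₀] 0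
  lower_δ : ∀ x, ENNReal.ofReal Cδ < ∫⁻ w, ‖δ w x‖ₑ ^ 2 ∂F₀
  condMoment_δ :
    ∫⁻ x, (∫⁻ w, ‖δ w x‖ₑ ^ 2 ∂F₀) ^ 2 ∂(F₀.map X) ≤ ENNReal.ofReal M₁
  condMoment_b :
    ∫⁻ x, (∫⁻ x', ‖(m : ℝ) ^ (-φ₂) • b x' x‖ₑ ^ 2 ∂(F₀.map X)) ^ 2 ∂(F₀.map X)
      ≤ ENNReal.ofReal ((m : ℝ) ^ (2 * (1 - 2 * φ₁)) * τ m)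
  moment_δ : ∀ s : ℕ, s = 1 ∨ s = 2 →
    ∫⁻ x, ∫⁻ w, ‖δ w x‖ₑ ^ (2 * s) ∂F₀ ∂(F₀.map X)
      < ENNReal.ofReal ((m : ℝ) ^ (((s : ℝ) - 1) * (1 - 2 * φ₁)) * M₁)
  lower_b :
    ENNReal.ofReal Cb < ∫⁻ x, ‖∫ x', b x' x ∂(F₀.map X)‖ₑ ^ 4 ∂(F₀.map X)
  upper_b :
    ∫⁻ x, ‖∫ x', b x' x ∂(F₀.map X)‖ₑ ^ 4 ∂(F₀.map X) < ENNReal.ofReal M₁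
  moment_b : ∀ s : ℕ, s = 1 ∨ s = 2 →
    ∫⁻ x, ∫⁻ x', ‖(m : ℝ) ^ (-φ₂) • b x' x‖ₑ ^ (2 * s) ∂(F₀.map X) ∂(F₀.map X)
      < ENNReal.ofReal ((m : ℝ) ^ ((2 * (s : ℝ) - 1) * (1 - 2 * φ₁)) * τ m)

/-- The assumption on the nuisance estimators: a stochastic expansion with rates `φ₁`, `φ₂`.
`W i` are the observations, `S n` is the (random) split of the first `n` observations into `K n`
folds and `est n` is the nuisance estimator for sample size `n`. -/
def ExpansionAssumption {Ω : Type*} [MeasurableSpace Ω] [MeasurableSpace 𝒲] [MeasurableSpace 𝒳]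
    (P : Measure Ω) (F₀ : Measure 𝒲) (X : 𝒲 → 𝒳) (η₀ : 𝒳 → EuclideanSpace ℝ (Fin p))
    (φ₁ φ₂ : ℝ) (K : ℕ → ℕ) (W : ℕ → Ω → 𝒲) (S : (n : ℕ) → Ω → Fin n → Fin (K n))
    (est : (n : ℕ) → NuisanceEstimator 𝒲 𝒳 p n (K n)) : Prop :=
  ∃ (δ : ℕ → 𝒲 → 𝒳 → EuclideanSpace ℝ (Fin p)) (b : ℕ → 𝒳 → 𝒳 → EuclideanSpace ℝ (Fin p)),
    (∀ m, Measurable (Function.uncurry (δ m))) ∧ (∀ m, Measurable (Function.uncurry (b m))) ∧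
    (∃ (M₁ Cδ Cb : ℝ) (τ : ℕ → ℝ), 0 < M₁ ∧ 0 < Cδ ∧ 0 < Cb ∧
      (∀ m, 0 < τ m) ∧ Tendsto τ atTop (𝓝 0) ∧
      ∀ᶠ m in atTop, ExpansionRegular F₀ X φ₁ φ₂ M₁ Cδ Cb τ m (δ m) (b m)) ∧
    -- for fixed `x` and `k`, the remainder is bounded in probability
    (∀ (x : 𝒳) (k : ℕ), IsBigOInProb P
      (fun n ω => if h : k < K n then
          ‖remainder X η₀ φ₁ φ₂ δ b (est n) (S n ω) ⟨k, h⟩ (fun i => W i ω) x‖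
        else 0) (fun _ => 1)) ∧
    -- second moments of the remainder at the sample points are bounded
    (∃ C : ℝ, ∀ᶠ n in atTop, ∀ i : Fin n,
      ∫⁻ ω, ‖remainder X η₀ φ₁ φ₂ δ b (est n) (S n ω) (S n ω i) (fun j => W j ω)
        (X (W i ω))‖ₑ ^ 2 ∂P ≤ ENNReal.ofReal C) ∧
    -- the average fourth power of the remainder
    IsBigOInProb P
      (fun n ω => (n : ℝ)⁻¹ * ∑ i : Fin n,
        ‖remainder X η₀ φ₁ φ₂ δ b (est n) (S n ω) (S n ω i) (fun j => W j ω) (X (W i ω))‖ ^ 4)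
      (fun n => (n : ℝ) ^ (4 * min φ₁ φ₂))

/-- The asymptotic variance `σ² = E[m(W, θ₀, η₀(X))²] / E[ψᵃ(W, η₀(X))]²`. -/
def asympVar [MeasurableSpace 𝒲] (F₀ : Measure 𝒲) (X : 𝒲 → 𝒳)
    (η₀ : 𝒳 → EuclideanSpace ℝ (Fin p)) (ψa ψb : 𝒲 → EuclideanSpace ℝ (Fin p) → ℝ)
    (θ₀ : ℝ) : ℝ :=
  (∫ w, moment ψa ψb w θ₀ (η₀ (X w)) ^ 2 ∂F₀) / (∫ w, ψa w (η₀ (X w)) ∂F₀) ^ 2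

/-- The bias coefficient
`Λ = Cov[m(W, θ₀, η₀(X)), -ψᵃ(W, η₀(X))] / E[ψᵃ(W, η₀(X))]²`. -/
def biasCoeff [MeasurableSpace 𝒲] (F₀ : Measure 𝒲) (X : 𝒲 → 𝒳)
    (η₀ : 𝒳 → EuclideanSpace ℝ (Fin p)) (ψa ψb : 𝒲 → EuclideanSpace ℝ (Fin p) → ℝ)
    (θ₀ : ℝ) : ℝ :=
  cov[fun w => moment ψa ψb w θ₀ (η₀ (X w)), fun w => -ψa w (η₀ (X w)); F₀] /
    (∫ w, ψa w (η₀ (X w)) ∂F₀) ^ 2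

end DML

end

namespace DML

/-! ### Moments of sums of independent variables. -/

section IidSums

variable {Ω ι E : Type*} [MeasurableSpace Ω] {P : Measure Ω}

/-! Put a = E ψᵃ(W, η₀), u = m(W, θ₀, η₀), v = ψᵃ(W, η₀) - a and κ = min(φ₁, φ₂). Let U_k, V_k be
the fold means of u, v, and let Dᵃ_k, Dᵇ_k be the changes in the fold means of ψᵃ, ψᵇ when η₀ is
replaced by its estimate (`foldError`). The estimation error of DML1 is the average over k of (U_k +
Dᵇ_k - θ₀ Dᵃ_k) / (a + V_k + Dᵃ_k) (`dml1_sub_eq`). Expanding each ratio to second order leaves U_k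
/ a - U_k V_k / a², with errors of size |Dᵃ_k|, |Dᵇ_k| and |U_k| V_k² (`abs_ratio_sub_le`).

All rates use that the fold size q = ⌊n/K⌋ is at least a constant times √n. After multiplication by
√n:

The linear terms give n^(-1/2) ∑ u(W_i) / a up to o_p(1), and the central limit theorem applies
(`tendstoInMeasure_sum_foldMean_sub`, `tendstoInDistribution_affine`).

The products U_k V_k have mean E[uv] / n_k, so their scaled average has mean about (K/√n) E[uv],
while its variance is O(1/q) because folds are independent. It tends to c E[uv], and -E[uv] / a² is
Λ because E u = 0 (`tendstoInMeasure_sum_foldMean_mul`). The bias thus comes from the correlation of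
numerator and denominator within a fold.

The cubic terms are of order √n q^(-3/2) = O(q^(-1/2)) (`tendstoInMeasure_sum_abs_mul_sq`).

The nuisance terms vanish (`IsLinearization.tendstoInMeasure_foldError`). The mean squared error of
the nuisance estimates is O(n^(-2κ)). Given the data outside a fold, orthogonality makes the linear
part of ψ in the error a sum of centred i.i.d. variables, so its fold mean is of order q^(-1/2)
n^(-κ); multiplied by √n this is O(n^(1/4 - κ)). The quadratic part contributes √n n^(-2κ). Both
vanish for κ > 1/4, and no cancellation between folds is needed, so absolute values may be summed.

The expansion is valid only where every U_k, V_k, Dᵃ_k is small. Sums of fourth powers of fold means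
tend to zero in probability and control all U_k, V_k at once; the summed |Dᵃ_k| are controlled by
the previous paragraph. -/

theorem lintegral_enorm_pow_eq_ofReal [NormedAddCommGroup E] {f : Ω → E} {k : ℕ} (hk : k ≠ 0)
    (hf : MemLp f k P) : ∫⁻ ω, ‖f ω‖ₑ ^ k ∂P = ENNReal.ofReal (∫ ω, ‖f ω‖ ^ k ∂P) := by
  rw [ofReal_integral_eq_lintegral_ofReal (hf.integrable_norm_pow hk)
    (ae_of_all _ fun ω => by positivity)]
  simp_rw [ENNReal.ofReal_pow (norm_nonneg _), ofReal_norm]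

theorem memLp_of_lintegral_enorm_sq_ne_top [NormedAddCommGroup E] {f : Ω → E}
    (hf : AEStronglyMeasurable f P) (h : ∫⁻ ω, ‖f ω‖ₑ ^ 2 ∂P ≠ ∞) : MemLp f 2 P := by
  refine ⟨hf, ?_⟩
  rw [eLpNorm_lt_top_iff_lintegral_rpow_enorm_lt_top (by norm_num) (by norm_num)]
  simpa using h.lt_top

/-- Second moment of a sum of independent vectors with a common mean. -/
theorem integral_norm_sum_sq_le [IsProbabilityMeasure P]
    [NormedAddCommGroup E] [InnerProductSpace ℝ E] [CompleteSpace E] [MeasurableSpace E]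
    [BorelSpace E] [SecondCountableTopology E]
    {Z : ι → Ω → E} (hZ : iIndepFun Z P) (hL2 : ∀ i, MemLp (Z i) 2 P) (hm : ∀ i, Measurable (Z i))
    {e : E} {κ : ℝ} (hmean : ∀ i, ∫ ω, Z i ω ∂P = e) (hκ : ∀ i, ∫ ω, ‖Z i ω‖ ^ 2 ∂P ≤ κ)
    (t : Finset ι) :
    ∫ ω, ‖∑ i ∈ t, Z i ω‖ ^ 2 ∂P ≤ (t.card : ℝ) ^ 2 * ‖e‖ ^ 2 + t.card * κ := by
  classical
  induction t using Finset.induction_on with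
  | empty => simp
  | insert i t hi ih =>
    have hS : MemLp (fun ω => ∑ j ∈ t, Z j ω) 2 P := memLp_finsetSum t fun j _ => hL2 j
    have hind : IndepFun (fun ω => ∑ j ∈ t, Z j ω) (Z i) P := by
      have := hZ.indepFun_finsetSum_of_notMem hm hi
      convert this using 1
      ext ω
      simp
    have hint : ∀ j, Integrable (Z j) P := fun j => (hL2 j).integrable (by norm_num)
    have hcross : ∫ ω, inner ℝ (∑ j ∈ t, Z j ω) (Z i ω) ∂P = t.card * ‖e‖ ^ 2 := by
      have := hind.integral_bilin (hS.integrable (by norm_num)) (hint i) (innerSL ℝ)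
      simp only [innerSL_apply_apply ℝ] at this
      rw [this, integral_finsetSum _ fun j _ => hint j]
      simp only [hmean, Finset.sum_const, ← Nat.cast_smul_eq_nsmul ℝ, inner_smul_left,
        real_inner_self_eq_norm_sq]
      simp
    have h1 : Integrable (fun ω => ‖∑ j ∈ t, Z j ω‖ ^ 2) P := hS.integrable_norm_pow (by norm_num)
    have h2 : Integrable (fun ω => ‖Z i ω‖ ^ 2) P := (hL2 i).integrable_norm_pow (by norm_num)
    have h3 : Integrable (fun ω => inner ℝ (∑ j ∈ t, Z j ω) (Z i ω)) P :=
      hind.integrable_bilin (hS.integrable (by norm_num)) (hint i) (innerSL ℝ)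
    have hexp : ∀ ω, ‖∑ j ∈ insert i t, Z j ω‖ ^ 2 =
        ‖∑ j ∈ t, Z j ω‖ ^ 2 + 2 * inner ℝ (∑ j ∈ t, Z j ω) (Z i ω) + ‖Z i ω‖ ^ 2 := fun ω => by
      rw [Finset.sum_insert hi, add_comm (Z i ω), norm_add_sq_real]
    simp_rw [hexp]
    rw [integral_add (h1.fun_add (h3.const_mul 2)) h2, integral_add h1 (h3.const_mul 2),
      integral_const_mul, hcross, Finset.card_insert_of_notMem hi]
    push_cast
    nlinarith [hκ i, sq_nonneg ‖e‖]

theorem integral_comp_eval_pi {𝒲 : Type*} [MeasurableSpace 𝒲] [Fintype ι]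
    (μ : Measure 𝒲) [IsProbabilityMeasure μ] [NormedAddCommGroup E] [NormedSpace ℝ E]
    {f : 𝒲 → E} (i : ι) (hf : AEStronglyMeasurable f μ) :
    ∫ w : ι → 𝒲, f (w i) ∂(Measure.pi fun _ => μ) = ∫ x, f x ∂μ := by
  have hmp := measurePreserving_eval (fun _ : ι => μ) i
  have := integral_map (μ := Measure.pi fun _ : ι => μ) hmp.aemeasurable (f := f)
    (by rw [hmp.map_eq]; exact hf)
  rw [hmp.map_eq] at this
  exact this.symm

/-- Second moment of a sum of i.i.d. vectors, without integrability assumptions on the norm. -/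
theorem lintegral_enorm_sum_sq_le {𝒲 : Type*} [MeasurableSpace 𝒲] [Fintype ι]
    (μ : Measure 𝒲) [IsProbabilityMeasure μ]
    [NormedAddCommGroup E] [InnerProductSpace ℝ E] [CompleteSpace E] [MeasurableSpace E]
    [BorelSpace E] [SecondCountableTopology E] {Y : 𝒲 → E} (hY : Measurable Y) :
    ∫⁻ w : ι → 𝒲, ‖∑ i, Y (w i)‖ₑ ^ 2 ∂(Measure.pi fun _ => μ) ≤
      (Fintype.card ι : ℝ≥0∞) ^ 2 * ‖∫ x, Y x ∂μ‖ₑ ^ 2 +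
        Fintype.card ι * ∫⁻ x, ‖Y x‖ₑ ^ 2 ∂μ := by
  classical
  rcases isEmpty_or_nonempty ι with hι | hι
  · simp
  -- With an infinite second moment the right side is infinite, since the index type is nonempty and
  -- the factor `card ι` is not zero.
  by_cases htop : ∫⁻ x, ‖Y x‖ₑ ^ 2 ∂μ = ∞
  · rw [htop, ENNReal.mul_top (by simp)]
    simp
  have hYL : MemLp Y 2 μ := memLp_of_lintegral_enorm_sq_ne_top hY.aestronglyMeasurable htop
  have hind : iIndepFun (fun (i : ι) (w : ι → 𝒲) => Y (w i)) (Measure.pi fun _ => μ) :=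
    iIndepFun_pi fun _ => hY.aemeasurable
  have hmp : ∀ i : ι, MeasurePreserving (fun w : ι → 𝒲 => w i) (Measure.pi fun _ => μ) μ :=
    fun i => measurePreserving_eval _ i
  have hZ : ∀ i : ι, MemLp (fun w : ι → 𝒲 => Y (w i)) 2 (Measure.pi fun _ => μ) := fun i =>
    hYL.comp_measurePreserving (hmp i)
  have hmain := integral_norm_sum_sq_le hind hZ (fun i => hY.comp (measurable_pi_apply i))
    (e := ∫ x, Y x ∂μ) (κ := ∫ x, ‖Y x‖ ^ 2 ∂μ)
    (fun i => integral_comp_eval_pi μ i hY.aestronglyMeasurable)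
    (fun i => (integral_comp_eval_pi μ (f := fun x => ‖Y x‖ ^ 2) i
      (hY.norm.pow_const 2).aestronglyMeasurable).le)
    Finset.univ
  have hS : MemLp (fun w : ι → 𝒲 => ∑ i, Y (w i)) 2 (Measure.pi fun _ => μ) :=
    memLp_finsetSum Finset.univ fun j _ => hZ j
  have e1 := lintegral_enorm_pow_eq_ofReal (k := 2) two_ne_zero hS
  have e2 := lintegral_enorm_pow_eq_ofReal (k := 2) two_ne_zero hYL
  rw [e1, e2, ← ofReal_norm (∫ x, Y x ∂μ), ← ENNReal.ofReal_natCast (Fintype.card ι),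
    ← ENNReal.ofReal_pow (by positivity), ← ENNReal.ofReal_pow (by positivity),
    ← ENNReal.ofReal_mul (by positivity), ← ENNReal.ofReal_mul (by positivity),
    ← ENNReal.ofReal_add (by positivity)
      (mul_nonneg (by positivity) (integral_nonneg fun x => by positivity))]
  exact ENNReal.ofReal_le_ofReal (by simpa using hmain)

/-- Fourth moment of a sum of independent centred variables. -/
theorem integral_sum_pow_four_le [IsProbabilityMeasure P] {Z : ι → Ω → ℝ} (hZ : iIndepFun Z P)
    (hL4 : ∀ i, MemLp (Z i) 4 P) (hm : ∀ i, Measurable (Z i)) {κ : ℝ}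
    (hmean : ∀ i, ∫ ω, Z i ω ∂P = 0) (hκ : ∀ i, ∫ ω, Z i ω ^ 4 ∂P ≤ κ) (t : Finset ι) :
    ∫ ω, (∑ i ∈ t, Z i ω) ^ 4 ∂P ≤ 3 * (t.card : ℝ) ^ 2 * κ := by
  classical
  have hpow : ∀ {f : Ω → ℝ}, MemLp f 4 P → ∀ k ≤ 4, Integrable (fun ω => f ω ^ k) P := by
    intro f hf k hk
    rcases Nat.eq_zero_or_pos k with rfl | hk0
    · simp
    have : MemLp f k P := hf.mono_exponent (by exact_mod_cast hk)
    have h := this.integrable_norm_pow hk0.ne'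
    refine h.mono' (hf.1.pow k) (ae_of_all _ fun ω => by simp)
  have hL2 : ∀ i, MemLp (Z i) 2 P := fun i => (hL4 i).mono_exponent (by norm_num)
  rcases isEmpty_or_nonempty ι with hι | ⟨⟨i₀⟩⟩
  · simp [Finset.eq_empty_of_isEmpty t]
  have hκ0 : 0 ≤ κ := le_trans (integral_nonneg fun ω => by positivity) (hκ i₀)
  -- (E Z²)² ≤ E Z⁴, because the variance of Z² is nonnegative.
  have hsq : ∀ i, ∫ ω, Z i ω ^ 2 ∂P ≤ √κ := by
    intro i
    refine Real.le_sqrt_of_sq_le (le_trans ?_ (hκ i))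
    have hv := variance_nonneg (fun ω => Z i ω ^ 2) P
    have h2 : MemLp (fun ω => Z i ω ^ 2) 2 P := by
      refine memLp_two_iff_integrable_sq ((hL4 i).1.pow 2) |>.2 ?_
      simpa [← pow_mul] using hpow (hL4 i) 4 le_rfl
    rw [variance_eq_sub h2] at hv
    simp only [Pi.pow_apply, ← pow_mul] at hv
    norm_num at hv
    linarith
  induction t using Finset.induction_on with
  | empty => simp
  | insert i t hi ih =>
    set S : Ω → ℝ := fun ω => ∑ j ∈ t, Z j ω with hSdef
    have hSm : Measurable S := Finset.measurable_fun_sum t fun j _ => hm j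
    have hS : MemLp S 4 P := memLp_finsetSum t fun j _ => hL4 j
    have hind : IndepFun S (Z i) P := by
      have := hZ.indepFun_finsetSum_of_notMem hm hi
      convert this using 1
      ext ω
      simp [hSdef]
    have hmul : ∀ a b : ℕ, a ≤ 4 → b ≤ 4 → Integrable (fun ω => S ω ^ a * Z i ω ^ b) P ∧
        ∫ ω, S ω ^ a * Z i ω ^ b ∂P = (∫ ω, S ω ^ a ∂P) * ∫ ω, Z i ω ^ b ∂P := by
      intro a b ha hb
      have hi' : IndepFun (fun ω => S ω ^ a) (fun ω => Z i ω ^ b) P :=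
        hind.comp (φ := fun x : ℝ => x ^ a) (ψ := fun x : ℝ => x ^ b)
          (measurable_id.pow_const a) (measurable_id.pow_const b)
      exact ⟨hi'.integrable_mul (hpow hS a ha) (hpow (hL4 i) b hb),
        hi'.integral_fun_mul_eq_mul_integral (hpow hS a ha).1 (hpow (hL4 i) b hb).1⟩
    have hS0 : ∫ ω, S ω ∂P = 0 := by
      rw [hSdef, integral_finsetSum _ fun j _ => (hL2 j).integrable (by norm_num)]
      simp [hmean]
    have hS2 : ∫ ω, S ω ^ 2 ∂P ≤ t.card * √κ := by
      have := integral_norm_sum_sq_le hZ hL2 hm (e := 0) (κ := √κ) hmean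
        (fun i => by simpa using hsq i) t
      simpa using this
    -- The trivial powers are kept so that every term has the form treated by `hmul`. The terms S³Z
    -- and SZ³ then vanish, since S and Z are centred.
    have hexp : ∀ ω, (∑ j ∈ insert i t, Z j ω) ^ 4 = S ω ^ 4 * Z i ω ^ 0
        + 4 * (S ω ^ 3 * Z i ω ^ 1) + 6 * (S ω ^ 2 * Z i ω ^ 2) + 4 * (S ω ^ 1 * Z i ω ^ 3)
        + S ω ^ 0 * Z i ω ^ 4 := fun ω => by
      rw [Finset.sum_insert hi]
      simp only [hSdef]
      ring
    have i40 := (hmul 4 0 (by norm_num) (by norm_num)).1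
    have i31 := (hmul 3 1 (by norm_num) (by norm_num)).1.const_mul 4
    have i22 := (hmul 2 2 (by norm_num) (by norm_num)).1.const_mul 6
    have i13 := (hmul 1 3 (by norm_num) (by norm_num)).1.const_mul 4
    have i04 := (hmul 0 4 (by norm_num) (by norm_num)).1
    simp_rw [hexp]
    rw [integral_add (((i40.fun_add i31).fun_add i22).fun_add i13) i04,
      integral_add ((i40.fun_add i31).fun_add i22) i13, integral_add (i40.fun_add i31) i22,
      integral_add i40 i31, integral_const_mul, integral_const_mul, integral_const_mul,
      (hmul 4 0 (by norm_num) (by norm_num)).2, (hmul 3 1 (by norm_num) (by norm_num)).2,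
      (hmul 2 2 (by norm_num) (by norm_num)).2, (hmul 1 3 (by norm_num) (by norm_num)).2,
      (hmul 0 4 (by norm_num) (by norm_num)).2, Finset.card_insert_of_notMem hi]
    simp only [pow_one, pow_zero, hS0, hmean, integral_const, probReal_univ, smul_eq_mul]
    -- With t summands so far, the induction closes by 3t²κ + 6tκ + κ ≤ 3(t + 1)²κ.
    have hprod : (∫ ω, S ω ^ 2 ∂P) * ∫ ω, Z i ω ^ 2 ∂P ≤ t.card * κ := by
      calc (∫ ω, S ω ^ 2 ∂P) * ∫ ω, Z i ω ^ 2 ∂P ≤ (t.card * √κ) * √κ :=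
            mul_le_mul hS2 (hsq i) (integral_nonneg fun ω => by positivity) (by positivity)
        _ = t.card * κ := by rw [mul_assoc, Real.mul_self_sqrt hκ0]
    push_cast
    nlinarith [hκ i]

end IidSums

/-! ### Linearization of the moment functions in the nuisance parameter. -/

section Linearization

variable {𝒲 𝒳 : Type*} {p : ℕ}

theorem norm_le_of_abs_apply_basisVec_le
    (B : EuclideanSpace ℝ (Fin p) →L[ℝ] EuclideanSpace ℝ (Fin p) →L[ℝ] ℝ) {C : ℝ} (hC : 0 ≤ C)
    (h : ∀ i j, |B (basisVec i) (basisVec j)| ≤ C) : ‖B‖ ≤ (p : ℝ) ^ 2 * C := by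
  have hrep : ∀ x : EuclideanSpace ℝ (Fin p), x = ∑ i, x i • basisVec i := by
    intro x
    ext j
    simp [basisVec, Pi.single_apply]
  have hco : ∀ (x : EuclideanSpace ℝ (Fin p)) i, ‖x i‖ ≤ ‖x‖ := fun x i => PiLp.norm_apply_le x i
  refine B.opNorm_le_bound₂ (by positivity) fun x y => ?_
  conv_lhs => rw [hrep x, hrep y]
  simp only [map_sum, map_smul, sum_apply, smul_apply, Finset.smul_sum]
  calc ‖∑ j, ∑ i, y j • x i • B (basisVec i) (basisVec j)‖
      ≤ ∑ j : Fin p, ∑ i : Fin p, ‖y‖ * ‖x‖ * C := by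
        refine (norm_sum_le _ _).trans (Finset.sum_le_sum fun j _ => ?_)
        refine (norm_sum_le _ _).trans (Finset.sum_le_sum fun i _ => ?_)
        rw [norm_smul, norm_smul, ← mul_assoc]
        gcongr
        · exact hco y j
        · exact hco x i
        · exact h i j
    _ = (p : ℝ) ^ 2 * C * ‖x‖ * ‖y‖ := by
        simp
        ring

/-- First-order Taylor bound on a convex set, from a bound on the second partial derivatives. -/
theorem abs_sub_sub_inner_gradientWithin_le {T : Set (EuclideanSpace ℝ (Fin p))} (hT : Convex ℝ T)
    (hTint : (interior T).Nonempty) {f : EuclideanSpace ℝ (Fin p) → ℝ} (hf : ContDiffOn ℝ 3 f T)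
    {C : ℝ} (hC : 0 ≤ C)
    (h2 : ∀ η ∈ T, ∀ i j : Fin p,
      |iteratedFDerivWithin ℝ 2 f T η ![basisVec i, basisVec j]| ≤ C)
    {x y : EuclideanSpace ℝ (Fin p)} (hx : x ∈ T) (hy : y ∈ T) :
    |f y - f x - inner ℝ (gradientWithin f T x) (y - x)| ≤ (p : ℝ) ^ 2 * C * ‖y - x‖ ^ 2 := by
  -- T need not be open. Uniqueness of derivatives within T identifies the second iterated
  -- derivative with the derivative of `fderivWithin`.
  have hU : UniqueDiffOn ℝ T := uniqueDiffOn_convex hT hTint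
  have hd : DifferentiableOn ℝ f T := hf.differentiableOn (by norm_num)
  have hd' : DifferentiableOn ℝ (fderivWithin ℝ f T) T :=
    (hf.fderivWithin hU (m := 2) (by norm_num)).differentiableOn (by norm_num)
  have hlip : ∀ z ∈ T, ‖fderivWithin ℝ f T z - fderivWithin ℝ f T x‖ ≤
      (p : ℝ) ^ 2 * C * ‖z - x‖ := by
    intro z hz
    refine hT.norm_image_sub_le_of_norm_fderivWithin_le hd' (fun η hη => ?_) hx hz
    refine norm_le_of_abs_apply_basisVec_le _ hC fun i j => ?_
    rw [← iteratedFDerivWithin_two_apply' f hU hη]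
    exact h2 η hη i j
  have hseg : segment ℝ x y ⊆ T := hT.segment_subset hx hy
  -- Mean value inequality on the segment: there f' differs from f'(x) by at most p²C‖y - x‖. The
  -- factor 1/2 of Taylor's formula is given up.
  have key := (convex_segment x y).norm_image_sub_le_of_norm_hasFDerivWithin_le'
    (f := f) (f' := fderivWithin ℝ f T) (φ := fderivWithin ℝ f T x)
    (C := (p : ℝ) ^ 2 * C * ‖y - x‖)
    (fun z hz => ((hd z (hseg hz)).hasFDerivWithinAt).mono hseg)
    (fun z hz => (hlip z (hseg hz)).trans (by
      gcongr
      obtain ⟨a, b, ha, hb, hab, rfl⟩ := hz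
      have : a • x + b • y - x = b • (y - x) := by
        rw [show a = 1 - b by linarith]
        module
      rw [this, norm_smul, Real.norm_of_nonneg hb]
      exact mul_le_of_le_one_left (norm_nonneg _) (by linarith)))
    (left_mem_segment ℝ x y) (right_mem_segment ℝ x y)
  have hg : inner ℝ (gradientWithin f T x) (y - x) = fderivWithin ℝ f T x (y - x) := by
    rw [gradientWithin, InnerProductSpace.toDual_symm_apply]
  rw [hg, ← Real.norm_eq_abs]
  exact key.trans (le_of_eq (by ring))

variable [MeasurableSpace 𝒲] [MeasurableSpace 𝒳]

/-- A measurable linear approximation of `ψ(w, ·)` at `η₀(X(w))`: quadratic error, conditional mean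
zero and bounded conditional second moment. -/
structure IsLinearization (F₀ : Measure 𝒲) (X : 𝒲 → 𝒳) (T : Set (EuclideanSpace ℝ (Fin p)))
    (η₀ : 𝒳 → EuclideanSpace ℝ (Fin p)) (ψ : 𝒲 → EuclideanSpace ℝ (Fin p) → ℝ) (L : ℝ)
    (G : 𝒲 → EuclideanSpace ℝ (Fin p)) : Prop where
  measurable : Measurable G
  pos : 0 < L
  approx : ∀ᵐ w ∂F₀, ∀ η ∈ T,
    |ψ w η - ψ w (η₀ (X w)) - inner ℝ (G w) (η - η₀ (X w))| ≤ L * ‖η - η₀ (X w)‖ ^ 2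
  mean_zero : ∀ h : 𝒳 → EuclideanSpace ℝ (Fin p), Measurable h →
    ∫⁻ w, ‖h (X w)‖ₑ ^ 2 ∂F₀ ≠ ∞ → ∫ w, inner ℝ (G w) (h (X w)) ∂F₀ = 0
  second_moment : ∀ h : 𝒳 → EuclideanSpace ℝ (Fin p), Measurable h →
    ∫⁻ w, ‖inner ℝ (G w) (h (X w))‖ₑ ^ 2 ∂F₀ ≤ ENNReal.ofReal L * ∫⁻ w, ‖h (X w)‖ₑ ^ 2 ∂F₀

/-- The image under X of the measure with density g is at most C times the law of X, as one sees on
the sets X⁻¹(s), where g may be replaced by its conditional expectation. Comparing measures rather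
than functions allows k with values in [0, ∞] and no integrability condition. -/
theorem lintegral_mul_comp_le_of_condExp_le {F₀ : Measure 𝒲} [IsProbabilityMeasure F₀] {X : 𝒲 → 𝒳}
    (hX : Measurable X) {g : 𝒲 → ℝ} (hgm : Measurable g) (hg0 : ∀ w, 0 ≤ g w)
    (hg : Integrable g F₀) {C : ℝ}
    (hC : ∀ᵐ w ∂F₀, (F₀[g | MeasurableSpace.comap X inferInstance]) w ≤ C)
    {k : 𝒳 → ℝ≥0∞} (hk : Measurable k) :
    ∫⁻ w, ENNReal.ofReal (g w) * k (X w) ∂F₀ ≤ ENNReal.ofReal C * ∫⁻ w, k (X w) ∂F₀ := by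
  have hle : (F₀.withDensity fun w => ENNReal.ofReal (g w)).map X ≤
      ENNReal.ofReal C • F₀.map X := by
    refine Measure.le_iff.2 fun s hs => ?_
    rw [Measure.map_apply hX hs, withDensity_apply _ (hX hs), Measure.smul_apply,
      Measure.map_apply hX hs, ← ofReal_integral_eq_lintegral_ofReal hg.integrableOn
        (ae_of_all _ hg0), ← setIntegral_condExp hX.comap_le hg ⟨s, hs, rfl⟩, smul_eq_mul]
    have hbound : ∫ w in X ⁻¹' s, (F₀[g | MeasurableSpace.comap X inferInstance]) w ∂F₀ ≤
        ∫ _ in X ⁻¹' s, C ∂F₀ :=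
      setIntegral_mono_ae integrable_condExp.integrableOn (by simp) hC
    refine (ENNReal.ofReal_le_ofReal hbound).trans ?_
    rw [setIntegral_const, smul_eq_mul, mul_comm, ENNReal.ofReal_mul' (by simp)]
    simp
  calc ∫⁻ w, ENNReal.ofReal (g w) * k (X w) ∂F₀
      = ∫⁻ x, k x ∂((F₀.withDensity fun w => ENNReal.ofReal (g w)).map X) := by
        rw [lintegral_map hk hX, lintegral_withDensity_eq_lintegral_mul _ (by fun_prop)
          (show Measurable fun a => k (X a) from hk.comp hX)]
        rfl
    _ ≤ ∫⁻ x, k x ∂(ENNReal.ofReal C • F₀.map X) := lintegral_mono' hle le_rfl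
    _ = ENNReal.ofReal C * ∫⁻ w, k (X w) ∂F₀ := by
        rw [lintegral_smul_measure, lintegral_map hk hX, smul_eq_mul]

theorem integral_mul_comp_eq_zero_of_condExp_eq_zero {F₀ : Measure 𝒲} [IsProbabilityMeasure F₀]
    {X : 𝒲 → 𝒳} (hX : Measurable X) {g : 𝒲 → ℝ} (hg : Integrable g F₀)
    (hC : F₀[g | MeasurableSpace.comap X inferInstance] =ᵐ[F₀] 0)
    {k : 𝒳 → ℝ} (hk : Measurable k) (hgk : Integrable (fun w => g w * k (X w)) F₀) :
    ∫ w, g w * k (X w) ∂F₀ = 0 := by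
  have hsm : StronglyMeasurable[MeasurableSpace.comap X inferInstance] (fun w => k (X w)) :=
    (hk.comp (comap_measurable X)).stronglyMeasurable
  have h := condExp_mul_of_stronglyMeasurable_right (m := MeasurableSpace.comap X inferInstance)
    (μ := F₀) (f := g) hsm hgk hg
  have h0 : F₀[(g * fun w => k (X w)) | MeasurableSpace.comap X inferInstance] =ᵐ[F₀] 0 := by
    filter_upwards [h, hC] with w h1 h2
    rw [h1, Pi.mul_apply, h2]
    simp
  have := integral_condExp (μ := F₀) (f := g * fun w => k (X w)) hX.comap_le
  rw [integral_congr_ae h0] at this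
  simpa using this.symm

/-- G is a measurable version of the gradient of ψ at η₀, which is itself only known to be a.e.
strongly measurable; later Fubini arguments need G measurable. Taylor's bound gives the quadratic
error, orthogonality the zero mean, and the bound on the conditional second moments the last
property. -/
theorem MomentRegular.exists_isLinearization {F₀ : Measure 𝒲} [IsProbabilityMeasure F₀]
    {X : 𝒲 → 𝒳} (hX : Measurable X) {T : Set (EuclideanSpace ℝ (Fin p))} (hT : Convex ℝ T)
    (hTint : (interior T).Nonempty) {η₀ : 𝒳 → EuclideanSpace ℝ (Fin p)} (hη₀T : ∀ x, η₀ x ∈ T)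
    {ψ : 𝒲 → EuclideanSpace ℝ (Fin p) → ℝ} {M C₁ C₂ C₃ : ℝ} (hC₁ : 0 < C₁) (hC₂ : 0 < C₂)
    (h : MomentRegular F₀ X T η₀ M C₁ C₂ C₃ ψ) :
    ∃ L G, IsLinearization F₀ X T η₀ ψ L G := by
  set D : 𝒲 → EuclideanSpace ℝ (Fin p) := fun w => gradientWithin (ψ w) T (η₀ (X w)) with hD
  obtain ⟨G, hGsm, hDG⟩ := h.memLp_grad.1
  have hGm : Measurable G := hGsm.measurable
  have hG4 : MemLp G 4 F₀ := (memLp_congr_ae hDG).1 h.memLp_grad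
  have hG2 : MemLp G 2 F₀ := hG4.mono_exponent (by norm_num)
  have hcoord : ∀ (v : EuclideanSpace ℝ (Fin p)) i, ‖v i‖ ≤ ‖v‖ := fun v i => PiLp.norm_apply_le v i
  have hGi : ∀ i, MemLp (fun w => G w i) 2 F₀ := fun i =>
    hG2.mono (by fun_prop) (ae_of_all _ fun w => hcoord _ i)
  have hinner : ∀ w (v : EuclideanSpace ℝ (Fin p)), inner ℝ (G w) v = ∑ i, G w i * v i := by
    intro w v
    simp [PiLp.inner_apply, mul_comm]
  have hcond : ∀ i, F₀[fun w => G w i | MeasurableSpace.comap X inferInstance] =ᵐ[F₀] 0 := by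
    intro i
    have h1 := ((EuclideanSpace.proj i : EuclideanSpace ℝ (Fin p) →L[ℝ] ℝ)).comp_condExp_comm
      (m := MeasurableSpace.comap X inferInstance) (hG2.integrable (by norm_num))
    have h2 : F₀[G | MeasurableSpace.comap X inferInstance] =ᵐ[F₀] 0 :=
      (condExp_congr_ae hDG.symm).trans h.orthogonal
    filter_upwards [h1, h2] with w hw1 hw2
    have hw3 : (F₀[fun w => G w i | MeasurableSpace.comap X inferInstance]) w = _ := hw1.symm
    rw [hw3]
    simp [hw2]
  have hvar : ∀ i, ∀ᵐ w ∂F₀,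
      (F₀[fun w => G w i ^ 2 | MeasurableSpace.comap X inferInstance]) w ≤ C₁ := by
    intro i
    have hcongr : (fun w => D w i * D w i) =ᵐ[F₀] fun w => G w i ^ 2 := by
      filter_upwards [hDG] with w hw
      rw [show D w = G w from hw]
      ring
    filter_upwards [h.condVar_le i i, condExp_congr_ae hcongr
      (m := MeasurableSpace.comap X inferInstance)] with w h1 h2
    rw [← h2]
    exact (le_abs_self _).trans h1
  -- p²C₂ is the Taylor constant, pC₁ bounds the conditional mean of ‖G‖², and 1 makes the sum
  -- positive even for p = 0.
  refine ⟨(p : ℝ) ^ 2 * C₂ + p * C₁ + 1, G, hGm, by positivity, ?_, ?_, ?_⟩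
  · filter_upwards [hDG, h.deriv_two_le] with w hw h2 η hη
    have hle : (p : ℝ) ^ 2 * C₂ ≤ (p : ℝ) ^ 2 * C₂ + p * C₁ + 1 := by
      nlinarith [show 0 ≤ (p : ℝ) * C₁ by positivity]
    refine le_trans ?_ (mul_le_mul_of_nonneg_right hle (sq_nonneg ‖η - η₀ (X w)‖))
    rw [← show D w = G w from hw]
    exact abs_sub_sub_inner_gradientWithin_le hT hTint (h.contDiffOn w) hC₂.le h2 (hη₀T _) hη
  · intro k hk hfin
    have hk2 : MemLp (fun w => k (X w)) 2 F₀ :=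
      memLp_of_lintegral_enorm_sq_ne_top (hk.comp hX).aestronglyMeasurable hfin
    have hkX : Measurable fun w => k (X w) := hk.comp hX
    have hki : ∀ i, MemLp (fun w => k (X w) i) 2 F₀ := fun i =>
      hk2.mono (Measurable.aestronglyMeasurable (by fun_prop)) (ae_of_all _ fun w => hcoord _ i)
    simp_rw [hinner]
    have hprod : ∀ i, Integrable (fun w => G w i * k (X w) i) F₀ := fun i =>
      (hGi i).integrable_mul (hki i)
    rw [integral_finsetSum _ fun i _ => hprod i]
    refine Finset.sum_eq_zero fun i _ => ?_
    exact integral_mul_comp_eq_zero_of_condExp_eq_zero hX ((hGi i).integrable (by norm_num))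
      (hcond i) (k := fun x => k x i) (by fun_prop) (hprod i)
  · intro k hk
    -- By Cauchy–Schwarz only ‖G‖² = ∑ G_i² enters, hence only the diagonal of the conditional
    -- second moment matrix.
    have hpt : ∀ w, ‖inner ℝ (G w) (k (X w))‖ₑ ^ 2 ≤
        ∑ i, ENNReal.ofReal (G w i ^ 2) * ‖k (X w)‖ₑ ^ 2 := by
      intro w
      have h1 : |inner ℝ (G w) (k (X w))| ≤ ‖G w‖ * ‖k (X w)‖ := abs_real_inner_le_norm _ _
      have h2 : ‖G w‖ ^ 2 = ∑ i, G w i ^ 2 := by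
        rw [EuclideanSpace.norm_sq_eq]
        simp
      rw [← Finset.sum_mul, ← ENNReal.ofReal_sum_of_nonneg fun i _ => sq_nonneg _, ← h2,
        ENNReal.ofReal_pow (norm_nonneg _), ofReal_norm, ← mul_pow]
      gcongr
      rw [← ofReal_norm, ← ofReal_norm, ← ofReal_norm, ← ENNReal.ofReal_mul (norm_nonneg _)]
      exact ENNReal.ofReal_le_ofReal h1
    calc ∫⁻ w, ‖inner ℝ (G w) (k (X w))‖ₑ ^ 2 ∂F₀
        ≤ ∫⁻ w, ∑ i, ENNReal.ofReal (G w i ^ 2) * ‖k (X w)‖ₑ ^ 2 ∂F₀ := lintegral_mono hpt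
      _ = ∑ i, ∫⁻ w, ENNReal.ofReal (G w i ^ 2) * ‖k (X w)‖ₑ ^ 2 ∂F₀ :=
          lintegral_finsetSum _ fun i _ => by fun_prop
      _ ≤ ∑ _i : Fin p, ENNReal.ofReal C₁ * ∫⁻ w, ‖k (X w)‖ₑ ^ 2 ∂F₀ := by
          refine Finset.sum_le_sum fun i _ => ?_
          exact lintegral_mul_comp_le_of_condExp_le hX (by fun_prop) (fun w => sq_nonneg _)
            (hGi i).integrable_sq (hvar i) (k := fun x => ‖k x‖ₑ ^ 2) (by fun_prop)
      _ = ENNReal.ofReal (p * C₁) * ∫⁻ w, ‖k (X w)‖ₑ ^ 2 ∂F₀ := by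
          rw [Finset.sum_const, Finset.card_univ, Fintype.card_fin, nsmul_eq_mul, ← mul_assoc,
            ENNReal.ofReal_mul (by positivity), ENNReal.ofReal_natCast]
      _ ≤ _ := by
          gcongr
          nlinarith [show 0 ≤ (p : ℝ) ^ 2 * C₂ by positivity]

end Linearization

/-! ### Sample splitting and independence across folds. -/

section Folds

variable {𝒲 : Type*} [MeasurableSpace 𝒲] {n K : ℕ}

theorem measurable_offFold (s : Fin n → Fin K) (k : Fin K) :
    Measurable (offFold s k : (Fin n → 𝒲) → _) :=
  measurable_pi_lambda _ fun i => measurable_pi_apply i.1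

/-- The data outside a fold and the data in the fold are independent. -/
theorem lintegral_offFold_fold (F₀ : Measure 𝒲) [IsProbabilityMeasure F₀] (s : Fin n → Fin K)
    (k : Fin K) {F : ({i : Fin n // s i ≠ k} → 𝒲) → ({i : Fin n // s i = k} → 𝒲) → ℝ≥0∞}
    (hF : Measurable (Function.uncurry F)) :
    ∫⁻ w : Fin n → 𝒲, F (offFold s k w) (fun i => w i) ∂(Measure.pi fun _ => F₀) =
      ∫⁻ d, ∫⁻ e, F d e ∂(Measure.pi fun _ => F₀) ∂(Measure.pi fun _ => F₀) := by
  have hmp := measurePreserving_piEquivPiSubtypeProd (fun _ : Fin n => F₀) (fun i => s i = k)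
  have h2 := hmp.lintegral_comp (f := fun q => F q.2 q.1)
    (hF.comp (measurable_snd.prodMk measurable_fst))
  refine Eq.trans ?_ (h2.trans ?_)
  · rfl
  · exact lintegral_prod_symm' _ (hF.comp (measurable_snd.prodMk measurable_fst))

theorem lintegral_offFold_eval (F₀ : Measure 𝒲) [IsProbabilityMeasure F₀] (s : Fin n → Fin K)
    {k : Fin K} {i : Fin n} (hi : s i = k)
    {F : ({i : Fin n // s i ≠ k} → 𝒲) → 𝒲 → ℝ≥0∞} (hF : Measurable (Function.uncurry F)) :
    ∫⁻ w : Fin n → 𝒲, F (offFold s k w) (w i) ∂(Measure.pi fun _ => F₀) =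
      ∫⁻ d, ∫⁻ x, F d x ∂F₀ ∂(Measure.pi fun _ => F₀) := by
  rw [lintegral_offFold_fold F₀ s k (F := fun d e => F d (e ⟨i, hi⟩))
    (hF.comp (measurable_fst.prodMk ((measurable_pi_apply _).comp measurable_snd)))]
  refine lintegral_congr fun d => ?_
  exact (measurePreserving_eval (fun _ : {i : Fin n // s i = k} => F₀) ⟨i, hi⟩).lintegral_comp
    (f := F d) (hF.comp measurable_prodMk_left)

/-- Averaging over a random split that is independent of the data. -/
theorem lintegral_comp_split {Ω : Type*} [MeasurableSpace Ω] {P : Measure Ω}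
    [IsProbabilityMeasure P] {F₀ : Measure 𝒲} [IsProbabilityMeasure F₀] {W : ℕ → Ω → 𝒲}
    (hW : ∀ i, Measurable (W i)) (hlaw : ∀ i, P.map (W i) = F₀) (hindep : iIndepFun W P)
    {S : Ω → Fin n → Fin K} (hS : Measurable S)
    (hSindep : IndepFun S (fun ω (i : ℕ) => W i ω) P)
    {f : (Fin n → Fin K) → (Fin n → 𝒲) → ℝ≥0∞} (hf : ∀ s, Measurable (f s)) :
    ∫⁻ ω, f (S ω) (fun i => W i ω) ∂P =
      ∑ s, P (S ⁻¹' {s}) * ∫⁻ w, f s w ∂(Measure.pi fun _ => F₀) := by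
  classical
  have hWn : Measurable fun ω (i : Fin n) => W i ω := measurable_pi_lambda _ fun i => hW i
  have hlawn : P.map (fun ω (i : Fin n) => W i ω) = Measure.pi fun _ => F₀ := by
    have h1 : iIndepFun (fun (i : Fin n) => W i) P := hindep.precomp Fin.val_injective
    rw [(iIndepFun_iff_map_fun_eq_pi_map fun i : Fin n => (hW i).aemeasurable).1 h1]
    simp_rw [hlaw]
  have hindn : IndepFun S (fun ω (i : Fin n) => W i ω) P :=
    hSindep.comp (φ := id) (ψ := fun (v : ℕ → 𝒲) (i : Fin n) => v i) measurable_id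
      (measurable_pi_lambda _ fun i => measurable_pi_apply _)
  have hsplit : ∀ ω, f (S ω) (fun i => W i ω) =
      ∑ s, ({s} : Set (Fin n → Fin K)).indicator 1 (S ω) * f s (fun i => W i ω) := by
    intro ω
    rw [Finset.sum_eq_single (S ω)]
    · simp
    · intro s _ hs
      rw [Set.indicator_of_notMem (by simpa using hs.symm)]
      simp
    · simp
  simp_rw [hsplit]
  have hind : ∀ s : Fin n → Fin K,
      Measurable (({s} : Set (Fin n → Fin K)).indicator (1 : (Fin n → Fin K) → ℝ≥0∞)) :=
    fun s => measurable_one.indicator (measurableSet_singleton s)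
  have hprod : ∀ s : Fin n → Fin K, Measurable fun ω =>
      ({s} : Set (Fin n → Fin K)).indicator (1 : (Fin n → Fin K) → ℝ≥0∞) (S ω) *
        f s (fun i => W i ω) := fun s => ((hind s).comp hS).mul ((hf s).comp hWn)
  rw [lintegral_finsetSum _ fun s _ => hprod s]
  refine Finset.sum_congr rfl fun s _ => ?_
  have := lintegral_mul_eq_lintegral_mul_lintegral_of_indepFun ((hind s).comp hS)
    ((hf s).comp hWn) (hindn.comp (hind s) (hf s))
  simp only [Pi.mul_apply, Function.comp_def] at this
  rw [this, ← hlawn, lintegral_map (hf s) hWn]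
  congr 1
  rw [← lintegral_indicator_one (hS (measurableSet_singleton s))]
  rfl

/-- A bound uniform over deterministic balanced splits survives averaging over the random one, since
unbalanced splits never occur. All moment estimates below can therefore be made for a fixed split
under the product measure. -/
theorem lintegral_comp_split_le {Ω : Type*} [MeasurableSpace Ω] {P : Measure Ω}
    [IsProbabilityMeasure P] {F₀ : Measure 𝒲} [IsProbabilityMeasure F₀] {W : ℕ → Ω → 𝒲}
    (hW : ∀ i, Measurable (W i)) (hlaw : ∀ i, P.map (W i) = F₀) (hindep : iIndepFun W P)
    {S : Ω → Fin n → Fin K} (hS : Measurable S) (hSbal : ∀ ω, IsBalanced (S ω))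
    (hSindep : IndepFun S (fun ω (i : ℕ) => W i ω) P)
    {f : (Fin n → Fin K) → (Fin n → 𝒲) → ℝ≥0∞} (hf : ∀ s, Measurable (f s)) {B : ℝ≥0∞}
    (hB : ∀ s, IsBalanced s → ∫⁻ w, f s w ∂(Measure.pi fun _ => F₀) ≤ B) :
    ∫⁻ ω, f (S ω) (fun i => W i ω) ∂P ≤ B := by
  rw [lintegral_comp_split hW hlaw hindep hS hSindep hf]
  calc _ ≤ ∑ s, P (S ⁻¹' {s}) * B := by
        refine Finset.sum_le_sum fun s _ => ?_
        by_cases hs : IsBalanced s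
        · gcongr
          exact hB s hs
        · have : S ⁻¹' {s} = ∅ := by
            ext ω
            simp only [Set.mem_preimage, Set.mem_singleton_iff, Set.mem_empty_iff_false, iff_false]
            rintro rfl
            exact hs (hSbal ω)
          simp [this]
    _ = B := by
        rw [← Finset.sum_mul, sum_measure_preimage_singleton _
          fun s _ => hS (measurableSet_singleton s)]
        simp

theorem measurable_comp_split {Ω E : Type*} [MeasurableSpace Ω] [MeasurableSpace E]
    {W : ℕ → Ω → 𝒲} (hW : ∀ i, Measurable (W i)) {S : Ω → Fin n → Fin K} (hS : Measurable S)
    {f : (Fin n → Fin K) → (Fin n → 𝒲) → E} (hf : ∀ s, Measurable (f s)) :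
    Measurable fun ω => f (S ω) (fun i => W i ω) := by
  have h1 : Measurable (Function.uncurry f) := measurable_from_prod_countable_right hf
  exact h1.comp (hS.prodMk (measurable_pi_lambda _ fun j : Fin n => hW j))

theorem card_offFold (s : Fin n → Fin K) (k : Fin K) :
    Fintype.card {i // s i ≠ k} = n - Fintype.card {i // s i = k} := by
  simp [Fintype.card_subtype_compl fun i => s i = k]

/-- A fold has at most n/4 + 1 ≤ n/2 elements. Hence rates in n₀ and in n agree up to constants. -/
theorem IsBalanced.half_le_card_offFold {s : Fin n → Fin K} (hs : IsBalanced s) (hn : 4 ≤ n)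
    (hK : 4 ≤ K) (k : Fin K) : (n : ℝ) / 2 ≤ (Fintype.card {i // s i ≠ k} : ℝ) := by
  have h1 : Fintype.card {i // s i = k} ≤ n / K + 1 := by rcases hs k with h | h <;> omega
  have h2 : n / K ≤ n / 4 := Nat.div_le_div_left hK (by norm_num)
  have h3 : n ≤ 2 * Fintype.card {i // s i ≠ k} := by
    rw [card_offFold]
    omega
  have : (n : ℝ) ≤ 2 * (Fintype.card {i // s i ≠ k} : ℝ) := by exact_mod_cast h3
  linarith

end Folds

/-! ### Mean squared error of the nuisance estimates. -/

section NuisanceRate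


theorem enorm_add_sq_le {E : Type*} [NormedAddCommGroup E] (x y : E) :
    ‖x + y‖ₑ ^ 2 ≤ 4 * (‖x‖ₑ ^ 2 + ‖y‖ₑ ^ 2) := by
  have key : ∀ a b : ℝ≥0∞, a ≤ b → (a + b) ^ 2 ≤ 4 * (a ^ 2 + b ^ 2) := by
    intro a b hab
    calc (a + b) ^ 2 ≤ (b + b) ^ 2 := by gcongr
      _ = 4 * b ^ 2 := by ring
      _ ≤ 4 * (a ^ 2 + b ^ 2) := by gcongr; exact le_add_self
  refine (pow_le_pow_left' (enorm_add_le x y) 2).trans ?_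
  rcases le_total ‖x‖ₑ ‖y‖ₑ with h | h
  · exact key _ _ h
  · rw [add_comm ‖x‖ₑ, add_comm (‖x‖ₑ ^ 2)]
    exact key _ _ h

variable {Ω 𝒲 𝒳 : Type*} {p : ℕ}

/-- The leading part of the stochastic expansion of a nuisance estimator, computed from the
data `d`. -/
noncomputable def leadingPart {ι : Type*} [Fintype ι] (X : 𝒲 → 𝒳) (φ₁ φ₂ : ℝ)
    (δ : ℕ → 𝒲 → 𝒳 → EuclideanSpace ℝ (Fin p)) (b : ℕ → 𝒳 → 𝒳 → EuclideanSpace ℝ (Fin p))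
    (d : ι → 𝒲) (x : 𝒳) : EuclideanSpace ℝ (Fin p) :=
  let m : ℕ := Fintype.card ι
  (m : ℝ) ^ (-(1 / 2) : ℝ) • ∑ l, (m : ℝ) ^ (-φ₁) • δ m (d l) x +
    (m : ℝ)⁻¹ • ∑ l, (m : ℝ) ^ (-φ₂) • b m (X (d l)) x

/-- `remainder` is the expansion solved for its last term, so this only undoes the scaling by a
power of m, which needs m > 0. -/
theorem crossFit_sub_eq {n K : ℕ} (X : 𝒲 → 𝒳) (η₀ : 𝒳 → EuclideanSpace ℝ (Fin p)) (φ₁ φ₂ : ℝ)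
    (δ : ℕ → 𝒲 → 𝒳 → EuclideanSpace ℝ (Fin p)) (b : ℕ → 𝒳 → 𝒳 → EuclideanSpace ℝ (Fin p))
    (est : NuisanceEstimator 𝒲 𝒳 p n K) (s : Fin n → Fin K) (w : Fin n → 𝒲) (i : Fin n) {m : ℕ}
    (hm : 0 < m) (hcard : Fintype.card {l // s l ≠ s i} = m) :
    crossFit X est s w i - η₀ (X (w i)) =
      leadingPart X φ₁ φ₂ δ b (offFold s (s i) w) (X (w i))
      + (m : ℝ) ^ (-(2 * min φ₁ φ₂)) •
        remainder X η₀ φ₁ φ₂ δ b est s (s i) w (X (w i)) := by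
  have hm0 : (0 : ℝ) < m := by exact_mod_cast hm
  simp only [remainder, leadingPart, hcard, crossFit, offFold]
  rw [smul_smul, ← Real.rpow_add hm0, neg_add_cancel, Real.rpow_zero, one_smul]
  abel

variable [MeasurableSpace Ω] [MeasurableSpace 𝒲] [MeasurableSpace 𝒳]

theorem lintegral_enorm_smul_sum_sq_le {ι : Type*} [Fintype ι] {F₀ : Measure 𝒲}
    [IsProbabilityMeasure F₀] {Y : 𝒲 → EuclideanSpace ℝ (Fin p)} (hY : Measurable Y) (a : ℝ) :
    ∫⁻ d : ι → 𝒲, ‖a • ∑ l, Y (d l)‖ₑ ^ 2 ∂(Measure.pi fun _ => F₀) ≤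
      ENNReal.ofReal ((a * Fintype.card ι) ^ 2) * ‖∫ w, Y w ∂F₀‖ₑ ^ 2 +
        ENNReal.ofReal (a ^ 2 * Fintype.card ι) * ∫⁻ w, ‖Y w‖ₑ ^ 2 ∂F₀ := by
  have ha : ‖a‖ₑ ^ 2 = ENNReal.ofReal (a ^ 2) := by
    rw [← ofReal_norm, ← ENNReal.ofReal_pow (norm_nonneg _)]
    simp
  simp_rw [enorm_smul, mul_pow]
  rw [lintegral_const_mul _ (by fun_prop), ha]
  refine (mul_le_mul_right (lintegral_enorm_sum_sq_le F₀ hY) _).trans (le_of_eq ?_)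
  rw [ENNReal.ofReal_mul (sq_nonneg a), ENNReal.ofReal_mul (sq_nonneg a),
    ENNReal.ofReal_pow (Nat.cast_nonneg (Fintype.card ι)), ENNReal.ofReal_natCast]
  ring

/-- The order of integration is exchanged on the right so that each part can be averaged over the
data at a fixed covariate value, where it is an i.i.d. sum. -/
theorem lintegral_lintegral_enorm_add_sq_le {α β E : Type*} [MeasurableSpace α]
    [MeasurableSpace β] {μ : Measure α} {ν : Measure β} [SFinite μ] [SFinite ν]
    [NormedAddCommGroup E] [MeasurableSpace E] [BorelSpace E] [SecondCountableTopology E]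
    {A B : α → β → E} (hA : Measurable (Function.uncurry A))
    (hB : Measurable (Function.uncurry B)) :
    ∫⁻ d, ∫⁻ w, ‖A d w + B d w‖ₑ ^ 2 ∂ν ∂μ ≤
      4 * (∫⁻ w, ∫⁻ d, ‖A d w‖ₑ ^ 2 ∂μ ∂ν + ∫⁻ w, ∫⁻ d, ‖B d w‖ₑ ^ 2 ∂μ ∂ν) := by
  have hA' : Measurable (Function.uncurry fun d w => ‖A d w‖ₑ ^ 2) := hA.enorm.pow_const 2
  have hB' : Measurable (Function.uncurry fun d w => ‖B d w‖ₑ ^ 2) := hB.enorm.pow_const 2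
  have hA1 : Measurable fun d => ∫⁻ w, ‖A d w‖ₑ ^ 2 ∂ν := hA'.lintegral_prod_right'
  have hB1 : Measurable fun d => ∫⁻ w, ‖B d w‖ₑ ^ 2 ∂ν := hB'.lintegral_prod_right'
  rw [← lintegral_lintegral_swap hA'.aemeasurable, ← lintegral_lintegral_swap hB'.aemeasurable,
    ← lintegral_add_left hA1, ← lintegral_const_mul _ (hA1.fun_add hB1)]
  refine lintegral_mono fun d => ?_
  have hA2 : Measurable fun w => ‖A d w‖ₑ ^ 2 := hA'.comp measurable_prodMk_left
  have hB2 : Measurable fun w => ‖B d w‖ₑ ^ 2 := hB'.comp measurable_prodMk_left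
  rw [← lintegral_add_left hA2, ← lintegral_const_mul _ (hA2.fun_add hB2)]
  exact lintegral_mono fun w => enorm_add_sq_le _ _

theorem rpow_neg_two_mul_eq_sq {m : ℝ} (hm : 0 ≤ m) (c : ℝ) : m ^ (-(2 * c)) = (m ^ (-c)) ^ 2 := by
  rw [← Real.rpow_natCast, ← Real.rpow_mul hm]
  congr 1
  push_cast
  ring

theorem enorm_rpow_neg_sq {m : ℝ} (hm : 0 ≤ m) (c : ℝ) :
    ‖m ^ (-c)‖ₑ ^ 2 = ENNReal.ofReal (m ^ (-(2 * c))) := by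
  rw [rpow_neg_two_mul_eq_sq hm, ← ofReal_norm, ← ENNReal.ofReal_pow (norm_nonneg _),
    Real.norm_of_nonneg (by positivity)]

/-- Since Y is centred, only the variance term of the i.i.d. sum remains. The factor m^(-1/2)
compensates the number of summands, leaving the rate m^(-φ). -/
theorem lintegral_stochastic_part_le {ι : Type*} [Fintype ι] {F₀ : Measure 𝒲}
    [IsProbabilityMeasure F₀] {m : ℕ} (hm : 0 < m) (hι : Fintype.card ι = m) (φ : ℝ)
    {Y : 𝒲 → EuclideanSpace ℝ (Fin p)} (hY : Measurable Y) (hzero : ∫ w, Y w ∂F₀ = 0) :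
    ∫⁻ d : ι → 𝒲, ‖(m : ℝ) ^ (-(1 / 2) : ℝ) • ∑ l, (m : ℝ) ^ (-φ) • Y (d l)‖ₑ ^ 2
      ∂(Measure.pi fun _ => F₀) ≤
        ENNReal.ofReal ((m : ℝ) ^ (-(2 * φ))) * ∫⁻ w, ‖Y w‖ₑ ^ 2 ∂F₀ := by
  have hm0 : (0 : ℝ) < m := by exact_mod_cast hm
  have hhalf : ((m : ℝ) ^ (-(1 / 2) : ℝ)) ^ 2 * m = 1 := by
    rw [← rpow_neg_two_mul_eq_sq hm0.le]
    norm_num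
    rw [Real.rpow_neg_one]
    field_simp
  refine (lintegral_enorm_smul_sum_sq_le (F₀ := F₀) (Y := fun w => (m : ℝ) ^ (-φ) • Y w)
    (by fun_prop) _).trans (le_of_eq ?_)
  rw [integral_smul, hzero, hι, hhalf]
  simp_rw [enorm_smul, mul_pow]
  rw [lintegral_const_mul _ (by fun_prop), enorm_rpow_neg_sq hm0.le]
  simp

/-- The average over the data contributes its squared mean and a variance smaller by the factor 1/m.
The squared mean is replaced by 1 plus its fourth power, because the assumption bounds the fourth
moment of the mean. -/
theorem lintegral_bias_part_le {ι : Type*} [Fintype ι] {F₀ : Measure 𝒲}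
    [IsProbabilityMeasure F₀] {X : 𝒲 → 𝒳} (hX : Measurable X) {m : ℕ} (hm : 0 < m)
    (hι : Fintype.card ι = m) (φ : ℝ) {Y : 𝒳 → EuclideanSpace ℝ (Fin p)} (hY : Measurable Y) :
    ∫⁻ d : ι → 𝒲, ‖(m : ℝ)⁻¹ • ∑ l, (m : ℝ) ^ (-φ) • Y (X (d l))‖ₑ ^ 2
      ∂(Measure.pi fun _ => F₀) ≤
        ENNReal.ofReal ((m : ℝ) ^ (-(2 * φ))) * (1 + ‖∫ x', Y x' ∂(F₀.map X)‖ₑ ^ 4) +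
        ENNReal.ofReal (m : ℝ)⁻¹ * ∫⁻ x', ‖(m : ℝ) ^ (-φ) • Y x'‖ₑ ^ 2 ∂(F₀.map X) := by
  have hm0 : (0 : ℝ) < m := by exact_mod_cast hm
  refine (lintegral_enorm_smul_sum_sq_le (F₀ := F₀)
    (Y := fun w => (m : ℝ) ^ (-φ) • Y (X w)) (by fun_prop) _).trans ?_
  rw [integral_smul, hι, ← integral_map hX.aemeasurable hY.aestronglyMeasurable,
    lintegral_map (by fun_prop) hX]
  refine add_le_add ?_ (le_of_eq ?_)
  · rw [inv_mul_cancel₀ hm0.ne', enorm_smul, mul_pow, enorm_rpow_neg_sq hm0.le]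
    simp only [one_pow, ENNReal.ofReal_one, one_mul]
    gcongr
    set y := ‖∫ x', Y x' ∂(F₀.map X)‖ₑ
    rcases le_total y 1 with h1 | h1
    · exact (pow_le_one' h1 2).trans le_self_add
    · exact (pow_le_pow_right' h1 (by norm_num : 2 ≤ 4)).trans le_add_self
  · congr 2
    field_simp

theorem measurable_leadingPart {ι : Type*} [Fintype ι] {X : 𝒲 → 𝒳} (hX : Measurable X)
    (φ₁ φ₂ : ℝ) {δ : ℕ → 𝒲 → 𝒳 → EuclideanSpace ℝ (Fin p)}
    {b : ℕ → 𝒳 → 𝒳 → EuclideanSpace ℝ (Fin p)} (hδ : ∀ m, Measurable (Function.uncurry (δ m)))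
    (hb : ∀ m, Measurable (Function.uncurry (b m))) :
    Measurable (Function.uncurry fun (d : ι → 𝒲) x => leadingPart X φ₁ φ₂ δ b d x) := by
  have h1 : ∀ m l, Measurable fun q : (ι → 𝒲) × 𝒳 => δ m (q.1 l) q.2 := fun m l =>
    (hδ m).comp (f := fun q : (ι → 𝒲) × 𝒳 => (q.1 l, q.2)) (by fun_prop)
  have h2 : ∀ m l, Measurable fun q : (ι → 𝒲) × 𝒳 => b m (X (q.1 l)) q.2 := fun m l =>
    (hb m).comp (f := fun q : (ι → 𝒲) × 𝒳 => (X (q.1 l), q.2)) (by fun_prop)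
  simp only [Function.uncurry_def, leadingPart]
  fun_prop

/-- Mean squared error of the leading part of the stochastic expansion. -/
theorem ExpansionRegular.lintegral_sum_sq_le {ι : Type*} [Fintype ι] {F₀ : Measure 𝒲}
    [IsProbabilityMeasure F₀] {X : 𝒲 → 𝒳} (hX : Measurable X) {φ₁ φ₂ M₁ Cδ Cb : ℝ} {τ : ℕ → ℝ}
    {m : ℕ} (hm : 0 < m) (hι : Fintype.card ι = m)
    {δ' : ℕ → 𝒲 → 𝒳 → EuclideanSpace ℝ (Fin p)} {b' : ℕ → 𝒳 → 𝒳 → EuclideanSpace ℝ (Fin p)}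
    (hδ' : ∀ m, Measurable (Function.uncurry (δ' m)))
    (hb' : ∀ m, Measurable (Function.uncurry (b' m))) (hM₁ : 0 < M₁) (hτ : τ m ≤ 1)
    (h : ExpansionRegular F₀ X φ₁ φ₂ M₁ Cδ Cb τ m (δ' m) (b' m)) :
    ∫⁻ d : ι → 𝒲, ∫⁻ w, ‖leadingPart X φ₁ φ₂ δ' b' d (X w)‖ₑ ^ 2 ∂F₀ ∂(Measure.pi fun _ => F₀)
      ≤ ENNReal.ofReal (8 * (M₁ + 1) * (m : ℝ) ^ (-(2 * min φ₁ φ₂))) := by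
  simp only [leadingPart, hι]
  have hδ := hδ' m
  have hb := hb' m
  generalize δ' m = δ at *
  generalize b' m = b at *
  have hm0 : (0 : ℝ) < m := by exact_mod_cast hm
  have hm1 : (1 : ℝ) ≤ m := by exact_mod_cast hm
  have : IsProbabilityMeasure (F₀.map X) := Measure.isProbabilityMeasure_map hX.aemeasurable
  have hzero : ∀ x, ∫ w, δ w x ∂F₀ = 0 := by
    intro x
    rw [← integral_condExp (μ := F₀) (f := fun w => δ w x) hX.comap_le,
      integral_congr_ae (h.condExp_δ x)]
    simp
  have hmδ := h.moment_δ 1 (Or.inl rfl)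
  have hmb := h.moment_b 1 (Or.inl rfl)
  norm_num at hmδ hmb
  have hexp1 : ∀ c, min φ₁ φ₂ ≤ c →
      (m : ℝ) ^ (-(2 * c)) ≤ (m : ℝ) ^ (-(2 * min φ₁ φ₂)) := fun c hc =>
    Real.rpow_le_rpow_of_exponent_le hm1 (by linarith)
  set r := (m : ℝ) ^ (-(2 * min φ₁ φ₂)) with hr
  have hr0 : 0 ≤ r := by positivity
  have hδx : ∀ x, Measurable fun w => δ w x := fun x => hδ.comp measurable_prodMk_right
  have hbx : ∀ x, Measurable fun x' => b x' x := fun x => hb.comp measurable_prodMk_right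
  have hmδ1 : Measurable fun x => ∫⁻ w, ‖δ w x‖ₑ ^ 2 ∂F₀ :=
    ((hδ.comp measurable_swap).enorm.pow_const 2).lintegral_prod_right'
  have hmb1 : Measurable fun x => ∫⁻ x', ‖(m : ℝ) ^ (-φ₂) • b x' x‖ₑ ^ 2 ∂(F₀.map X) :=
    (((hb.comp measurable_swap).const_smul ((m : ℝ) ^ (-φ₂))).enorm.pow_const
      2).lintegral_prod_right'
  have hmb2 : Measurable fun x => ‖∫ x', b x' x ∂(F₀.map X)‖ₑ ^ 4 :=
    ((hb.comp measurable_swap).stronglyMeasurable.integral_prod_right').measurable.enorm.pow_const 4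
  have hAm : Measurable (Function.uncurry fun (d : ι → 𝒲) w =>
      (m : ℝ) ^ (-(1 / 2) : ℝ) • ∑ l, (m : ℝ) ^ (-φ₁) • δ (d l) (X w)) := by
    have : ∀ l, Measurable fun q : (ι → 𝒲) × 𝒲 => δ (q.1 l) (X q.2) := fun l =>
      hδ.comp (f := fun q : (ι → 𝒲) × 𝒲 => (q.1 l, X q.2)) (by fun_prop)
    simp only [Function.uncurry_def]
    fun_prop
  have hBm : Measurable (Function.uncurry fun (d : ι → 𝒲) w =>
      (m : ℝ)⁻¹ • ∑ l, (m : ℝ) ^ (-φ₂) • b (X (d l)) (X w)) := by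
    have : ∀ l, Measurable fun q : (ι → 𝒲) × 𝒲 => b (X (q.1 l)) (X q.2) := fun l =>
      hb.comp (f := fun q : (ι → 𝒲) × 𝒲 => (X (q.1 l), X q.2)) (by fun_prop)
    simp only [Function.uncurry_def]
    fun_prop
  have hA : ∫⁻ w, ∫⁻ d : ι → 𝒲, ‖(m : ℝ) ^ (-(1 / 2) : ℝ) • ∑ l, (m : ℝ) ^ (-φ₁) • δ (d l) (X w)‖ₑ
      ^ 2 ∂(Measure.pi fun _ => F₀) ∂F₀ ≤ ENNReal.ofReal r * ENNReal.ofReal M₁ := by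
    refine (lintegral_mono fun w => (lintegral_stochastic_part_le hm hι φ₁ (hδx (X w))
      (hzero (X w))).trans (mul_le_mul_left (ENNReal.ofReal_le_ofReal
        (hexp1 φ₁ (min_le_left _ _))) _)).trans ?_
    have h1 : Measurable fun w => ∫⁻ w', ‖δ w' (X w)‖ₑ ^ 2 ∂F₀ := hmδ1.comp hX
    rw [lintegral_const_mul _ h1, ← lintegral_map hmδ1 hX]
    gcongr
  have hB : ∫⁻ w, ∫⁻ d : ι → 𝒲, ‖(m : ℝ)⁻¹ • ∑ l, (m : ℝ) ^ (-φ₂) • b (X (d l)) (X w)‖ₑ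
      ^ 2 ∂(Measure.pi fun _ => F₀) ∂F₀ ≤
        ENNReal.ofReal r * (1 + ENNReal.ofReal M₁) + ENNReal.ofReal r := by
    refine (lintegral_mono fun w => (lintegral_bias_part_le hX hm hι φ₂ (hbx (X w))).trans
      (add_le_add_left (mul_le_mul_left (ENNReal.ofReal_le_ofReal
        (hexp1 φ₂ (min_le_right _ _))) _) _)).trans ?_
    have h2 : Measurable fun w => ‖∫ x', b x' (X w) ∂(F₀.map X)‖ₑ ^ 4 := hmb2.comp hX
    have h3 : Measurable fun w => ∫⁻ x', ‖(m : ℝ) ^ (-φ₂) • b x' (X w)‖ₑ ^ 2 ∂(F₀.map X) :=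
      hmb1.comp hX
    rw [lintegral_add_left ((h2.const_add 1).const_mul _), lintegral_const_mul _ (h2.const_add 1),
      lintegral_const_mul _ h3, lintegral_add_left measurable_const,
      ← lintegral_map hmb2 hX, ← lintegral_map hmb1 hX]
    refine add_le_add ?_ ?_
    · gcongr
      · simp
      · exact h.upper_b.le
    -- The moment bound for b with s = 1 grows like m^(1 - 2φ₁); the factor 1/m turns this into
    -- m^(-2φ₁).
    · refine (mul_le_mul_right (hmb.le.trans (ENNReal.ofReal_le_ofReal
        (mul_le_of_le_one_right (by positivity) hτ))) _).trans ?_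
      rw [← ENNReal.ofReal_mul (by positivity)]
      refine ENNReal.ofReal_le_ofReal (le_trans (le_of_eq ?_) (hexp1 φ₁ (min_le_left _ _)))
      rw [← Real.rpow_neg_one, ← Real.rpow_add hm0]
      congr 1
      ring
  refine (lintegral_lintegral_enorm_add_sq_le hAm hBm).trans
    ((mul_le_mul_right (add_le_add hA hB) 4).trans (le_of_eq ?_))
  -- The constant is 4 (M₁ + (1 + M₁) + 1) = 8 (M₁ + 1).
  rw [show (1 : ℝ≥0∞) = ENNReal.ofReal 1 by simp,
    show (4 : ℝ≥0∞) = ENNReal.ofReal 4 by simp, ← ENNReal.ofReal_add zero_le_one hM₁.le,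
    ← ENNReal.ofReal_mul hr0, ← ENNReal.ofReal_mul hr0,
    ← ENNReal.ofReal_add (by positivity) hr0,
    ← ENNReal.ofReal_add (by positivity) (by positivity),
    ← ENNReal.ofReal_mul (by norm_num)]
  congr 1
  ring

theorem measurable_leadingPart_offFold {n K : ℕ} {X : 𝒲 → 𝒳} (hX : Measurable X)
    (φ₁ φ₂ : ℝ) {δ : ℕ → 𝒲 → 𝒳 → EuclideanSpace ℝ (Fin p)}
    {b : ℕ → 𝒳 → 𝒳 → EuclideanSpace ℝ (Fin p)} (hδ : ∀ m, Measurable (Function.uncurry (δ m)))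
    (hb : ∀ m, Measurable (Function.uncurry (b m))) (s : Fin n → Fin K) (i : Fin n) :
    Measurable fun w : Fin n → 𝒲 => leadingPart X φ₁ φ₂ δ b (offFold s (s i) w) (X (w i)) := by
  have h := measurable_leadingPart (ι := {l // s l ≠ s i}) hX φ₁ φ₂ hδ hb
  have h2 : Measurable fun w : Fin n → 𝒲 => (offFold s (s i) w, X (w i)) :=
    (measurable_offFold s (s i)).prodMk (hX.comp (measurable_pi_apply i))
  have h3 := h.comp h2
  simp only [Function.comp_def, Function.uncurry_apply_pair] at h3
  exact h3

theorem ExpansionRegular.lintegral_leadingPart_offFold_le {n K : ℕ} {F₀ : Measure 𝒲}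
    [IsProbabilityMeasure F₀] {X : 𝒲 → 𝒳} (hX : Measurable X) {φ₁ φ₂ M₁ Cδ Cb : ℝ} {τ : ℕ → ℝ}
    {δ : ℕ → 𝒲 → 𝒳 → EuclideanSpace ℝ (Fin p)} {b : ℕ → 𝒳 → 𝒳 → EuclideanSpace ℝ (Fin p)}
    (hδ : ∀ m, Measurable (Function.uncurry (δ m)))
    (hb : ∀ m, Measurable (Function.uncurry (b m))) (hM₁ : 0 < M₁)
    (s : Fin n → Fin K) (i : Fin n) {m : ℕ} (hm : 0 < m)
    (hcard : Fintype.card {l // s l ≠ s i} = m) (hτ : τ m ≤ 1)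
    (h : ExpansionRegular F₀ X φ₁ φ₂ M₁ Cδ Cb τ m (δ m) (b m)) :
    ∫⁻ w, ‖leadingPart X φ₁ φ₂ δ b (offFold s (s i) w) (X (w i))‖ₑ ^ 2 ∂(Measure.pi fun _ => F₀)
      ≤ ENNReal.ofReal (8 * (M₁ + 1) * (m : ℝ) ^ (-(2 * min φ₁ φ₂))) := by
  have h1 := measurable_leadingPart (ι := {l // s l ≠ s i}) hX φ₁ φ₂ hδ hb
  have h2 : Measurable fun q : ({l // s l ≠ s i} → 𝒲) × 𝒲 => (q.1, X q.2) := by fun_prop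
  have hFm : Measurable (Function.uncurry fun (d : {l // s l ≠ s i} → 𝒲) (x : 𝒲) =>
      ‖leadingPart X φ₁ φ₂ δ b d (X x)‖ₑ ^ 2) := (h1.comp h2).enorm.pow_const 2
  exact (lintegral_offFold_eval F₀ s (k := s i) (i := i) rfl hFm).le.trans
    (h.lintegral_sum_sq_le hX hm hcard hδ hb hM₁ hτ)

/-- The cross-fitted nuisance estimates have mean squared error of order `n ^ (-2 min(φ₁, φ₂))`. -/
theorem ExpansionAssumption.exists_lintegral_error_le {P : Measure Ω} [IsProbabilityMeasure P]
    {F₀ : Measure 𝒲} [IsProbabilityMeasure F₀] {W : ℕ → Ω → 𝒲} (hW : ∀ i, Measurable (W i))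
    (hlaw : ∀ i, P.map (W i) = F₀) (hindep : iIndepFun W P) {X : 𝒲 → 𝒳} (hX : Measurable X)
    {η₀ : 𝒳 → EuclideanSpace ℝ (Fin p)}
    {K : ℕ → ℕ} {S : (n : ℕ) → Ω → Fin n → Fin (K n)}
    (hS : ∀ n, Measurable (S n)) (hSbal : ∀ n ω, IsBalanced (S n ω))
    (hSindep : ∀ n, IndepFun (S n) (fun ω (i : ℕ) => W i ω) P)
    {est : (n : ℕ) → NuisanceEstimator 𝒲 𝒳 p n (K n)} {φ₁ φ₂ : ℝ} (hφ : 0 < min φ₁ φ₂)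
    (hA2 : ExpansionAssumption P F₀ X η₀ φ₁ φ₂ K W S est) (hK : Tendsto K atTop atTop) :
    ∃ C : ℝ, 0 < C ∧ ∀ᶠ n in atTop, ∀ i : Fin n,
      ∫⁻ ω, ‖crossFit X (est n) (S n ω) (fun j => W j ω) i - η₀ (X (W i ω))‖ₑ ^ 2 ∂P ≤
        ENNReal.ofReal (C * (n : ℝ) ^ (-(2 * min φ₁ φ₂))) := by
  obtain ⟨δ, b, hδ, hb, ⟨M₁, Cδ, Cb, τ, hM₁, -, -, -, hτ0, hreg⟩, -, ⟨C, hC⟩, -⟩ := hA2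
  obtain ⟨m₀, hm₀⟩ := eventually_atTop.1 (hreg.and (hτ0.eventually_le_const zero_lt_one))
  generalize hκ : min φ₁ φ₂ = κ at *
  -- 4 comes from the square of a sum, 8(M₁ + 1) from the leading part, |C| from the remainder, and
  -- 2^(2κ) from n₀ ≥ n/2.
  refine ⟨4 * (8 * (M₁ + 1) + |C|) * (2 : ℝ) ^ (2 * κ), by positivity, ?_⟩
  filter_upwards [hC, hK.eventually_ge_atTop 4, eventually_ge_atTop (2 * m₀ + 4)]
    with n hCn hKn hn i
  have hn0 : (0 : ℝ) < n := by
    have : 0 < n := by omega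
    exact_mod_cast this
  obtain ⟨r, hr⟩ : ∃ r : ℝ, r = (2 : ℝ) ^ (2 * κ) * (n : ℝ) ^ (-(2 * κ)) := ⟨_, rfl⟩
  have hr0 : 0 ≤ r := by rw [hr]; positivity
  have hcard : ∀ s : Fin n → Fin (K n), IsBalanced s → ∀ k,
      m₀ ≤ Fintype.card {l // s l ≠ k} ∧ 1 ≤ Fintype.card {l // s l ≠ k} ∧
      (Fintype.card {l // s l ≠ k} : ℝ) ^ (-(2 * κ)) ≤ r := by
    intro s hs k
    have h1 := hs.half_le_card_offFold (by omega) hKn k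
    have h2 : (m₀ : ℝ) + 2 ≤ Fintype.card {l // s l ≠ k} := by
      have : (2 * m₀ + 4 : ℝ) ≤ n := by exact_mod_cast hn
      linarith
    have h3 : m₀ + 2 ≤ Fintype.card {l // s l ≠ k} := by exact_mod_cast h2
    refine ⟨by omega, by omega, ?_⟩
    calc _ ≤ ((n : ℝ) / 2) ^ (-(2 * κ)) :=
          Real.rpow_le_rpow_of_nonpos (by positivity) h1 (by linarith)
      _ = r := by
          rw [Real.div_rpow hn0.le (by norm_num), Real.rpow_neg (by norm_num : (0 : ℝ) ≤ 2), hr]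
          field_simp
  have hAm := measurable_leadingPart_offFold (K := K n) (n := n) hX φ₁ φ₂ hδ hb
  have hlead : ∀ s : Fin n → Fin (K n), IsBalanced s →
      ∫⁻ w, ‖leadingPart X φ₁ φ₂ δ b (offFold s (s i) w) (X (w i))‖ₑ ^ 2
      ∂(Measure.pi fun _ => F₀) ≤
      ENNReal.ofReal (8 * (M₁ + 1) * r) := by
    intro s hs
    obtain ⟨h1, h2, h3⟩ := hcard s hs (s i)
    obtain ⟨hregm, hτm⟩ := hm₀ _ h1
    refine (hregm.lintegral_leadingPart_offFold_le hX hδ hb hM₁ s i (by omega) rfl hτm).trans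
      (ENNReal.ofReal_le_ofReal ?_)
    rw [hκ]
    gcongr
  have hAint := lintegral_comp_split_le hW hlaw hindep (hS n) (hSbal n) (hSindep n)
    (fun s => (hAm s i).enorm.pow_const 2) hlead
  have hAmeas := measurable_comp_split hW (hS n) fun s => hAm s i
  calc ∫⁻ ω, ‖crossFit X (est n) (S n ω) (fun j => W j ω) i - η₀ (X (W i ω))‖ₑ ^ 2 ∂P
      ≤ ∫⁻ ω, 4 * (‖leadingPart X φ₁ φ₂ δ b
          (offFold (S n ω) (S n ω i) fun j => W j ω) (X (W i ω))‖ₑ ^ 2 +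
          ENNReal.ofReal r * ‖remainder X η₀ φ₁ φ₂ δ b (est n) (S n ω) (S n ω i)
          (fun j => W j ω) (X (W i ω))‖ₑ ^ 2) ∂P := by
        refine lintegral_mono fun ω => ?_
        obtain ⟨-, h2, h3⟩ := hcard (S n ω) (hSbal n ω) (S n ω i)
        dsimp only
        rw [crossFit_sub_eq X η₀ φ₁ φ₂ δ b (est n) (S n ω) (fun j => W j ω) i (by omega) rfl]
        refine (enorm_add_sq_le _ _).trans ?_
        gcongr
        rw [enorm_smul, mul_pow]
        gcongr
        rw [enorm_rpow_neg_sq (Nat.cast_nonneg _)]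
        -- The squared prefactor of the remainder is n₀^(-4κ). As n₀ ≥ 1, it is at most n₀^(-2κ),
        -- which is all that is needed.
        refine ENNReal.ofReal_le_ofReal (le_trans ?_ h3)
        exact Real.rpow_le_rpow_of_exponent_le (by exact_mod_cast h2) (by linarith)
    _ = 4 * (∫⁻ ω, ‖leadingPart X φ₁ φ₂ δ b
          (offFold (S n ω) (S n ω i) fun j => W j ω) (X (W i ω))‖ₑ ^ 2 ∂P +
          ENNReal.ofReal r * ∫⁻ ω, ‖remainder X η₀ φ₁ φ₂ δ b (est n) (S n ω) (S n ω i)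
          (fun j => W j ω) (X (W i ω))‖ₑ ^ 2 ∂P) := by
        rw [lintegral_const_mul' _ _ (by simp), lintegral_add_left (hAmeas.enorm.pow_const 2),
          lintegral_const_mul' _ _ (by simp)]
    _ ≤ 4 * (ENNReal.ofReal (8 * (M₁ + 1) * r) + ENNReal.ofReal r * ENNReal.ofReal |C|) := by
        gcongr
        exact (hCn i).trans (ENNReal.ofReal_le_ofReal (le_abs_self C))
    _ = ENNReal.ofReal (4 * (8 * (M₁ + 1) * r + r * |C|)) := by
        rw [show (4 : ℝ≥0∞) = ENNReal.ofReal 4 by simp, ← ENNReal.ofReal_mul (by positivity),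
          ← ENNReal.ofReal_add (by positivity) (by positivity),
          ← ENNReal.ofReal_mul (by norm_num)]
    _ ≤ _ := ENNReal.ofReal_le_ofReal (le_of_eq (by rw [hr]; ring))

end NuisanceRate

/-! ### Orthogonality and the linear part of the nuisance effect. -/

section FoldError

variable {Ω 𝒲 𝒳 : Type*} {p : ℕ}

theorem crossFit_of_mem {n K : ℕ} (X : 𝒲 → 𝒳) (est : NuisanceEstimator 𝒲 𝒳 p n K)
    {s : Fin n → Fin K} {k : Fin K} (w : Fin n → 𝒲) {i : Fin n} (hi : s i = k) :
    crossFit X est s w i = est s k (offFold s k w) (X (w i)) := by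
  subst hi
  rfl

/-- The linear part of the foldwise effect of the nuisance estimation error. -/
noncomputable def foldLinear {n K : ℕ} (X : 𝒲 → 𝒳) (η₀ : 𝒳 → EuclideanSpace ℝ (Fin p))
    (G : 𝒲 → EuclideanSpace ℝ (Fin p)) (est : NuisanceEstimator 𝒲 𝒳 p n K)
    (s : Fin n → Fin K) (k : Fin K) (w : Fin n → 𝒲) : ℝ :=
  ∑ i : {i // s i = k}, inner ℝ (G (w i)) (crossFit X est s w i - η₀ (X (w i)))

/-- The effect of the nuisance estimation error on the average of `ψ` over a fold. -/
noncomputable def foldError {n K : ℕ} (X : 𝒲 → 𝒳) (η₀ : 𝒳 → EuclideanSpace ℝ (Fin p))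
    (ψ : 𝒲 → EuclideanSpace ℝ (Fin p) → ℝ) (est : NuisanceEstimator 𝒲 𝒳 p n K)
    (s : Fin n → Fin K) (w : Fin n → 𝒲) (k : Fin K) : ℝ :=
  foldMean s k (fun i => ψ (w i) (crossFit X est s w i)) -
    foldMean s k (fun i => ψ (w i) (η₀ (X (w i))))

theorem IsBalanced.div_le_card {n K : ℕ} {s : Fin n → Fin K} (hs : IsBalanced s) (k : Fin K) :
    n / K ≤ Fintype.card {i // s i = k} := by
  rcases hs k with h | h <;> omega

theorem sum_fold {n K : ℕ} {M : Type*} [AddCommMonoid M] (s : Fin n → Fin K) (f : Fin n → M) :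
    ∑ k, ∑ i : {i // s i = k}, f i = ∑ i, f i :=
  Fintype.sum_fiberwise s f

variable [MeasurableSpace Ω] [MeasurableSpace 𝒲] [MeasurableSpace 𝒳]

theorem measurable_crossFit {n K : ℕ} {X : 𝒲 → 𝒳} (hX : Measurable X)
    {est : NuisanceEstimator 𝒲 𝒳 p n K} (hest : ∀ s k, Measurable (Function.uncurry (est s k)))
    (s : Fin n → Fin K) (i : Fin n) : Measurable fun w : Fin n → 𝒲 => crossFit X est s w i := by
  have h2 : Measurable fun w : Fin n → 𝒲 => (offFold s (s i) w, X (w i)) :=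
    (measurable_offFold s (s i)).prodMk (hX.comp (measurable_pi_apply i))
  have h3 := (hest s (s i)).comp h2
  simp only [Function.comp_def, Function.uncurry_apply_pair] at h3
  exact h3

/-- For a fixed error function h the summands are i.i.d. and centred by orthogonality, so the second
moment grows linearly in the number of summands. If h is not square integrable the right side is
infinite, as L > 0. -/
theorem IsLinearization.lintegral_sum_inner_sq_le {ι : Type*} [Fintype ι] {F₀ : Measure 𝒲}
    [IsProbabilityMeasure F₀] {X : 𝒲 → 𝒳} (hX : Measurable X)
    {T : Set (EuclideanSpace ℝ (Fin p))} {η₀ : 𝒳 → EuclideanSpace ℝ (Fin p)}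
    {ψ : 𝒲 → EuclideanSpace ℝ (Fin p) → ℝ} {L : ℝ} {G : 𝒲 → EuclideanSpace ℝ (Fin p)}
    (hG : IsLinearization F₀ X T η₀ ψ L G) {h : 𝒳 → EuclideanSpace ℝ (Fin p)} (hh : Measurable h) :
    ∫⁻ e : ι → 𝒲, ‖∑ i, inner ℝ (G (e i)) (h (X (e i)))‖ₑ ^ 2 ∂(Measure.pi fun _ => F₀) ≤
      ENNReal.ofReal L * ∑ _i : ι, ∫⁻ x, ‖h (X x)‖ₑ ^ 2 ∂F₀ := by
  rcases isEmpty_or_nonempty ι with hι | hι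
  · simp
  have hY : Measurable fun x => inner ℝ (G x) (h (X x)) := hG.measurable.inner (hh.comp hX)
  by_cases htop : ∫⁻ x, ‖h (X x)‖ₑ ^ 2 ∂F₀ = ∞
  · rw [htop]
    simp [ENNReal.mul_top, hG.pos]
  refine (lintegral_enorm_sum_sq_le F₀ hY).trans ?_
  rw [hG.mean_zero h hh htop]
  simp only [enorm_zero, ne_eq, OfNat.ofNat_ne_zero, not_false_eq_true, zero_pow, mul_zero,
    zero_add, Finset.sum_const, nsmul_eq_mul, Finset.card_univ]
  rw [mul_left_comm]
  gcongr
  exact hG.second_moment h hh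

/-- This is where cross-fitting enters: with the data outside the fold frozen, the estimation error
is a fixed function of the covariate and the fold itself is a fresh i.i.d. sample. The bound is then
integrated over the frozen data. -/
theorem IsLinearization.lintegral_foldLinear_sq_le {n K : ℕ} {F₀ : Measure 𝒲}
    [IsProbabilityMeasure F₀] {X : 𝒲 → 𝒳} (hX : Measurable X)
    {T : Set (EuclideanSpace ℝ (Fin p))} {η₀ : 𝒳 → EuclideanSpace ℝ (Fin p)} (hη₀ : Measurable η₀)
    {ψ : 𝒲 → EuclideanSpace ℝ (Fin p) → ℝ} {L : ℝ} {G : 𝒲 → EuclideanSpace ℝ (Fin p)}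
    (hG : IsLinearization F₀ X T η₀ ψ L G) {est : NuisanceEstimator 𝒲 𝒳 p n K}
    (hest : ∀ s k, Measurable (Function.uncurry (est s k))) (s : Fin n → Fin K) (k : Fin K) :
    ∫⁻ w, ‖foldLinear X η₀ G est s k w‖ₑ ^ 2 ∂(Measure.pi fun _ => F₀) ≤
      ENNReal.ofReal L * ∑ i : {i // s i = k},
        ∫⁻ w, ‖crossFit X est s w i - η₀ (X (w i))‖ₑ ^ 2 ∂(Measure.pi fun _ => F₀) := by
  have hGm := hG.measurable
  have hsum : ∀ d : {i // s i ≠ k} → 𝒲,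
      ∫⁻ e : {i // s i = k} → 𝒲, ‖∑ i, inner ℝ (G (e i)) (est s k d (X (e i)) - η₀ (X (e i)))‖ₑ ^ 2
        ∂(Measure.pi fun _ => F₀) ≤
      ENNReal.ofReal L * ∑ _i : {i // s i = k}, ∫⁻ x, ‖est s k d (X x) - η₀ (X x)‖ₑ ^ 2 ∂F₀ := by
    intro d
    have h1 := (hest s k).comp (measurable_prodMk_left (x := d))
    simp only [Function.comp_def, Function.uncurry_apply_pair] at h1
    exact hG.lintegral_sum_inner_sq_le (h := fun x => est s k d x - η₀ x) hX (h1.sub hη₀)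
  have hF : Measurable (Function.uncurry fun (d : {i // s i ≠ k} → 𝒲) (e : {i // s i = k} → 𝒲) =>
      ‖∑ i, inner ℝ (G (e i)) (est s k d (X (e i)) - η₀ (X (e i)))‖ₑ ^ 2) := by
    have h1 : ∀ i, Measurable fun q : ({i // s i ≠ k} → 𝒲) × ({i // s i = k} → 𝒲) =>
        inner ℝ (G (q.2 i)) (est s k q.1 (X (q.2 i)) - η₀ (X (q.2 i))) := by
      intro i
      have h0 : Measurable fun q : ({i // s i ≠ k} → 𝒲) × ({i // s i = k} → 𝒲) =>
        (q.1, X (q.2 i)) := by fun_prop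
      have h3 := (hest s k).comp h0
      simp only [Function.comp_def, Function.uncurry_apply_pair] at h3
      exact Measurable.inner (by fun_prop) (h3.sub (by fun_prop))
    simp only [Function.uncurry_def]
    exact (Finset.measurable_fun_sum _ fun i _ => h1 i).enorm.pow_const 2
  have hH : Measurable (Function.uncurry fun (d : {i // s i ≠ k} → 𝒲) (x : 𝒲) =>
      ‖est s k d (X x) - η₀ (X x)‖ₑ ^ 2) := by
    have h0 : Measurable fun q : ({i // s i ≠ k} → 𝒲) × 𝒲 => (q.1, X q.2) := by fun_prop
    have h3 := (hest s k).comp h0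
    simp only [Function.comp_def, Function.uncurry_apply_pair] at h3
    simp only [Function.uncurry_def]
    exact (h3.sub (by fun_prop)).enorm.pow_const 2
  have hfl : ∀ w, ‖foldLinear X η₀ G est s k w‖ₑ ^ 2 =
      ‖∑ i : {i // s i = k}, inner ℝ (G (w i)) (est s k (offFold s k w) (X (w i)) -
        η₀ (X (w i)))‖ₑ ^ 2 := by
    intro w
    rw [foldLinear]
    congr 2
    exact Finset.sum_congr rfl fun i _ => by rw [crossFit_of_mem X est w i.2]
  simp_rw [hfl]
  refine (lintegral_offFold_fold F₀ s k hF).le.trans ((lintegral_mono hsum).trans (le_of_eq ?_))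
  have hHi : Measurable fun d => ∫⁻ x, ‖est s k d (X x) - η₀ (X x)‖ₑ ^ 2 ∂F₀ :=
    hH.lintegral_prod_right'
  rw [lintegral_const_mul _ (Finset.measurable_fun_sum _ fun i _ => hHi),
    lintegral_finsetSum _ fun i _ => hHi]
  congr 1
  refine Finset.sum_congr rfl fun i _ => ?_
  rw [← lintegral_offFold_eval F₀ s i.2 hH]
  exact lintegral_congr fun w => by rw [crossFit_of_mem X est w i.2]

/-- Both sides depend on the random split, so the bound is proved for each split and averaged with
the same weights on the two sides. -/
theorem IsLinearization.lintegral_sum_foldLinear_sq_le {n K : ℕ} {P : Measure Ω}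
    [IsProbabilityMeasure P] {F₀ : Measure 𝒲} [IsProbabilityMeasure F₀] {W : ℕ → Ω → 𝒲}
    (hW : ∀ i, Measurable (W i)) (hlaw : ∀ i, P.map (W i) = F₀) (hindep : iIndepFun W P)
    {X : 𝒲 → 𝒳} (hX : Measurable X)
    {T : Set (EuclideanSpace ℝ (Fin p))} {η₀ : 𝒳 → EuclideanSpace ℝ (Fin p)} (hη₀ : Measurable η₀)
    {ψ : 𝒲 → EuclideanSpace ℝ (Fin p) → ℝ} {L : ℝ} {G : 𝒲 → EuclideanSpace ℝ (Fin p)}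
    (hG : IsLinearization F₀ X T η₀ ψ L G) {est : NuisanceEstimator 𝒲 𝒳 p n K}
    (hest : ∀ s k, Measurable (Function.uncurry (est s k)))
    {S : Ω → Fin n → Fin K} (hS : Measurable S)
    (hSindep : IndepFun S (fun ω (i : ℕ) => W i ω) P) :
    ∫⁻ ω, ∑ k, ‖foldLinear X η₀ G est (S ω) k (fun j => W j ω)‖ₑ ^ 2 ∂P ≤
      ENNReal.ofReal L * ∑ i : Fin n,
        ∫⁻ ω, ‖crossFit X est (S ω) (fun j => W j ω) i - η₀ (X (W i ω))‖ₑ ^ 2 ∂P := by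
  have hcm := measurable_crossFit hX hest
  have hdm : ∀ s i, Measurable fun w : Fin n → 𝒲 => crossFit X est s w i - η₀ (X (w i)) :=
    fun s i => (hcm s i).sub (by fun_prop)
  have hlm : ∀ s k, Measurable fun w : Fin n → 𝒲 => foldLinear X η₀ G est s k w := fun s k =>
    Finset.measurable_fun_sum _ fun i _ =>
      (hG.measurable.comp (measurable_pi_apply _)).inner (hdm s i)
  rw [lintegral_comp_split hW hlaw hindep hS hSindep
    (f := fun s w => ∑ k, ‖foldLinear X η₀ G est s k w‖ₑ ^ 2)
    fun s => Finset.measurable_fun_sum _ fun k _ => (hlm s k).enorm.pow_const 2]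
  have hR : ∀ i : Fin n,
      ∫⁻ ω, ‖crossFit X est (S ω) (fun j => W j ω) i - η₀ (X (W i ω))‖ₑ ^ 2 ∂P =
      ∑ s, P (S ⁻¹' {s}) *
        ∫⁻ w, ‖crossFit X est s w i - η₀ (X (w i))‖ₑ ^ 2 ∂(Measure.pi fun _ => F₀) := fun i =>
    lintegral_comp_split hW hlaw hindep hS hSindep
      (f := fun s w => ‖crossFit X est s w i - η₀ (X (w i))‖ₑ ^ 2)
      fun s => (hdm s i).enorm.pow_const 2
  simp_rw [hR]
  rw [Finset.sum_comm, Finset.mul_sum]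
  refine Finset.sum_le_sum fun s _ => ?_
  rw [← Finset.mul_sum, mul_left_comm]
  gcongr
  rw [lintegral_finsetSum _ fun k _ => (hlm s k).enorm.pow_const 2, ← sum_fold s, Finset.mul_sum]
  exact Finset.sum_le_sum fun k _ => hG.lintegral_foldLinear_sq_le hX hη₀ hest s k

end FoldError

/-! ### Growth of the fold size, and Markov's inequality. -/

section Rates

/-- Growth of the number `n / K` of observations per fold. -/
theorem eventually_fold_size {K : ℕ → ℕ} (hKn : ∀ n, K n ≤ n) (hK : Tendsto K atTop atTop) {c : ℝ}
    (hKc : Tendsto (fun n : ℕ => (K n : ℝ) / √n) atTop (𝓝 c)) :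
    ∀ᶠ n in atTop, 1 ≤ K n ∧ 1 ≤ n / K n ∧ (n : ℝ) ≤ 2 * (K n * (n / K n : ℕ)) ∧
      (K n : ℝ) ≤ (c + 1) * √n ∧ √n ≤ 2 * (c + 1) * (n / K n : ℕ) := by
  filter_upwards [hK.eventually_ge_atTop 1, hKc.eventually_le_const (lt_add_one c),
    eventually_ge_atTop 1] with n h1 h2 h3
  have hq : 1 ≤ n / K n := (Nat.one_le_div_iff (by omega)).2 (hKn n)
  -- The remainder of n modulo K is below K, hence at most K ⌊n/K⌋.
  have h4 : n ≤ 2 * (K n * (n / K n)) := by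
    have h5 := Nat.div_add_mod n (K n)
    have h6 : n % K n < K n := Nat.mod_lt _ (by omega)
    nlinarith
  have h4' : (n : ℝ) ≤ 2 * (K n * (n / K n : ℕ)) := by exact_mod_cast h4
  have hs : 0 < √(n : ℝ) := Real.sqrt_pos.2 (by exact_mod_cast h3)
  have h5 : (K n : ℝ) ≤ (c + 1) * √n := (div_le_iff₀ hs).1 h2
  refine ⟨h1, hq, h4', h5, ?_⟩
  -- √n · √n = n ≤ 2Kq ≤ 2(c + 1) √n q, and √n cancels. Here c + 1 is an eventual bound for K/√n
  -- that stays positive when c = 0.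
  have h6 : √(n : ℝ) * √n = n := Real.mul_self_sqrt (Nat.cast_nonneg n)
  have h7 : (K n : ℝ) * (n / K n : ℕ) ≤ (c + 1) * √n * (n / K n : ℕ) := by gcongr
  nlinarith

theorem tendsto_fold_size {K : ℕ → ℕ} (hKn : ∀ n, K n ≤ n) (hK : Tendsto K atTop atTop) {c : ℝ}
    (hKc : Tendsto (fun n : ℕ => (K n : ℝ) / √n) atTop (𝓝 c)) :
    Tendsto (fun n : ℕ => ((n / K n : ℕ) : ℝ)) atTop atTop := by
  have hs : Tendsto (fun n : ℕ => √(n : ℝ)) atTop atTop :=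
    Real.tendsto_sqrt_atTop.comp tendsto_natCast_atTop_atTop
  have hc : 0 ≤ c := ge_of_tendsto' hKc fun n => by positivity
  have h : Tendsto (fun n : ℕ => √(n : ℝ) / (2 * (c + 1))) atTop atTop :=
    hs.atTop_div_const (by positivity)
  refine tendsto_atTop_mono' _ ?_ h
  filter_upwards [eventually_fold_size hKn hK hKc] with n hn
  rw [div_le_iff₀ (by positivity)]
  linarith [hn.2.2.2.2]

theorem tendstoInMeasure_zero_of_lintegral_le {Ω : Type*} [MeasurableSpace Ω] {P : Measure Ω}
    {Z : ℕ → Ω → ℝ} (hZ : ∀ n, AEMeasurable (Z n) P) {a : ℕ → ℝ}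
    (k : ℕ) (ha : Tendsto a atTop (𝓝 0))
    (h : ∀ᶠ n in atTop, ∫⁻ ω, ‖Z n ω‖ₑ ^ k ∂P ≤ ENNReal.ofReal (a n)) :
    TendstoInMeasure P Z atTop 0 := by
  intro ε hε
  -- Convergence in measure is tested with extended ε. At ε = ∞ the event is empty, since Z is real.
  rcases eq_or_ne ε ∞ with rfl | hεt
  · simp
  have hlim : Tendsto (fun n => ENNReal.ofReal (a n) / ε ^ k) atTop (𝓝 0) := by
    have h1 := ENNReal.Tendsto.div_const (ENNReal.tendsto_ofReal ha) (b := ε ^ k)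
      (Or.inr (pow_ne_zero k hε.ne'))
    simpa using h1
  refine tendsto_of_tendsto_of_tendsto_of_le_of_le' tendsto_const_nhds hlim
    (Eventually.of_forall fun n => zero_le) ?_
  filter_upwards [h] with n hn
  have hset : {ω | ε ≤ edist (Z n ω) ((0 : Ω → ℝ) ω)} ⊆ {ω | ε ^ k ≤ ‖Z n ω‖ₑ ^ k} := by
    intro ω hω
    simp only [Set.mem_ofPred_eq, Pi.zero_apply, edist_zero_right] at hω ⊢
    gcongr
  refine (measure_mono hset).trans ?_
  refine (meas_ge_le_lintegral_div ((hZ n).enorm.pow_const k) (pow_ne_zero k hε.ne')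
    (ENNReal.pow_ne_top hεt)).trans ?_
  gcongr

end Rates

/-! ### The nuisance effect is negligible at rate √n. -/

section FoldErrorRate

variable {Ω 𝒲 𝒳 : Type*} {p : ℕ}

theorem abs_foldError_le {n K : ℕ} (X : 𝒲 → 𝒳) {T : Set (EuclideanSpace ℝ (Fin p))}
    {η₀ : 𝒳 → EuclideanSpace ℝ (Fin p)} {ψ : 𝒲 → EuclideanSpace ℝ (Fin p) → ℝ} {L : ℝ}
    {G : 𝒲 → EuclideanSpace ℝ (Fin p)} {est : NuisanceEstimator 𝒲 𝒳 p n K}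
    (hestT : ∀ s k d x, est s k d x ∈ T) {s : Fin n → Fin K} (hs : IsBalanced s) (hq : 1 ≤ n / K)
    {w : Fin n → 𝒲}
    (hw : ∀ i, ∀ η ∈ T, |ψ (w i) η - ψ (w i) (η₀ (X (w i))) -
      inner ℝ (G (w i)) (η - η₀ (X (w i)))| ≤ L * ‖η - η₀ (X (w i))‖ ^ 2) (k : Fin K) :
    |foldError X η₀ ψ est s w k| ≤ ((n / K : ℕ) : ℝ)⁻¹ * (|foldLinear X η₀ G est s k w| +
      L * ∑ i : {i // s i = k}, ‖crossFit X est s w i - η₀ (X (w i))‖ ^ 2) := by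
  have hq0 : (0 : ℝ) < (n / K : ℕ) := by exact_mod_cast hq
  have hqk : ((n / K : ℕ) : ℝ) ≤ Fintype.card {i // s i = k} := by exact_mod_cast hs.div_le_card k
  rw [foldError, foldMean, foldMean, ← mul_sub, ← Finset.sum_sub_distrib, abs_mul,
    abs_of_nonneg (by positivity)]
  gcongr
  rw [foldLinear, Finset.mul_sum]
  have hdec : ∑ i : {i // s i = k}, (ψ (w i) (crossFit X est s w i) - ψ (w i) (η₀ (X (w i)))) =
      ∑ i : {i // s i = k}, inner ℝ (G (w i)) (crossFit X est s w i - η₀ (X (w i))) +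
      ∑ i : {i // s i = k}, (ψ (w i) (crossFit X est s w i) - ψ (w i) (η₀ (X (w i))) -
        inner ℝ (G (w i)) (crossFit X est s w i - η₀ (X (w i)))) := by
    rw [← Finset.sum_add_distrib]
    exact Finset.sum_congr rfl fun i _ => by ring
  rw [hdec]
  refine (abs_add_le _ _).trans ?_
  gcongr
  exact (Finset.abs_sum_le_sum_abs _ _).trans
    (Finset.sum_le_sum fun i _ => hw i _ (hestT _ _ _ _))

/-- The inequality |t| ≤ l + t² / l converts the sum of absolute linear parts into a sum of squares,
whose expectation is known. The level l > 0 is free and is chosen to balance the two terms. -/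
theorem sum_abs_foldError_le {n K : ℕ} (X : 𝒲 → 𝒳) {T : Set (EuclideanSpace ℝ (Fin p))}
    {η₀ : 𝒳 → EuclideanSpace ℝ (Fin p)} {ψ : 𝒲 → EuclideanSpace ℝ (Fin p) → ℝ} {L : ℝ}
    {G : 𝒲 → EuclideanSpace ℝ (Fin p)} {est : NuisanceEstimator 𝒲 𝒳 p n K}
    (hestT : ∀ s k d x, est s k d x ∈ T) {s : Fin n → Fin K} (hs : IsBalanced s) (hq : 1 ≤ n / K)
    {w : Fin n → 𝒲}
    (hw : ∀ i, ∀ η ∈ T, |ψ (w i) η - ψ (w i) (η₀ (X (w i))) -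
      inner ℝ (G (w i)) (η - η₀ (X (w i)))| ≤ L * ‖η - η₀ (X (w i))‖ ^ 2) {l : ℝ} (hl : 0 < l) :
    ∑ k, |foldError X η₀ ψ est s w k| ≤ ((n / K : ℕ) : ℝ)⁻¹ *
      (K * l + l⁻¹ * ∑ k, foldLinear X η₀ G est s k w ^ 2 +
        L * ∑ i, ‖crossFit X est s w i - η₀ (X (w i))‖ ^ 2) := by
  refine (Finset.sum_le_sum fun k _ => abs_foldError_le X hestT hs hq hw k).trans ?_
  rw [← Finset.mul_sum, Finset.sum_add_distrib, ← Finset.mul_sum,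
    sum_fold s fun i => ‖crossFit X est s w i - η₀ (X (w i))‖ ^ 2]
  gcongr
  have hamgm : ∀ t : ℝ, |t| ≤ l + l⁻¹ * t ^ 2 := by
    intro t
    have h1 : l * |t| ≤ l * (l + l⁻¹ * t ^ 2) := by
      rw [mul_add, ← mul_assoc, mul_inv_cancel₀ hl.ne', ← sq_abs]
      nlinarith [sq_nonneg (l - |t|), abs_nonneg t]
    exact le_of_mul_le_mul_left h1 hl
  refine (Finset.sum_le_sum fun k _ => hamgm _).trans ?_
  rw [Finset.sum_add_distrib, ← Finset.mul_sum]
  simp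

variable [MeasurableSpace Ω] [MeasurableSpace 𝒲] [MeasurableSpace 𝒳]

theorem measurable_foldError {n K : ℕ} {X : 𝒲 → 𝒳} (hX : Measurable X)
    {η₀ : 𝒳 → EuclideanSpace ℝ (Fin p)} (hη₀ : Measurable η₀)
    {ψ : 𝒲 → EuclideanSpace ℝ (Fin p) → ℝ} (hψ : Measurable (Function.uncurry ψ))
    {est : NuisanceEstimator 𝒲 𝒳 p n K} (hest : ∀ s k, Measurable (Function.uncurry (est s k)))
    (s : Fin n → Fin K) (k : Fin K) : Measurable fun w => foldError X η₀ ψ est s w k := by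
  have hcm := measurable_crossFit hX hest s
  have h1 : ∀ i, Measurable fun w : Fin n → 𝒲 => ψ (w i) (crossFit X est s w i) := fun i =>
    hψ.comp (f := fun w : Fin n → 𝒲 => (w i, crossFit X est s w i))
      ((measurable_pi_apply i).prodMk (hcm i))
  have h2 : ∀ i, Measurable fun w : Fin n → 𝒲 => ψ (w i) (η₀ (X (w i))) := fun i =>
    hψ.comp (f := fun w : Fin n → 𝒲 => (w i, η₀ (X (w i)))) (by fun_prop)
  simp only [foldError, foldMean]
  fun_prop

/-- The average over the folds of the effect of the nuisance estimation error is `o_p(n⁻¹ᐟ²)`. -/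
theorem IsLinearization.tendstoInMeasure_foldError {P : Measure Ω} [IsProbabilityMeasure P]
    {F₀ : Measure 𝒲} [IsProbabilityMeasure F₀] {W : ℕ → Ω → 𝒲} (hW : ∀ i, Measurable (W i))
    (hlaw : ∀ i, P.map (W i) = F₀) (hindep : iIndepFun W P) {X : 𝒲 → 𝒳} (hX : Measurable X)
    {T : Set (EuclideanSpace ℝ (Fin p))} {η₀ : 𝒳 → EuclideanSpace ℝ (Fin p)} (hη₀ : Measurable η₀)
    {ψ : 𝒲 → EuclideanSpace ℝ (Fin p) → ℝ} (hψ : Measurable (Function.uncurry ψ)) {L : ℝ}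
    {G : 𝒲 → EuclideanSpace ℝ (Fin p)} (hG : IsLinearization F₀ X T η₀ ψ L G)
    {K : ℕ → ℕ} {S : (n : ℕ) → Ω → Fin n → Fin (K n)}
    (hS : ∀ n, Measurable (S n)) (hSbal : ∀ n ω, IsBalanced (S n ω))
    (hSindep : ∀ n, IndepFun (S n) (fun ω (i : ℕ) => W i ω) P)
    {est : (n : ℕ) → NuisanceEstimator 𝒲 𝒳 p n (K n)}
    (hest : ∀ n s k, Measurable (Function.uncurry (est n s k)))
    (hestT : ∀ n s k d x, est n s k d x ∈ T) {φ₁ φ₂ : ℝ}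
    (hA2 : ExpansionAssumption P F₀ X η₀ φ₁ φ₂ K W S est)
    (hKn : ∀ n, K n ≤ n) (hK : Tendsto K atTop atTop) {c : ℝ}
    (hKc : Tendsto (fun n : ℕ => (K n : ℝ) / √n) atTop (𝓝 c)) (hφ : 1 / 4 < min φ₁ φ₂) :
    TendstoInMeasure P (fun (n : ℕ) ω => √n * (K n : ℝ)⁻¹ *
      ∑ k, |foldError X η₀ ψ (est n) (S n ω) (fun i => W i ω) k|) atTop 0 := by
  obtain ⟨C, hC0, hC⟩ := hA2.exists_lintegral_error_le hW hlaw hindep hX hS hSbal hSindep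
    (by linarith) hK
  generalize min φ₁ φ₂ = κ at *
  have hc : 0 ≤ c := ge_of_tendsto' hKc fun n => by positivity
  have hL := hG.pos
  have hl0 : Tendsto (fun n : ℕ => (n : ℝ) ^ (-(κ - 1 / 4))) atTop (𝓝 0) :=
    (tendsto_rpow_neg_atTop (by linarith)).comp tendsto_natCast_atTop_atTop
  have ha : Tendsto (fun n : ℕ => (n : ℝ) ^ (-(κ - 1 / 4)) *
      (2 * (c + 1) + 2 * L * C + 2 * L * C * (n : ℝ) ^ (-(κ - 1 / 4)))) atTop (𝓝 0) := by
    have := hl0.mul ((hl0.const_mul (2 * L * C)).const_add (2 * (c + 1) + 2 * L * C))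
    simpa using this
  refine tendstoInMeasure_zero_of_lintegral_le (fun n => Measurable.aemeasurable ?_) 1
    ha ?_
  · refine Measurable.const_mul ?_ _
    exact measurable_comp_split hW (hS n)
      (f := fun s w => ∑ k, |foldError X η₀ ψ (est n) s w k|) fun s =>
        Finset.measurable_fun_sum _ fun k _ =>
          (measurable_foldError hX hη₀ hψ (hest n) s k).abs
  have happrox : ∀ᵐ ω ∂P, ∀ i : ℕ, ∀ η ∈ T, |ψ (W i ω) η - ψ (W i ω) (η₀ (X (W i ω))) -
      inner ℝ (G (W i ω)) (η - η₀ (X (W i ω)))| ≤ L * ‖η - η₀ (X (W i ω))‖ ^ 2 := by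
    refine ae_all_iff.2 fun i => ?_
    exact ae_of_ae_map (hW i).aemeasurable (by rw [hlaw i]; exact hG.approx)
  filter_upwards [hC, eventually_fold_size hKn hK hKc, eventually_ge_atTop 1] with n hCn hsize hn1
  obtain ⟨hK1, hq1, hnq, hKs, hsq⟩ := hsize
  have hn0 : (0 : ℝ) < n := by exact_mod_cast hn1
  have hK0 : (0 : ℝ) < K n := by exact_mod_cast hK1
  have hq0 : (0 : ℝ) < (n / K n : ℕ) := by exact_mod_cast hq1
  -- With K at most of order √n and squares summing to order n^(1 - 2κ), the terms Kl and n^(1 - 2κ)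
  -- / l balance at l² = √n n^(-2κ) when K is of order √n. This l tends to zero exactly when κ >
  -- 1/4.
  obtain ⟨l, hl⟩ : ∃ l : ℝ, l = (n : ℝ) ^ (-(κ - 1 / 4)) := ⟨_, rfl⟩
  have hlpos : 0 < l := by rw [hl]; positivity
  have hl2 : √n * (n : ℝ) ^ (-(2 * κ)) = l ^ 2 := by
    rw [hl, Real.sqrt_eq_rpow, ← Real.rpow_add hn0, ← Real.rpow_natCast, ← Real.rpow_mul hn0.le]
    congr 1
    push_cast
    ring
  rw [← hl]
  obtain ⟨q, hq⟩ : ∃ q : ℝ, q = (n / K n : ℕ) := ⟨_, rfl⟩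
  rw [← hq] at hnq hsq hq0
  -- A collects the normalizations and is of order n^(-1/2), since Kq and n are comparable.
  obtain ⟨A, hA⟩ : ∃ A : ℝ, A = √n * (K n : ℝ)⁻¹ * q⁻¹ := ⟨_, rfl⟩
  have hA0 : 0 ≤ A := by rw [hA]; positivity
  have hAn : A * n ≤ 2 * √n := by
    have : (n : ℝ) * ((K n : ℝ)⁻¹ * q⁻¹) ≤ 2 := by
      rw [← mul_inv, ← div_eq_mul_inv, div_le_iff₀ (by positivity)]
      exact hnq
    calc A * n = √n * (n * ((K n : ℝ)⁻¹ * q⁻¹)) := by rw [hA]; ring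
      _ ≤ √n * 2 := by gcongr
      _ = 2 * √n := by ring
  have hAK : A * K n ≤ 2 * (c + 1) := by
    calc A * K n = √n / q := by rw [hA]; field_simp
      _ ≤ 2 * (c + 1) := by rw [div_le_iff₀ hq0]; exact hsq
  have hpt : ∀ᵐ ω ∂P, ‖√n * (K n : ℝ)⁻¹ *
      ∑ k, |foldError X η₀ ψ (est n) (S n ω) (fun i => W i ω) k|‖ₑ ^ 1 ≤
      ENNReal.ofReal (A * K n * l) + (ENNReal.ofReal (A * l⁻¹) *
        ∑ k, ‖foldLinear X η₀ G (est n) (S n ω) k (fun i => W i ω)‖ₑ ^ 2 + ENNReal.ofReal (A * L) *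
        ∑ i : Fin n, ‖crossFit X (est n) (S n ω) (fun i => W i ω) i - η₀ (X (W i ω))‖ₑ ^ 2) := by
    filter_upwards [happrox] with ω hω
    have h1 := sum_abs_foldError_le X (hestT n) (hSbal n ω) hq1 (w := fun i => W i ω)
      (fun i => hω i) hlpos
    rw [← hq] at h1
    have h2 : ∀ {E : Type} [NormedAddCommGroup E] (x : E), ‖x‖ₑ ^ 2 = ENNReal.ofReal (‖x‖ ^ 2) := by
      intro E _ x
      rw [ENNReal.ofReal_pow (norm_nonneg _), ofReal_norm]
    simp only [h2, ← ENNReal.ofReal_sum_of_nonneg fun i _ => sq_nonneg _]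
    rw [← ENNReal.ofReal_mul (by positivity), ← ENNReal.ofReal_mul (by positivity),
      ← ENNReal.ofReal_add (by positivity) (by positivity),
      ← ENNReal.ofReal_add (by positivity) (by positivity), pow_one, ← ofReal_norm,
      Real.norm_of_nonneg (by positivity)]
    refine ENNReal.ofReal_le_ofReal ?_
    calc _ ≤ √n * (K n : ℝ)⁻¹ * (q⁻¹ * (K n * l + l⁻¹ *
          ∑ k, foldLinear X η₀ G (est n) (S n ω) k (fun i => W i ω) ^ 2 +
          L * ∑ i : Fin n, ‖crossFit X (est n) (S n ω) (fun i => W i ω) i - η₀ (X (W i ω))‖ ^ 2)) :=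
          mul_le_mul_of_nonneg_left h1 (by positivity)
      _ = _ := by
          rw [hA]
          simp only [Real.norm_eq_abs, sq_abs]
          ring
  have hT := hG.lintegral_sum_foldLinear_sq_le hW hlaw hindep hX hη₀ (hest n) (hS n) (hSindep n)
  have hE : ∑ i : Fin n, ∫⁻ ω, ‖crossFit X (est n) (S n ω) (fun j => W j ω) i -
      η₀ (X (W i ω))‖ₑ ^ 2 ∂P ≤ ENNReal.ofReal (n * (C * (n : ℝ) ^ (-(2 * κ)))) := by
    refine (Finset.sum_le_sum fun i _ => hCn i).trans (le_of_eq ?_)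
    rw [Finset.sum_const, Finset.card_univ, Fintype.card_fin, nsmul_eq_mul,
      ENNReal.ofReal_mul (p := (n : ℝ)) hn0.le, ENNReal.ofReal_natCast]
  have hmT : Measurable fun ω =>
      ∑ k, ‖foldLinear X η₀ G (est n) (S n ω) k (fun i => W i ω)‖ₑ ^ 2 := by
    refine measurable_comp_split hW (hS n)
      (f := fun s w => ∑ k, ‖foldLinear X η₀ G (est n) s k w‖ₑ ^ 2) fun s => ?_
    refine Finset.measurable_fun_sum _ fun k _ => Measurable.pow_const (Measurable.enorm ?_) 2
    exact Finset.measurable_fun_sum _ fun i _ =>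
      (hG.measurable.comp (measurable_pi_apply _)).inner
        ((measurable_crossFit hX (hest n) s i).sub (by fun_prop))
  have hmD : ∀ i : Fin n, Measurable fun ω =>
      ‖crossFit X (est n) (S n ω) (fun i => W i ω) i - η₀ (X (W i ω))‖ₑ ^ 2 := fun i =>
    measurable_comp_split hW (hS n)
      (f := fun s w => ‖crossFit X (est n) s w i - η₀ (X (w i))‖ₑ ^ 2) fun s =>
        (Measurable.enorm ((measurable_crossFit hX (hest n) s i).sub (by fun_prop))).pow_const 2
  refine (lintegral_mono_ae hpt).trans ?_
  rw [lintegral_add_left measurable_const, lintegral_add_left (hmT.const_mul _),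
    lintegral_const_mul _ hmT, lintegral_const_mul _ (Finset.measurable_fun_sum _ fun i _ => hmD i),
    lintegral_finsetSum _ fun i _ => hmD i, lintegral_const, measure_univ, mul_one]
  calc _ ≤ ENNReal.ofReal (A * K n * l) + (ENNReal.ofReal (A * l⁻¹) *
        (ENNReal.ofReal L * ENNReal.ofReal (n * (C * (n : ℝ) ^ (-(2 * κ))))) +
        ENNReal.ofReal (A * L) * ENNReal.ofReal (n * (C * (n : ℝ) ^ (-(2 * κ))))) := by
        gcongr
        exact hT.trans (by gcongr)
    _ = ENNReal.ofReal (A * K n * l + (A * l⁻¹ * (L * (n * (C * (n : ℝ) ^ (-(2 * κ))))) +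
        A * L * (n * (C * (n : ℝ) ^ (-(2 * κ)))))) := by
        rw [← ENNReal.ofReal_mul hL.le, ← ENNReal.ofReal_mul (by positivity),
          ← ENNReal.ofReal_mul (by positivity), ← ENNReal.ofReal_add (by positivity) (by positivity),
          ← ENNReal.ofReal_add (by positivity) (by positivity)]
    _ ≤ _ := by
        refine ENNReal.ofReal_le_ofReal ?_
        have h1 : A * (n * (C * (n : ℝ) ^ (-(2 * κ)))) ≤ 2 * C * l ^ 2 := by
          calc _ = A * n * (C * (n : ℝ) ^ (-(2 * κ))) := by ring
            _ ≤ 2 * √n * (C * (n : ℝ) ^ (-(2 * κ))) := by gcongr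
            _ = 2 * C * l ^ 2 := by rw [← hl2]; ring
        calc _ = A * K n * l + (l⁻¹ * L + L) * (A * (n * (C * (n : ℝ) ^ (-(2 * κ))))) := by ring
          _ ≤ 2 * (c + 1) * l + (l⁻¹ * L + L) * (2 * C * l ^ 2) := by gcongr
          _ = _ := by
              field_simp
              ring

end FoldErrorRate

/-! ### Moments and independence of fold means. -/

section FoldMean

variable {𝒲 : Type*} [MeasurableSpace 𝒲] {n K : ℕ} {F₀ : Measure 𝒲} [IsProbabilityMeasure F₀]
  {u : 𝒲 → ℝ}

theorem measurable_foldMean (hu : Measurable u) (s : Fin n → Fin K) (k : Fin K) :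
    Measurable fun w : Fin n → 𝒲 => foldMean s k fun i => u (w i) := by
  refine Measurable.const_mul (Finset.measurable_fun_sum _ fun i _ => ?_) _
  exact hu.comp (measurable_pi_apply _)

theorem iIndepFun_comp_eval (hu : Measurable u) :
    iIndepFun (fun (i : Fin n) (w : Fin n → 𝒲) => u (w i)) (Measure.pi fun _ => F₀) :=
  iIndepFun_pi fun _ => hu.aemeasurable

theorem memLp_comp_eval {q : ℝ≥0∞} (hu : MemLp u q F₀) (i : Fin n) :
    MemLp (fun w : Fin n → 𝒲 => u (w i)) q (Measure.pi fun _ => F₀) :=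
  hu.comp_measurePreserving (measurePreserving_eval (fun _ : Fin n => F₀) i)

theorem memLp_foldMean {q : ℝ≥0∞} (hu : MemLp u q F₀) (s : Fin n → Fin K) (k : Fin K) :
    MemLp (fun w : Fin n → 𝒲 => foldMean s k fun i => u (w i)) q (Measure.pi fun _ => F₀) :=
  (memLp_finsetSum _ fun (i : {i // s i = k}) _ => memLp_comp_eval hu (i : Fin n)).const_mul _

theorem integral_foldMean_pow_four_le (hum : Measurable u) (hu : MemLp u 4 F₀)
    (hu0 : ∫ w, u w ∂F₀ = 0) {s : Fin n → Fin K} (hs : IsBalanced s) (hq : 1 ≤ n / K)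
    (k : Fin K) :
    ∫ w, (foldMean s k fun i => u (w i)) ^ 4 ∂(Measure.pi fun _ : Fin n => F₀) ≤
      3 * (∫ w, u w ^ 4 ∂F₀) / ((n / K : ℕ) : ℝ) ^ 2 := by
  have hq0 : (0 : ℝ) < (n / K : ℕ) := by exact_mod_cast hq
  have hqk : ((n / K : ℕ) : ℝ) ≤ Fintype.card {i // s i = k} := by exact_mod_cast hs.div_le_card k
  have hκ : 0 ≤ ∫ w, u w ^ 4 ∂F₀ := integral_nonneg fun w => by positivity
  have h1 := integral_sum_pow_four_le (P := Measure.pi fun _ : Fin n => F₀)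
    (Z := fun (i : {i // s i = k}) w => u (w i))
    ((iIndepFun_comp_eval hum).precomp Subtype.val_injective)
    (fun i => memLp_comp_eval hu (i : Fin n))
    (fun i => hum.comp (measurable_pi_apply _)) (κ := ∫ w, u w ^ 4 ∂F₀)
    (fun i => (integral_comp_eval_pi F₀ (i : Fin n) hum.aestronglyMeasurable).trans hu0)
    (fun i => (integral_comp_eval_pi F₀ (i : Fin n) (hum.pow_const 4).aestronglyMeasurable).le)
    Finset.univ
  simp only [foldMean, mul_pow]
  rw [integral_const_mul]
  rw [Finset.card_univ] at h1
  refine (mul_le_mul_of_nonneg_left h1 (by positivity)).trans ?_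
  have hpos := hq0.trans_le hqk
  calc _ = 3 * (∫ w, u w ^ 4 ∂F₀) / (Fintype.card {i // s i = k} : ℝ) ^ 2 := by field_simp
    _ ≤ _ := by gcongr

/-- An equality is needed here, not a bound: these second moments produce the asymptotic bias. -/
theorem integral_foldMean_sq (hum : Measurable u) (hu : MemLp u 2 F₀)
    (hu0 : ∫ w, u w ∂F₀ = 0) {s : Fin n → Fin K} (hs : IsBalanced s) (hq : 1 ≤ n / K)
    (k : Fin K) :
    ∫ w, (foldMean s k fun i => u (w i)) ^ 2 ∂(Measure.pi fun _ : Fin n => F₀) =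
      (∫ w, u w ^ 2 ∂F₀) / Fintype.card {i // s i = k} := by
  have hqk : 0 < Fintype.card {i // s i = k} := lt_of_lt_of_le hq (hs.div_le_card k)
  have hqk' : (0 : ℝ) < Fintype.card {i // s i = k} := by exact_mod_cast hqk
  obtain ⟨Z, hZ⟩ : ∃ Z : {i // s i = k} → (Fin n → 𝒲) → ℝ, Z = fun i w => u (w i) := ⟨_, rfl⟩
  have hZm : ∀ i, Measurable (Z i) := fun i => by
    rw [hZ]
    exact hum.comp (measurable_pi_apply _)
  have hZL : ∀ i, MemLp (Z i) 2 (Measure.pi fun _ : Fin n => F₀) := fun i => by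
    rw [hZ]
    exact memLp_comp_eval hu (i : Fin n)
  have hZ0 : ∀ i, ∫ w, Z i w ∂(Measure.pi fun _ : Fin n => F₀) = 0 := fun i => by
    rw [hZ]
    exact (integral_comp_eval_pi F₀ (i : Fin n) hum.aestronglyMeasurable).trans hu0
  have hZv : ∀ i, Var[Z i; Measure.pi fun _ : Fin n => F₀] = ∫ w, u w ^ 2 ∂F₀ := fun i => by
    rw [variance_of_integral_eq_zero (hZm i).aemeasurable (hZ0 i), hZ]
    exact integral_comp_eval_pi F₀ (i : Fin n) (hum.pow_const 2).aestronglyMeasurable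
  have hZi : iIndepFun Z (Measure.pi fun _ : Fin n => F₀) := by
    rw [hZ]
    exact (iIndepFun_comp_eval hum).precomp Subtype.val_injective
  have hvar : Var[∑ i, Z i; Measure.pi fun _ : Fin n => F₀] =
      Fintype.card {i // s i = k} * ∫ w, u w ^ 2 ∂F₀ := by
    rw [IndepFun.variance_sum (fun i _ => hZL i) fun i _ j _ hij => hZi.indepFun hij]
    simp [hZv]
  have hmean : ∫ w, (∑ i, Z i) w ∂(Measure.pi fun _ : Fin n => F₀) = 0 := by
    simp only [Finset.sum_apply]
    rw [integral_finsetSum _ fun i _ => (hZL i).integrable (by norm_num)]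
    exact Finset.sum_eq_zero fun i _ => hZ0 i
  have hZs : Measurable (∑ i, Z i) := by
    simpa only [Finset.sum_fn] using Finset.measurable_fun_sum Finset.univ fun i _ => hZm i
  rw [variance_of_integral_eq_zero hZs.aemeasurable hmean] at hvar
  simp only [Finset.sum_apply, hZ] at hvar
  simp only [foldMean, mul_pow]
  rw [integral_const_mul, hvar]
  field_simp

/-- Different folds use disjoint sets of coordinates. The work lies in rewriting the sum over a
subtype as a sum over a finset. -/
theorem indepFun_foldMean (hum : Measurable u) (s : Fin n → Fin K) {k l : Fin K} (hkl : k ≠ l) :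
    IndepFun (fun w : Fin n → 𝒲 => foldMean s k fun i => u (w i))
      (fun w => foldMean s l fun i => u (w i)) (Measure.pi fun _ => F₀) := by
  classical
  have hdis : Disjoint (Finset.univ.filter fun i => s i = k)
      (Finset.univ.filter fun i => s i = l) :=
    Finset.disjoint_filter.2 fun i _ h1 h2 => hkl (h1.symm.trans h2)
  have h := (iIndepFun_comp_eval (F₀ := F₀) hum).indepFun_finset _ _ hdis
    fun i : Fin n => hum.comp (measurable_pi_apply i)
  have hφ : ∀ k : Fin K, Measurable fun z : {i // i ∈ Finset.univ.filter fun i => s i = k} → ℝ =>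
      (Fintype.card {i // s i = k} : ℝ)⁻¹ * ∑ i, z i := fun k =>
    (Finset.measurable_fun_sum _ fun i _ => measurable_pi_apply i).const_mul _
  have hk : ∀ (k : Fin K) (f : Fin n → ℝ), ∑ i : {i // s i = k}, f i =
      ∑ i : {i // i ∈ Finset.univ.filter fun i => s i = k}, f i := fun k f => by
    rw [Finset.sum_coe_sort _ f]
    exact (Finset.sum_subtype (p := fun i => s i = k) _ (by simp) f).symm
  have h2 := h.comp (hφ k) (hφ l)
  simp only [Function.comp_def] at h2
  have hk' : ∀ k : Fin K, (fun w : Fin n → 𝒲 => foldMean s k fun i => u (w i)) = fun w =>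
      (Fintype.card {i // s i = k} : ℝ)⁻¹ *
        ∑ i : {i // i ∈ Finset.univ.filter fun i => s i = k}, u (w i) := fun k => by
    funext w
    rw [foldMean, hk k fun i => u (w i)]
  rw [hk' k, hk' l]
  exact h2

theorem integrable_foldMean_pow_four (hu : MemLp u 4 F₀) (s : Fin n → Fin K) (k : Fin K) :
    Integrable (fun w : Fin n → 𝒲 => (foldMean s k fun i => u (w i)) ^ 4)
      (Measure.pi fun _ => F₀) := by
  have h := memLp_foldMean hu s k
  have h1 : Integrable (fun w : Fin n → 𝒲 => ‖foldMean s k fun i => u (w i)‖ ^ 4)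
    (Measure.pi fun _ => F₀) := MemLp.integrable_norm_pow (p := 4) h (by norm_num)
  exact h1.mono' (h.1.pow 4) (ae_of_all _ fun ω => by simp)

theorem memLp_foldMean_sq (hu : MemLp u 4 F₀) (s : Fin n → Fin K) (k : Fin K) :
    MemLp (fun w : Fin n → 𝒲 => (foldMean s k fun i => u (w i)) ^ 2) 2
      (Measure.pi fun _ => F₀) := by
  refine (memLp_two_iff_integrable_sq ((memLp_foldMean hu s k).1.pow 2)).2 ?_
  simpa only [Pi.pow_apply, ← pow_mul] using integrable_foldMean_pow_four hu s k

theorem variance_sum_foldMean_sq_le (hum : Measurable u) (hu : MemLp u 4 F₀)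
    (hu0 : ∫ w, u w ∂F₀ = 0) {s : Fin n → Fin K} (hs : IsBalanced s) (hq : 1 ≤ n / K) :
    Var[∑ k, fun w : Fin n → 𝒲 => (foldMean s k fun i => u (w i)) ^ 2;
      Measure.pi fun _ : Fin n => F₀] ≤ K * (3 * (∫ w, u w ^ 4 ∂F₀) / ((n / K : ℕ) : ℝ) ^ 2) := by
  rw [IndepFun.variance_sum (fun k _ => memLp_foldMean_sq hu s k) fun k _ l _ hkl =>
    (indepFun_foldMean hum s hkl).comp (measurable_id.pow_const 2) (measurable_id.pow_const 2)]
  refine (Finset.sum_le_sum (g := fun _ => 3 * (∫ w, u w ^ 4 ∂F₀) / ((n / K : ℕ) : ℝ) ^ 2)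
    fun k _ => ?_).trans (by simp)
  refine (variance_le_expectation_sq (memLp_foldMean_sq hu s k).1).trans ?_
  simpa only [Pi.pow_apply, ← pow_mul] using integral_foldMean_pow_four_le hum hu hu0 hs hq k

/-- For both admissible sizes |n - K n_k| ≤ K; then divide by n_k ≥ ⌊n/K⌋. -/
theorem IsBalanced.abs_div_card_sub_le {s : Fin n → Fin K} (hs : IsBalanced s) (hq : 1 ≤ n / K)
    (k : Fin K) : |(n : ℝ) / Fintype.card {i // s i = k} - K| ≤ K / ((n / K : ℕ) : ℝ) := by
  have hq0 : (0 : ℝ) < (n / K : ℕ) := by exact_mod_cast hq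
  have hqk : ((n / K : ℕ) : ℝ) ≤ Fintype.card {i // s i = k} := by exact_mod_cast hs.div_le_card k
  have hK : 0 < K := k.pos
  have h1 := Nat.div_add_mod n K
  have h2 : n % K < K := Nat.mod_lt _ hK
  have hle : |(n : ℝ) - K * Fintype.card {i // s i = k}| ≤ K := by
    have h3 : (n : ℝ) = K * (n / K : ℕ) + (n % K : ℕ) := by exact_mod_cast h1.symm
    have h4 : ((n % K : ℕ) : ℝ) ≤ K := by exact_mod_cast h2.le
    have h5 : (0 : ℝ) ≤ (n % K : ℕ) := Nat.cast_nonneg _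
    rw [abs_le]
    rcases hs k with h | h <;> rw [h] <;> push_cast <;> constructor <;> nlinarith
  have hpos := hq0.trans_le hqk
  rw [show (n : ℝ) / Fintype.card {i // s i = k} - K =
    (n - K * Fintype.card {i // s i = k}) / Fintype.card {i // s i = k} by field_simp, abs_div,
    abs_of_pos hpos]
  gcongr

/-- The scaled sum of the squared fold means concentrates. -/
theorem integral_sum_foldMean_sq_sub_sq_le (hum : Measurable u) (hu : MemLp u 4 F₀)
    (hu0 : ∫ w, u w ∂F₀ = 0) {s : Fin n → Fin K} (hs : IsBalanced s) (hK : 1 ≤ K) (hq : 1 ≤ n / K)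
    (c : ℝ) :
    ∫ w, (√n * (K : ℝ)⁻¹ * ∑ k, (foldMean s k fun i => u (w i)) ^ 2 - c * ∫ w, u w ^ 2 ∂F₀) ^ 2
      ∂(Measure.pi fun _ : Fin n => F₀) ≤
      3 * (∫ w, u w ^ 4 ∂F₀) * n / (K * ((n / K : ℕ) : ℝ) ^ 2) +
      ((∫ w, u w ^ 2 ∂F₀) * (K / √n / (n / K : ℕ) + |K / √n - c|)) ^ 2 := by
  have hK0 : (0 : ℝ) < K := by exact_mod_cast hK
  have hn : 0 < n := by
    rcases Nat.eq_zero_or_pos n with rfl | h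
    · simp at hq
    · exact h
  have hs0 : 0 < √(n : ℝ) := Real.sqrt_pos.2 (by exact_mod_cast hn)
  have hu2 : MemLp u 2 F₀ := hu.mono_exponent (by norm_num)
  have hσ : 0 ≤ ∫ w, u w ^ 2 ∂F₀ := integral_nonneg fun w => by positivity
  obtain ⟨Y, hY⟩ : ∃ Y : (Fin n → 𝒲) → ℝ, Y = ∑ k, fun w => (foldMean s k fun i => u (w i)) ^ 2 :=
    ⟨_, rfl⟩
  have hYv := variance_sum_foldMean_sq_le hum hu hu0 hs hq
  rw [← hY] at hYv
  have hYL : MemLp Y 2 (Measure.pi fun _ : Fin n => F₀) := by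
    rw [hY]
    exact memLp_finsetSum' _ fun k _ => memLp_foldMean_sq hu s k
  have hYi : ∫ w, Y w ∂(Measure.pi fun _ : Fin n => F₀) =
      ∑ k, (∫ w, u w ^ 2 ∂F₀) / Fintype.card {i // s i = k} := by
    simp only [hY, Finset.sum_apply]
    rw [integral_finsetSum _ fun k _ => (memLp_foldMean_sq hu s k).integrable (by norm_num)]
    exact Finset.sum_congr rfl fun k _ => integral_foldMean_sq hum hu2 hu0 hs hq k
  have hYw : ∀ w, ∑ k, (foldMean s k fun i => u (w i)) ^ 2 = Y w := fun w => by
    simp [hY]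
  simp only [hYw]
  generalize ∫ w, u w ^ 2 ∂F₀ = σ at *
  -- Split into variance and squared bias around cσ. The variance is small by independence of the
  -- folds.
  have hdecomp : ∫ w, (√n * (K : ℝ)⁻¹ * Y w - c * σ) ^ 2 ∂(Measure.pi fun _ : Fin n => F₀) =
      (√n * (K : ℝ)⁻¹) ^ 2 * Var[Y; Measure.pi fun _ : Fin n => F₀] +
      (√n * (K : ℝ)⁻¹ * ∫ w, Y w ∂(Measure.pi fun _ : Fin n => F₀) - c * σ) ^ 2 := by
    have hZ : MemLp (fun w => √n * (K : ℝ)⁻¹ * Y w - c * σ) 2 (Measure.pi fun _ : Fin n => F₀) :=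
      (hYL.const_mul _).sub (memLp_const _)
    have h1 := variance_eq_sub hZ
    rw [variance_sub_const (hYL.const_mul _).1, variance_const_mul] at h1
    have h2 : ∫ w, (√n * (K : ℝ)⁻¹ * Y w - c * σ) ∂(Measure.pi fun _ : Fin n => F₀) =
        √n * (K : ℝ)⁻¹ * ∫ w, Y w ∂(Measure.pi fun _ : Fin n => F₀) - c * σ := by
      rw [integral_sub ((hYL.const_mul _).integrable (by norm_num)) (integrable_const _),
        integral_const_mul]
      simp
    rw [h2] at h1
    simp only [Pi.pow_apply] at h1
    linarith
  rw [hdecomp]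
  have hnn : √(n : ℝ) ^ 2 = n := Real.sq_sqrt (Nat.cast_nonneg n)
  refine add_le_add ?_ ?_
  · calc _ ≤ (√n * (K : ℝ)⁻¹) ^ 2 * _ := mul_le_mul_of_nonneg_left hYv (by positivity)
      _ = _ := by
        rw [mul_pow, hnn]
        field_simp
  · rw [hYi, sq_le_sq]
    refine le_trans ?_ (le_abs_self _)
    -- The bias has two sources: unequal fold sizes, and the distance of K/√n from its limit.
    have h1 : √n * (K : ℝ)⁻¹ * ∑ k, σ / Fintype.card {i // s i = k} - c * σ =
        σ * ((K : ℝ)⁻¹ * ∑ k, (√n)⁻¹ * (n / Fintype.card {i // s i = k} - K) + (K / √n - c)) := by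
      rw [← Finset.mul_sum, Finset.sum_sub_distrib]
      simp only [Finset.sum_const, Finset.card_univ, Fintype.card_fin, nsmul_eq_mul, div_eq_mul_inv,
        ← Finset.mul_sum]
      nth_rewrite 3 [← hnn]
      field_simp
      ring
    rw [h1, abs_mul, abs_of_nonneg hσ]
    gcongr
    refine (abs_add_le _ _).trans ?_
    gcongr
    rw [abs_mul, abs_of_pos (inv_pos.2 hK0)]
    refine (mul_le_mul_of_nonneg_left (Finset.abs_sum_le_sum_abs _ _) (by positivity)).trans ?_
    have h2 : ∀ k : Fin K, |(√(n : ℝ))⁻¹ * (n / Fintype.card {i // s i = k} - K)| ≤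
        K / √n / (n / K : ℕ) := fun k => by
      rw [abs_mul, abs_of_pos (inv_pos.2 hs0)]
      calc _ ≤ (√(n : ℝ))⁻¹ * (K / (n / K : ℕ)) := by
            gcongr
            exact hs.abs_div_card_sub_le hq k
        _ = _ := by field_simp
    refine (mul_le_mul_of_nonneg_left (Finset.sum_le_sum fun k _ => h2 k) (by positivity)).trans ?_
    simp
    field_simp
    rfl

end FoldMean

/-! ### First-order and cubic sums of fold means. -/

section FoldMeanSum

variable {𝒲 : Type*} [MeasurableSpace 𝒲] {n K : ℕ} {F₀ : Measure 𝒲} [IsProbabilityMeasure F₀]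
  {u v : 𝒲 → ℝ}

/-- With equal folds the average of the fold means is the sample mean. In general the difference is
a weighted sum whose weights measure how far n / n_k is from K. -/
theorem sum_foldMean_sub_eq (s : Fin n → Fin K) (hn : 0 < n) (hK : 0 < K) (x : Fin n → ℝ) :
    √n * (K : ℝ)⁻¹ * ∑ k, foldMean s k x - (√n)⁻¹ * ∑ i, x i =
      ∑ i, (√n * (K : ℝ))⁻¹ * (n / Fintype.card {j // s j = s i} - K) * x i := by
  have hnn : √(n : ℝ) ^ 2 = n := Real.sq_sqrt (Nat.cast_nonneg n)
  have hs0 : 0 < √(n : ℝ) := Real.sqrt_pos.2 (by exact_mod_cast hn)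
  have hK0 : (0 : ℝ) < K := by exact_mod_cast hK
  have h1 : ∑ k, foldMean s k x = ∑ i, (Fintype.card {j // s j = s i} : ℝ)⁻¹ * x i := by
    rw [← sum_fold s]
    refine Finset.sum_congr rfl fun k _ => ?_
    rw [foldMean, Finset.mul_sum]
    exact Finset.sum_congr rfl fun i _ => by rw [i.2]
  rw [h1, Finset.mul_sum, Finset.mul_sum, ← Finset.sum_sub_distrib]
  refine Finset.sum_congr rfl fun i _ => ?_
  rw [div_eq_mul_inv]
  nth_rewrite 4 [← hnn]
  field_simp

theorem integral_sum_foldMean_sub_sq_le (hum : Measurable u) (hu : MemLp u 2 F₀)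
    (hu0 : ∫ w, u w ∂F₀ = 0) {s : Fin n → Fin K} (hs : IsBalanced s) (hK : 1 ≤ K)
    (hq : 1 ≤ n / K) :
    ∫ w, (√n * (K : ℝ)⁻¹ * ∑ k, (foldMean s k fun i => u (w i)) - (√n)⁻¹ * ∑ i, u (w i)) ^ 2
      ∂(Measure.pi fun _ : Fin n => F₀) ≤ (∫ w, u w ^ 2 ∂F₀) / ((n / K : ℕ) : ℝ) ^ 2 := by
  have hn : 0 < n := by
    rcases Nat.eq_zero_or_pos n with rfl | h
    · simp at hq
    · exact h
  have hn0 : (0 : ℝ) < n := by exact_mod_cast hn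
  have hnn : √(n : ℝ) ^ 2 = n := Real.sq_sqrt (Nat.cast_nonneg n)
  have hs0 : 0 < √(n : ℝ) := Real.sqrt_pos.2 hn0
  have hq0 : (0 : ℝ) < (n / K : ℕ) := by exact_mod_cast hq
  have hK0 : (0 : ℝ) < K := by exact_mod_cast hK
  simp only [sum_foldMean_sub_eq s hn hK]
  obtain ⟨a, ha⟩ : ∃ a : Fin n → ℝ,
    a = fun i => (√n * (K : ℝ))⁻¹ * (n / Fintype.card {j // s j = s i} - K) := ⟨_, rfl⟩
  -- The n squared weights sum to at most q⁻², which gives the stated bound.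
  have hab : ∀ i, a i ^ 2 ≤ (n : ℝ)⁻¹ * (((n / K : ℕ) : ℝ) ^ 2)⁻¹ := fun i => by
    have h1 : |a i| ≤ (√n * (K : ℝ))⁻¹ * (K / ((n / K : ℕ) : ℝ)) := by
      rw [ha, abs_mul, abs_of_pos (by positivity)]
      gcongr
      exact hs.abs_div_card_sub_le hq (s i)
    rw [← sq_abs]
    calc |a i| ^ 2 ≤ ((√n * (K : ℝ))⁻¹ * (K / ((n / K : ℕ) : ℝ))) ^ 2 := by gcongr
      _ = _ := by
        rw [mul_pow, inv_pow, mul_pow, hnn]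
        field_simp
  have haw : ∀ w : Fin n → 𝒲, ∑ i, (√n * (K : ℝ))⁻¹ *
      (n / Fintype.card {j // s j = s i} - K) * u (w i) = ∑ i, a i * u (w i) := fun w => by
    rw [ha]
  simp only [haw]
  have hind : iIndepFun (fun (i : Fin n) (w : Fin n → 𝒲) => a i * u (w i))
      (Measure.pi fun _ => F₀) :=
    (iIndepFun_comp_eval hum).comp (fun i x => a i * x) fun i => measurable_const_mul _
  have hmean : ∀ i : Fin n, ∫ w, a i * u (w i) ∂(Measure.pi fun _ : Fin n => F₀) = 0 := fun i => by
    rw [integral_const_mul, integral_comp_eval_pi F₀ i hum.aestronglyMeasurable, hu0, mul_zero]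
  have hsq : ∀ i : Fin n, ∫ w, ‖a i * u (w i)‖ ^ 2 ∂(Measure.pi fun _ : Fin n => F₀) ≤
      (n : ℝ)⁻¹ * (((n / K : ℕ) : ℝ) ^ 2)⁻¹ * ∫ w, u w ^ 2 ∂F₀ := fun i => by
    simp only [Real.norm_eq_abs, sq_abs, mul_pow]
    rw [integral_const_mul,
      integral_comp_eval_pi F₀ i (f := fun x => u x ^ 2) (hum.pow_const 2).aestronglyMeasurable]
    exact mul_le_mul_of_nonneg_right (hab i) (integral_nonneg fun w => by positivity)
  have h := integral_norm_sum_sq_le hind (fun i => (memLp_comp_eval hu i).const_mul _)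
    (fun i => (hum.comp (measurable_pi_apply i)).const_mul _) hmean hsq Finset.univ
  simp only [Real.norm_eq_abs, sq_abs, Finset.card_univ, Fintype.card_fin] at h
  refine h.trans (le_of_eq ?_)
  field_simp
  simp

theorem lintegral_sum_foldMean_pow_four_le (hum : Measurable u) (hu : MemLp u 4 F₀)
    (hu0 : ∫ w, u w ∂F₀ = 0) {s : Fin n → Fin K} (hs : IsBalanced s) (hq : 1 ≤ n / K) :
    ∫⁻ w, ‖∑ k, (foldMean s k fun i => u (w i)) ^ 4‖ₑ ∂(Measure.pi fun _ : Fin n => F₀) ≤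
      ENNReal.ofReal (K * (3 * (∫ w, u w ^ 4 ∂F₀) / ((n / K : ℕ) : ℝ) ^ 2)) := by
  have hint : Integrable (fun w : Fin n → 𝒲 => ∑ k, (foldMean s k fun i => u (w i)) ^ 4)
      (Measure.pi fun _ => F₀) :=
    integrable_finsetSum _ fun k _ => integrable_foldMean_pow_four hu s k
  have hnn : ∀ w : Fin n → 𝒲, 0 ≤ ∑ k, (foldMean s k fun i => u (w i)) ^ 4 := fun w =>
    Finset.sum_nonneg fun k _ => by positivity
  rw [← ofReal_integral_norm_eq_lintegral_enorm hint]
  refine ENNReal.ofReal_le_ofReal ?_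
  simp only [Real.norm_eq_abs, abs_of_nonneg (hnn _)]
  rw [integral_finsetSum _ fun k _ => integrable_foldMean_pow_four hu s k]
  refine (Finset.sum_le_sum fun k _ =>
    integral_foldMean_pow_four_le hum hu hu0 hs hq k).trans (by simp)

/-- A cubic term is at most M³ with M = max(|x|, |y|), and M³ ≤ r³ + M⁴ / r according to whether M ≤
r or M ≥ r. Thus only fourth moments are needed, with r free. -/
theorem sqrt_mul_sum_abs_mul_sq_le {r : ℝ} (hr : 0 < r) (hK : 0 < K) (x y : Fin K → ℝ) :
    √n * (K : ℝ)⁻¹ * ∑ k, |x k| * y k ^ 2 ≤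
      √n * r ^ 3 + √n * (K : ℝ)⁻¹ * r⁻¹ * (∑ k, x k ^ 4 + ∑ k, y k ^ 4) := by
  have hK0 : (0 : ℝ) < K := by exact_mod_cast hK
  have key : ∀ s t : ℝ, |s| * t ^ 2 ≤ r ^ 3 + r⁻¹ * (s ^ 4 + t ^ 4) := by
    intro s t
    have hpow : ∀ m : ℝ, 0 ≤ m → m ^ 3 ≤ r ^ 3 + r⁻¹ * m ^ 4 := by
      intro m hm
      rcases le_total m r with h | h
      · have : m ^ 3 ≤ r ^ 3 := by gcongr
        have : 0 ≤ r⁻¹ * m ^ 4 := by positivity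
        linarith
      · have h1 : m ^ 3 ≤ r⁻¹ * m ^ 4 := by
          rw [← div_eq_inv_mul, le_div_iff₀ hr]
          nlinarith [pow_nonneg hm 3]
        have : 0 ≤ r ^ 3 := by positivity
        linarith
    have h4 : ∀ z : ℝ, |z| ^ 4 = z ^ 4 := fun z => by
      rw [pow_abs, abs_of_nonneg (by positivity)]
    rw [← sq_abs t, ← h4 s, ← h4 t]
    have h1 : 0 ≤ r⁻¹ * |s| ^ 4 := by positivity
    have h2 : 0 ≤ r⁻¹ * |t| ^ 4 := by positivity
    rcases le_total |s| |t| with h | h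
    · have h3 := hpow |t| (abs_nonneg t)
      have : |s| * |t| ^ 2 ≤ |t| * |t| ^ 2 := by gcongr
      linarith
    · have h3 := hpow |s| (abs_nonneg s)
      have : |s| * |t| ^ 2 ≤ |s| * |s| ^ 2 := by gcongr
      linarith
  calc _ ≤ √n * (K : ℝ)⁻¹ * ∑ k, (r ^ 3 + r⁻¹ * (x k ^ 4 + y k ^ 4)) := by
        gcongr with k _
        exact key _ _
    _ = _ := by
        rw [Finset.sum_add_distrib, ← Finset.mul_sum, Finset.sum_add_distrib]
        simp only [Finset.sum_const, Finset.card_univ, Fintype.card_fin, nsmul_eq_mul]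
        field_simp

theorem lintegral_sum_abs_mul_sq_le (hum : Measurable u) (hu : MemLp u 4 F₀)
    (hu0 : ∫ w, u w ∂F₀ = 0) (hvm : Measurable v) (hv : MemLp v 4 F₀) (hv0 : ∫ w, v w ∂F₀ = 0)
    {s : Fin n → Fin K} (hs : IsBalanced s) (hK : 1 ≤ K) (hq : 1 ≤ n / K) {r : ℝ} (hr : 0 < r) :
    ∫⁻ w, ‖√n * (K : ℝ)⁻¹ * ∑ k, |foldMean s k fun i => u (w i)| *
      (foldMean s k fun i => v (w i)) ^ 2‖ₑ ∂(Measure.pi fun _ : Fin n => F₀) ≤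
      ENNReal.ofReal (√n * r ^ 3 + √n * r⁻¹ *
        (3 * (∫ w, u w ^ 4 ∂F₀ + ∫ w, v w ^ 4 ∂F₀) / ((n / K : ℕ) : ℝ) ^ 2)) := by
  have hK0 : (0 : ℝ) < K := by exact_mod_cast hK
  obtain ⟨Y, hY⟩ : ∃ Y : (Fin n → 𝒲) → ℝ, Y = fun w => √n * r ^ 3 + √n * (K : ℝ)⁻¹ * r⁻¹ *
    (∑ k, (foldMean s k fun i => u (w i)) ^ 4 + ∑ k, (foldMean s k fun i => v (w i)) ^ 4) :=
    ⟨_, rfl⟩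
  have hi : ∀ {f : 𝒲 → ℝ}, MemLp f 4 F₀ → Integrable
      (fun w : Fin n → 𝒲 => ∑ k, (foldMean s k fun i => f (w i)) ^ 4) (Measure.pi fun _ => F₀) :=
    fun hf => integrable_finsetSum _ fun k _ => integrable_foldMean_pow_four hf s k
  have hYi : Integrable Y (Measure.pi fun _ => F₀) := by
    rw [hY]
    exact (integrable_const _).add (((hi hu).add (hi hv)).const_mul _)
  have hYb : ∫ w, Y w ∂(Measure.pi fun _ : Fin n => F₀) ≤ √n * r ^ 3 + √n * r⁻¹ *
      (3 * (∫ w, u w ^ 4 ∂F₀ + ∫ w, v w ^ 4 ∂F₀) / ((n / K : ℕ) : ℝ) ^ 2) := by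
    have hb : ∀ {f : 𝒲 → ℝ}, Measurable f → MemLp f 4 F₀ → ∫ w, f w ∂F₀ = 0 →
        ∫ w, ∑ k, (foldMean s k fun i => f (w i)) ^ 4 ∂(Measure.pi fun _ : Fin n => F₀) ≤
          K * (3 * (∫ w, f w ^ 4 ∂F₀) / ((n / K : ℕ) : ℝ) ^ 2) := fun {f} hfm hf hf0 => by
      rw [integral_finsetSum _ fun k _ => integrable_foldMean_pow_four hf s k]
      exact (Finset.sum_le_sum fun k _ =>
        integral_foldMean_pow_four_le hfm hf hf0 hs hq k).trans (by simp)
    rw [hY, integral_add (integrable_const _) (((hi hu).fun_add (hi hv)).const_mul _)]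
    simp only [integral_const, probReal_univ, one_smul]
    rw [integral_const_mul, integral_add (hi hu) (hi hv)]
    refine add_le_add le_rfl ?_
    calc _ ≤ √n * (K : ℝ)⁻¹ * r⁻¹ * (K * (3 * (∫ w, u w ^ 4 ∂F₀) / ((n / K : ℕ) : ℝ) ^ 2) +
          K * (3 * (∫ w, v w ^ 4 ∂F₀) / ((n / K : ℕ) : ℝ) ^ 2)) := by
          gcongr
          · exact hb hum hu hu0
          · exact hb hvm hv hv0
      _ = _ := by field_simp
  refine le_trans ?_ (ENNReal.ofReal_le_ofReal hYb)
  have hYnn : ∀ w, 0 ≤ Y w := fun w => by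
    rw [hY]
    positivity
  rw [ofReal_integral_eq_lintegral_ofReal hYi (ae_of_all _ hYnn)]
  refine lintegral_mono fun w => ?_
  rw [Real.enorm_of_nonneg (by positivity), hY]
  exact ENNReal.ofReal_le_ofReal (sqrt_mul_sum_abs_mul_sq_le hr hK _ _)

end FoldMeanSum

/-! ### Limits in probability of the oracle terms. -/

section FoldMeanLimits

variable {Ω 𝒲 : Type*} [MeasurableSpace Ω] [MeasurableSpace 𝒲]

theorem lintegral_enorm_sq_le_of_integral_le {P : Measure Ω} {f : Ω → ℝ} (hf : MemLp f 2 P) {B : ℝ}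
    (h : ∫ ω, f ω ^ 2 ∂P ≤ B) : ∫⁻ ω, ‖f ω‖ₑ ^ 2 ∂P ≤ ENNReal.ofReal B := by
  rw [lintegral_enorm_pow_eq_ofReal two_ne_zero (by exact_mod_cast hf)]
  simpa using ENNReal.ofReal_le_ofReal h

variable {P : Measure Ω} [IsProbabilityMeasure P] {F₀ : Measure 𝒲} [IsProbabilityMeasure F₀]
  {W : ℕ → Ω → 𝒲} {K : ℕ → ℕ} {S : (n : ℕ) → Ω → Fin n → Fin (K n)} {u v : 𝒲 → ℝ} {c : ℝ}

/-- The scaled average of the fold means agrees with the scaled sample mean. -/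
theorem tendstoInMeasure_sum_foldMean_sub (hW : ∀ i, Measurable (W i))
    (hlaw : ∀ i, P.map (W i) = F₀) (hindep : iIndepFun W P) (hS : ∀ n, Measurable (S n))
    (hSbal : ∀ n ω, IsBalanced (S n ω))
    (hSindep : ∀ n, IndepFun (S n) (fun ω (i : ℕ) => W i ω) P) (hKn : ∀ n, K n ≤ n)
    (hK : Tendsto K atTop atTop) (hKc : Tendsto (fun n : ℕ => (K n : ℝ) / √n) atTop (𝓝 c))
    (hum : Measurable u) (hu : MemLp u 2 F₀) (hu0 : ∫ w, u w ∂F₀ = 0) :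
    TendstoInMeasure P (fun (n : ℕ) ω => √n * (K n : ℝ)⁻¹ *
      ∑ k, (foldMean (S n ω) k fun i => u (W i ω)) - (√n)⁻¹ * ∑ i : Fin n, u (W i ω))
      atTop 0 := by
  have hm : ∀ (n : ℕ) (s : Fin n → Fin (K n)), Measurable fun w : Fin n → 𝒲 =>
      √n * (K n : ℝ)⁻¹ * ∑ k, (foldMean s k fun i => u (w i)) - (√n)⁻¹ * ∑ i : Fin n, u (w i) :=
    fun n s => ((Finset.measurable_fun_sum _ fun k _ => measurable_foldMean hum s k).const_mul
      _).sub ((Finset.measurable_fun_sum _ fun i _ => hum.comp (measurable_pi_apply i)).const_mul _)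
  have hL : ∀ (n : ℕ) (s : Fin n → Fin (K n)), MemLp (fun w : Fin n → 𝒲 =>
      √n * (K n : ℝ)⁻¹ * ∑ k, (foldMean s k fun i => u (w i)) - (√n)⁻¹ * ∑ i : Fin n, u (w i)) 2
      (Measure.pi fun _ => F₀) := fun n s =>
    ((memLp_finsetSum _ fun k _ => memLp_foldMean hu s k).const_mul _).sub
      ((memLp_finsetSum _ fun i _ => memLp_comp_eval hu i).const_mul _)
  have ha : Tendsto (fun n : ℕ => (∫ w, u w ^ 2 ∂F₀) / ((n / K n : ℕ) : ℝ) ^ 2) atTop (𝓝 0) :=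
    tendsto_const_nhds.div_atTop
      ((tendsto_pow_atTop two_ne_zero).comp (tendsto_fold_size hKn hK hKc))
  refine tendstoInMeasure_zero_of_lintegral_le
    (fun n => (measurable_comp_split hW (hS n) (hm n)).aemeasurable) 2 ha ?_
  filter_upwards [eventually_fold_size hKn hK hKc] with n hn
  exact lintegral_comp_split_le hW hlaw hindep (hS n) (hSbal n) (hSindep n)
    (fun s => (hm n s).enorm.pow_const 2) fun s hs =>
    lintegral_enorm_sq_le_of_integral_le (hL n s)
      (integral_sum_foldMean_sub_sq_le hum hu hu0 hs hn.1 hn.2.1)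

/-- The scaled average of the squared fold means converges in probability. -/
theorem tendstoInMeasure_sum_foldMean_sq (hW : ∀ i, Measurable (W i))
    (hlaw : ∀ i, P.map (W i) = F₀) (hindep : iIndepFun W P) (hS : ∀ n, Measurable (S n))
    (hSbal : ∀ n ω, IsBalanced (S n ω))
    (hSindep : ∀ n, IndepFun (S n) (fun ω (i : ℕ) => W i ω) P) (hKn : ∀ n, K n ≤ n)
    (hK : Tendsto K atTop atTop) (hKc : Tendsto (fun n : ℕ => (K n : ℝ) / √n) atTop (𝓝 c))
    (hum : Measurable u) (hu : MemLp u 4 F₀) (hu0 : ∫ w, u w ∂F₀ = 0) :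
    TendstoInMeasure P (fun (n : ℕ) ω => √n * (K n : ℝ)⁻¹ *
      ∑ k, (foldMean (S n ω) k fun i => u (W i ω)) ^ 2 - c * ∫ w, u w ^ 2 ∂F₀) atTop 0 := by
  have hm : ∀ (n : ℕ) (s : Fin n → Fin (K n)), Measurable fun w : Fin n → 𝒲 =>
      √n * (K n : ℝ)⁻¹ * ∑ k, (foldMean s k fun i => u (w i)) ^ 2 - c * ∫ w, u w ^ 2 ∂F₀ :=
    fun n s => ((Finset.measurable_fun_sum _ fun k _ =>
      (measurable_foldMean hum s k).pow_const 2).const_mul _).sub_const _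
  have hL : ∀ (n : ℕ) (s : Fin n → Fin (K n)), MemLp (fun w : Fin n → 𝒲 =>
      √n * (K n : ℝ)⁻¹ * ∑ k, (foldMean s k fun i => u (w i)) ^ 2 - c * ∫ w, u w ^ 2 ∂F₀) 2
      (Measure.pi fun _ => F₀) := fun n s =>
    ((memLp_finsetSum _ fun k _ => memLp_foldMean_sq hu s k).const_mul _).sub (memLp_const _)
  have hq := tendsto_fold_size hKn hK hKc
  -- The variance term 3 E[u⁴] n / (Kq²) is at most 6 E[u⁴] / q, because n ≤ 2Kq.
  have ha : Tendsto (fun n : ℕ => 6 * (∫ w, u w ^ 4 ∂F₀) / ((n / K n : ℕ) : ℝ) +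
      ((∫ w, u w ^ 2 ∂F₀) * ((K n : ℝ) / √n / (n / K n : ℕ) + |(K n : ℝ) / √n - c|)) ^ 2)
      atTop (𝓝 0) := by
    have h1 : Tendsto (fun n : ℕ => 6 * (∫ w, u w ^ 4 ∂F₀) / ((n / K n : ℕ) : ℝ)) atTop (𝓝 0) :=
      tendsto_const_nhds.div_atTop hq
    have h2 : Tendsto (fun n : ℕ => (K n : ℝ) / √n / (n / K n : ℕ)) atTop (𝓝 0) :=
      hKc.div_atTop hq
    have h3 : Tendsto (fun n : ℕ => |(K n : ℝ) / √n - c|) atTop (𝓝 0) := by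
      simpa using (hKc.sub_const c).abs
    simpa using h1.add (((h2.add h3).const_mul (∫ w, u w ^ 2 ∂F₀)).pow 2)
  refine tendstoInMeasure_zero_of_lintegral_le
    (fun n => (measurable_comp_split hW (hS n) (hm n)).aemeasurable) 2 ha ?_
  filter_upwards [eventually_fold_size hKn hK hKc] with n hn
  refine lintegral_comp_split_le hW hlaw hindep (hS n) (hSbal n) (hSindep n)
    (fun s => (hm n s).enorm.pow_const 2) fun s hs =>
    lintegral_enorm_sq_le_of_integral_le (hL n s)
      ((integral_sum_foldMean_sq_sub_sq_le hum hu hu0 hs hn.1 hn.2.1 c).trans ?_)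
  have hK0 : (0 : ℝ) < K n := by exact_mod_cast hn.1
  have hq0 : (0 : ℝ) < (n / K n : ℕ) := by exact_mod_cast hn.2.1
  have hκ : 0 ≤ ∫ w, u w ^ 4 ∂F₀ := integral_nonneg fun w => by positivity
  refine add_le_add ?_ le_rfl
  rw [div_le_div_iff₀ (by positivity) hq0]
  have h1 := mul_le_mul_of_nonneg_left hn.2.2.1
    (show 0 ≤ 3 * (∫ w, u w ^ 4 ∂F₀) * ((n / K n : ℕ) : ℝ) by positivity)
  linarith

/-- This controls all fold means simultaneously, so that no denominator in the estimator comes near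
zero. The expectation is O(K/q²) = O(1/q), since K is at most a constant times q. -/
theorem tendstoInMeasure_sum_foldMean_pow_four (hW : ∀ i, Measurable (W i))
    (hlaw : ∀ i, P.map (W i) = F₀) (hindep : iIndepFun W P) (hS : ∀ n, Measurable (S n))
    (hSbal : ∀ n ω, IsBalanced (S n ω))
    (hSindep : ∀ n, IndepFun (S n) (fun ω (i : ℕ) => W i ω) P) (hKn : ∀ n, K n ≤ n)
    (hK : Tendsto K atTop atTop) (hKc : Tendsto (fun n : ℕ => (K n : ℝ) / √n) atTop (𝓝 c))
    (hum : Measurable u) (hu : MemLp u 4 F₀) (hu0 : ∫ w, u w ∂F₀ = 0) :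
    TendstoInMeasure P (fun (n : ℕ) ω => ∑ k, (foldMean (S n ω) k fun i => u (W i ω)) ^ 4)
      atTop 0 := by
  have hm : ∀ (n : ℕ) (s : Fin n → Fin (K n)), Measurable fun w : Fin n → 𝒲 =>
      ∑ k, (foldMean s k fun i => u (w i)) ^ 4 :=
    fun n s => Finset.measurable_fun_sum _ fun k _ => (measurable_foldMean hum s k).pow_const 4
  have hc : 0 ≤ c := ge_of_tendsto' hKc fun n => by positivity
  have hκ : 0 ≤ ∫ w, u w ^ 4 ∂F₀ := integral_nonneg fun w => by positivity
  have ha : Tendsto (fun n : ℕ => 6 * (c + 1) ^ 2 * (∫ w, u w ^ 4 ∂F₀) / ((n / K n : ℕ) : ℝ))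
      atTop (𝓝 0) := tendsto_const_nhds.div_atTop (tendsto_fold_size hKn hK hKc)
  refine tendstoInMeasure_zero_of_lintegral_le
    (fun n => (measurable_comp_split hW (hS n) (hm n)).aemeasurable) 1 ha ?_
  filter_upwards [eventually_fold_size hKn hK hKc] with n hn
  simp only [pow_one]
  refine lintegral_comp_split_le hW hlaw hindep (hS n) (hSbal n) (hSindep n)
    (fun s => (hm n s).enorm) fun s hs =>
    (lintegral_sum_foldMean_pow_four_le hum hu hu0 hs hn.2.1).trans (ENNReal.ofReal_le_ofReal ?_)
  have hq0 : (0 : ℝ) < (n / K n : ℕ) := by exact_mod_cast hn.2.1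
  have h1 : (K n : ℝ) ≤ 2 * (c + 1) ^ 2 * (n / K n : ℕ) := by
    have := mul_le_mul_of_nonneg_left hn.2.2.2.2 (show 0 ≤ c + 1 by positivity)
    linarith [hn.2.2.2.1]
  calc _ ≤ 2 * (c + 1) ^ 2 * (n / K n : ℕ) *
        (3 * (∫ w, u w ^ 4 ∂F₀) / ((n / K n : ℕ) : ℝ) ^ 2) := by gcongr
    _ = _ := by
      field_simp
      ring

/-- Taking r = q^(-1/2), the typical size of a fold mean, makes both parts of the cubic bound of
order √n q^(-3/2), which is O(q^(-1/2)). -/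
theorem tendstoInMeasure_sum_abs_mul_sq (hW : ∀ i, Measurable (W i))
    (hlaw : ∀ i, P.map (W i) = F₀) (hindep : iIndepFun W P) (hS : ∀ n, Measurable (S n))
    (hSbal : ∀ n ω, IsBalanced (S n ω))
    (hSindep : ∀ n, IndepFun (S n) (fun ω (i : ℕ) => W i ω) P) (hKn : ∀ n, K n ≤ n)
    (hK : Tendsto K atTop atTop) (hKc : Tendsto (fun n : ℕ => (K n : ℝ) / √n) atTop (𝓝 c))
    (hum : Measurable u) (hu : MemLp u 4 F₀) (hu0 : ∫ w, u w ∂F₀ = 0)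
    (hvm : Measurable v) (hv : MemLp v 4 F₀) (hv0 : ∫ w, v w ∂F₀ = 0) :
    TendstoInMeasure P (fun (n : ℕ) ω => √n * (K n : ℝ)⁻¹ *
      ∑ k, |foldMean (S n ω) k fun i => u (W i ω)| *
        (foldMean (S n ω) k fun i => v (W i ω)) ^ 2) atTop 0 := by
  have hm : ∀ (n : ℕ) (s : Fin n → Fin (K n)), Measurable fun w : Fin n → 𝒲 =>
      √n * (K n : ℝ)⁻¹ * ∑ k, |foldMean s k fun i => u (w i)| *
        (foldMean s k fun i => v (w i)) ^ 2 :=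
    fun n s => (Finset.measurable_fun_sum _ fun k _ => (measurable_foldMean hum s k).abs.mul
      ((measurable_foldMean hvm s k).pow_const 2)).const_mul _
  have hc : 0 ≤ c := ge_of_tendsto' hKc fun n => by positivity
  have hκ : 0 ≤ ∫ w, u w ^ 4 ∂F₀ + ∫ w, v w ^ 4 ∂F₀ :=
    add_nonneg (integral_nonneg fun w => by positivity) (integral_nonneg fun w => by positivity)
  generalize hκe : ∫ w, u w ^ 4 ∂F₀ + ∫ w, v w ^ 4 ∂F₀ = κ at hκ
  have ha : Tendsto (fun n : ℕ => 2 * (c + 1) * (1 + 3 * κ) / √((n / K n : ℕ) : ℝ))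
      atTop (𝓝 0) := tendsto_const_nhds.div_atTop
    (Real.tendsto_sqrt_atTop.comp (tendsto_fold_size hKn hK hKc))
  refine tendstoInMeasure_zero_of_lintegral_le
    (fun n => (measurable_comp_split hW (hS n) (hm n)).aemeasurable) 1 ha ?_
  filter_upwards [eventually_fold_size hKn hK hKc] with n hn
  simp only [pow_one]
  have hq0 : (0 : ℝ) < (n / K n : ℕ) := by exact_mod_cast hn.2.1
  have hr : 0 < √((n / K n : ℕ) : ℝ) := Real.sqrt_pos.2 hq0
  refine lintegral_comp_split_le hW hlaw hindep (hS n) (hSbal n) (hSindep n)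
    (fun s => (hm n s).enorm) fun s hs =>
    (lintegral_sum_abs_mul_sq_le hum hu hu0 hvm hv hv0 hs hn.1 hn.2.1 (inv_pos.2 hr)).trans
      (ENNReal.ofReal_le_ofReal ?_)
  rw [hκe]
  have hq2 : ((n / K n : ℕ) : ℝ) = √((n / K n : ℕ) : ℝ) ^ 2 := (Real.sq_sqrt hq0.le).symm
  have h1 := hn.2.2.2.2
  rw [hq2] at h1 ⊢
  rw [Real.sqrt_sq hr.le]
  generalize √((n / K n : ℕ) : ℝ) = r at *
  calc √n * r⁻¹ ^ 3 + √n * r⁻¹⁻¹ * (3 * κ / (r ^ 2) ^ 2) = √n * ((1 + 3 * κ) / r ^ 3) := by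
        field_simp
    _ ≤ 2 * (c + 1) * r ^ 2 * ((1 + 3 * κ) / r ^ 3) := by gcongr
    _ = _ := by field_simp

end FoldMeanLimits

/-! ### Tools for convergence in probability and in distribution. -/

section ConvergenceTools

variable {Ω : Type*} [MeasurableSpace Ω] {P : Measure Ω} {f g : ℕ → Ω → ℝ}

theorem tendstoInMeasure_zero_add (hf : TendstoInMeasure P f atTop 0)
    (hg : TendstoInMeasure P g atTop 0) :
    TendstoInMeasure P (fun n ω => f n ω + g n ω) atTop 0 := by
  rw [tendstoInMeasure_iff_norm] at *
  intro ε hε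
  have h := (hf (ε / 2) (half_pos hε)).add (hg (ε / 2) (half_pos hε))
  rw [add_zero] at h
  refine tendsto_of_tendsto_of_tendsto_of_le_of_le tendsto_const_nhds h (fun _ => zero_le)
    fun n => ?_
  refine (measure_mono fun ω hω => ?_).trans (measure_union_le _ _)
  simp only [Set.mem_ofPred_eq, Set.mem_union, Pi.zero_apply, sub_zero, Real.norm_eq_abs] at hω ⊢
  by_contra! hcon
  linarith [abs_add_le (f n ω) (g n ω)]

theorem tendstoInMeasure_zero_abs (hf : TendstoInMeasure P f atTop 0) :
    TendstoInMeasure P (fun n ω => |f n ω|) atTop 0 := by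
  rw [tendstoInMeasure_iff_norm] at *
  simpa using hf

/-- The comparison is required only on the event |f| < δ, whose probability tends to one. This lets
a deterministic expansion valid near the limit be used as it stands. -/
theorem tendstoInMeasure_zero_of_abs_le_mul (hf : TendstoInMeasure P f atTop 0) {δ C : ℝ}
    (hδ : 0 < δ) (hC : 0 < C) (h : ∀ᶠ n in atTop, ∀ ω, |f n ω| < δ → |g n ω| ≤ C * |f n ω|) :
    TendstoInMeasure P g atTop 0 := by
  rw [tendstoInMeasure_iff_norm] at *
  intro ε hε
  refine tendsto_of_tendsto_of_tendsto_of_le_of_le' tendsto_const_nhds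
    (hf (min δ (ε / C)) (by positivity)) (Eventually.of_forall fun _ => zero_le) ?_
  filter_upwards [h] with n hn
  refine measure_mono fun ω hω => ?_
  simp only [Set.mem_ofPred_eq, Pi.zero_apply, sub_zero, Real.norm_eq_abs] at hω ⊢
  by_contra! hcon
  have h1 := hn ω (hcon.trans_le (min_le_left _ _))
  have h2 : |f n ω| * C < ε := (lt_div_iff₀ hC).1 (hcon.trans_le (min_le_right _ _))
  linarith

theorem tendstoInDistribution_id_of_hasLaw [IsProbabilityMeasure P] {Ω' : Type*}
    [MeasurableSpace Ω'] {μ : Measure Ω'} [IsProbabilityMeasure μ] {ν : Measure ℝ}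
    [IsProbabilityMeasure ν] {Z : Ω' → ℝ} (h : TendstoInDistribution f atTop Z (fun _ => P) μ)
    (hZ : HasLaw Z ν μ) : TendstoInDistribution f atTop (id : ℝ → ℝ) (fun _ => P) ν where
  forall_aemeasurable := h.forall_aemeasurable
  aemeasurable_limit := aemeasurable_id
  tendsto := by
    have hmap : Measure.map id ν = Measure.map Z μ := by rw [Measure.map_id, hZ.map_eq]
    have heq : (⟨Measure.map id ν, Measure.isProbabilityMeasure_map aemeasurable_id⟩ :
        ProbabilityMeasure ℝ) =
        ⟨Measure.map Z μ, Measure.isProbabilityMeasure_map h.aemeasurable_limit⟩ := Subtype.ext hmap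
    rw [heq]
    exact h.tendsto

end ConvergenceTools

/-! ### Second-order expansion of the foldwise ratios. -/

section RatioExpansion

/-- Over the common denominator a²(a + V + D) the error is exactly a²N + UV² + U(V - a)D, and |a + V
+ D| ≥ |a|/2. The assumption |U| ≤ 1 makes the D term linear in |D|; its constant 5/2 is rounded up
to 3. -/
theorem abs_ratio_sub_le {a U V N D : ℝ} (ha : a ≠ 0) (hU : |U| ≤ 1) (hV : |V| ≤ |a| / 4)
    (hD : |D| ≤ |a| / 4) :
    |(U + N) / (a + V + D) - (a⁻¹ * U - (a ^ 2)⁻¹ * (U * V))| ≤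
      2 / |a| * |N| + 3 / a ^ 2 * |D| + 2 / |a| ^ 3 * (|U| * V ^ 2) := by
  have ha0 : 0 < |a| := abs_pos.2 ha
  have hA : |a| / 2 ≤ |a + V + D| := by
    have h1 := abs_sub_abs_le_abs_sub a (-(V + D))
    rw [abs_neg, sub_neg_eq_add, ← add_assoc] at h1
    linarith [abs_add_le V D]
  have hA0 : a + V + D ≠ 0 := abs_pos.1 (by linarith)
  have hid : (U + N) / (a + V + D) - (a⁻¹ * U - (a ^ 2)⁻¹ * (U * V)) =
      (a ^ 2 * N + (U * V ^ 2 + U * (V - a) * D)) / (a ^ 2 * (a + V + D)) := by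
    field_simp
    ring
  have hUV : |U * (V - a)| ≤ 5 / 4 * |a| := by
    rw [abs_mul]
    have h1 : |V - a| ≤ 5 / 4 * |a| := by linarith [abs_sub V a]
    nlinarith [abs_nonneg U, abs_nonneg (V - a)]
  have hnum : |a ^ 2 * N + (U * V ^ 2 + U * (V - a) * D)| ≤
      |a| ^ 2 * |N| + (|U| * V ^ 2 + 5 / 4 * |a| * |D|) := by
    refine (abs_add_le _ _).trans (add_le_add ?_ ((abs_add_le _ _).trans (add_le_add ?_ ?_)))
    · rw [abs_mul, abs_pow]
    · rw [abs_mul, abs_of_nonneg (sq_nonneg V)]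
    · rw [abs_mul]
      gcongr
  have hden : |a| ^ 3 / 2 ≤ |a ^ 2 * (a + V + D)| := by
    rw [abs_mul, abs_pow]
    calc |a| ^ 3 / 2 = |a| ^ 2 * (|a| / 2) := by ring
      _ ≤ _ := by gcongr
  rw [hid, abs_div]
  calc _ ≤ (|a| ^ 2 * |N| + (|U| * V ^ 2 + 5 / 4 * |a| * |D|)) / (|a| ^ 3 / 2) := by gcongr
    _ = 2 / |a| * |N| + 5 / 2 / |a| ^ 2 * |D| + 2 / |a| ^ 3 * (|U| * V ^ 2) := by
      field_simp
      ring
    _ ≤ _ := by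
      rw [sq_abs]
      gcongr
      norm_num

theorem abs_mul_sum_ratio_sub_le {K : ℕ} {r a θ : ℝ} (hr : 0 ≤ r) (ha : a ≠ 0)
    {U V Da Db : Fin K → ℝ} (hU : ∀ k, |U k| ≤ 1) (hV : ∀ k, |V k| ≤ |a| / 4)
    (hD : ∀ k, |Da k| ≤ |a| / 4) :
    |r * ∑ k, (U k + (Db k - θ * Da k)) / (a + V k + Da k) -
      (a⁻¹ * (r * ∑ k, U k) - (a ^ 2)⁻¹ * (r * ∑ k, U k * V k))| ≤
      2 / |a| * (r * ∑ k, |Db k|) + (2 / |a| * |θ| + 3 / a ^ 2) * (r * ∑ k, |Da k|) +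
        2 / |a| ^ 3 * (r * ∑ k, |U k| * V k ^ 2) := by
  have h1 : r * ∑ k, (U k + (Db k - θ * Da k)) / (a + V k + Da k) -
      (a⁻¹ * (r * ∑ k, U k) - (a ^ 2)⁻¹ * (r * ∑ k, U k * V k)) =
      r * ∑ k, ((U k + (Db k - θ * Da k)) / (a + V k + Da k) -
        (a⁻¹ * U k - (a ^ 2)⁻¹ * (U k * V k))) := by
    simp only [Finset.sum_sub_distrib, ← Finset.mul_sum]
    ring
  have h2 : 2 / |a| * (r * ∑ k, |Db k|) + (2 / |a| * |θ| + 3 / a ^ 2) * (r * ∑ k, |Da k|) +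
        2 / |a| ^ 3 * (r * ∑ k, |U k| * V k ^ 2) =
      r * ∑ k, (2 / |a| * |Db k| + (2 / |a| * |θ| + 3 / a ^ 2) * |Da k| +
        2 / |a| ^ 3 * (|U k| * V k ^ 2)) := by
    simp only [Finset.sum_add_distrib, ← Finset.mul_sum]
    ring
  rw [h1, h2, abs_mul, abs_of_nonneg hr]
  gcongr
  refine (Finset.abs_sum_le_sum_abs _ _).trans (Finset.sum_le_sum fun k _ => ?_)
  refine (abs_ratio_sub_le ha (hU k) (hV k) (hD k)).trans ?_
  have h3 : |Db k - θ * Da k| ≤ |Db k| + |θ| * |Da k| := by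
    rw [← abs_mul]
    exact abs_sub _ _
  have h4 := mul_le_mul_of_nonneg_left h3 (show 0 ≤ 2 / |a| by positivity)
  linarith

variable {𝒲 𝒳 : Type*} {p n K : ℕ}

theorem foldMean_add (s : Fin n → Fin K) (k : Fin K) (x y : Fin n → ℝ) :
    foldMean s k (fun i => x i + y i) = foldMean s k x + foldMean s k y := by
  rw [foldMean, foldMean, foldMean, ← mul_add, Finset.sum_add_distrib]

theorem foldMean_sub (s : Fin n → Fin K) (k : Fin K) (x y : Fin n → ℝ) :
    foldMean s k (fun i => x i - y i) = foldMean s k x - foldMean s k y := by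
  rw [foldMean, foldMean, foldMean, ← mul_sub, Finset.sum_sub_distrib]

theorem IsBalanced.foldMean_const {s : Fin n → Fin K} (hs : IsBalanced s) (hq : 1 ≤ n / K)
    (k : Fin K) (a : ℝ) : foldMean s k (fun _ => a) = a := by
  have h : Fintype.card {i // s i = k} ≠ 0 := (lt_of_lt_of_le hq (hs.div_le_card k)).ne'
  have h' : (Fintype.card {i // s i = k} : ℝ) ≠ 0 := by exact_mod_cast h
  rw [foldMean, Finset.sum_const, Finset.card_univ, nsmul_eq_mul, inv_mul_cancel_left₀ h']

/-- The moment is affine in θ, so B/A - θ = (B - θA)/A fold by fold. Nonzero denominators are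
essential: with division by zero equal to zero, the left side would be -θ and the right side 0. -/
theorem dml1_sub_eq (X : 𝒲 → 𝒳) (η₀ : 𝒳 → EuclideanSpace ℝ (Fin p))
    (ψa ψb : 𝒲 → EuclideanSpace ℝ (Fin p) → ℝ) (est : NuisanceEstimator 𝒲 𝒳 p n K)
    {s : Fin n → Fin K} (hs : IsBalanced s) (hK : 1 ≤ K) (hq : 1 ≤ n / K) (w : Fin n → 𝒲)
    {a : ℝ} (θ : ℝ)
    (hne : ∀ k, a + (foldMean s k fun i => ψa (w i) (η₀ (X (w i))) - a) +
      foldError X η₀ ψa est s w k ≠ 0) :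
    dml1 X ψa ψb est s w - θ = (K : ℝ)⁻¹ * ∑ k,
      ((foldMean s k fun i => moment ψa ψb (w i) θ (η₀ (X (w i)))) +
        (foldError X η₀ ψb est s w k - θ * foldError X η₀ ψa est s w k)) /
      (a + (foldMean s k fun i => ψa (w i) (η₀ (X (w i))) - a) +
        foldError X η₀ ψa est s w k) := by
  have hK0 : (K : ℝ) ≠ 0 := by
    have : K ≠ 0 := by omega
    exact_mod_cast this
  have hm : ∀ k, (foldMean s k fun i => moment ψa ψb (w i) θ (η₀ (X (w i)))) =
      (foldMean s k fun i => ψb (w i) (η₀ (X (w i)))) -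
        θ * foldMean s k fun i => ψa (w i) (η₀ (X (w i))) := fun k => by
    simp only [moment, foldMean_sub]
    congr 1
    rw [foldMean, foldMean, ← Finset.sum_mul]
    ring
  have hden : ∀ k, a + (foldMean s k fun i => ψa (w i) (η₀ (X (w i))) - a) +
      foldError X η₀ ψa est s w k = foldMean s k fun i => ψa (w i) (crossFit X est s w i) := by
    intro k
    rw [foldMean_sub, hs.foldMean_const hq, foldError]
    ring
  have hθ : θ = (K : ℝ)⁻¹ * ∑ _k : Fin K, θ := by
    simp [inv_mul_cancel_left₀ hK0]
  rw [dml1]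
  nth_rewrite 1 [hθ]
  rw [← mul_sub, ← Finset.sum_sub_distrib]
  congr 1
  refine Finset.sum_congr rfl fun k _ => ?_
  have hk := hne k
  rw [hden k] at hk ⊢
  rw [eq_div_iff hk, sub_mul, div_mul_cancel₀ _ hk, hm k, foldError, foldError]
  ring

end RatioExpansion

/-! ### Expansion of the estimator and the central limit theorem. -/

section AsymptoticExpansion

variable {Ω 𝒲 𝒳 : Type*} {p : ℕ}

/-- On the event that the oracle fold means and the nuisance errors are small, the estimator agrees
with its linear expansion up to these errors. -/
theorem abs_sqrt_mul_dml1_sub_le {n K : ℕ} (X : 𝒲 → 𝒳) (η₀ : 𝒳 → EuclideanSpace ℝ (Fin p))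
    (ψa ψb : 𝒲 → EuclideanSpace ℝ (Fin p) → ℝ) (est : NuisanceEstimator 𝒲 𝒳 p n K)
    {s : Fin n → Fin K} (hs : IsBalanced s) (hK : 1 ≤ K) (hq : 1 ≤ n / K) (w : Fin n → 𝒲)
    {a c θ E R₁ R₂ : ℝ} (ha : a ≠ 0) (hKc : (K : ℝ) ≤ (c + 1) * √n) {U V : Fin K → ℝ}
    (hU : U = fun k => foldMean s k fun i => moment ψa ψb (w i) θ (η₀ (X (w i))))
    (hV : V = fun k => foldMean s k fun i => ψa (w i) (η₀ (X (w i))) - a)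
    (hR₁ : R₁ = √n * (K : ℝ)⁻¹ * ∑ k, U k -
      (√n)⁻¹ * ∑ i, moment ψa ψb (w i) θ (η₀ (X (w i))))
    (hR₂ : R₂ = √n * (K : ℝ)⁻¹ * ∑ k, U k * V k - c * E)
    (hU1 : ∑ k, U k ^ 4 ≤ 1) (hV1 : ∑ k, V k ^ 4 ≤ (|a| / 4) ^ 4)
    (hDa : (c + 1) * (√n * (K : ℝ)⁻¹ * ∑ k, |foldError X η₀ ψa est s w k|) ≤ |a| / 4) :
    |√n * (dml1 X ψa ψb est s w - θ) -
      (a⁻¹ * ((√n)⁻¹ * ∑ i, moment ψa ψb (w i) θ (η₀ (X (w i)))) - (a ^ 2)⁻¹ * (c * E))| ≤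
      2 / |a| * (√n * (K : ℝ)⁻¹ * ∑ k, |foldError X η₀ ψb est s w k|) +
      (2 / |a| * |θ| + 3 / a ^ 2) * (√n * (K : ℝ)⁻¹ * ∑ k, |foldError X η₀ ψa est s w k|) +
      2 / |a| ^ 3 * (√n * (K : ℝ)⁻¹ * ∑ k, |U k| * V k ^ 2) + |a|⁻¹ * |R₁| + (a ^ 2)⁻¹ * |R₂| := by
  have hK0 : (0 : ℝ) < K := by exact_mod_cast hK
  have ha0 : 0 < |a| := abs_pos.2 ha
  have habs : ∀ {x y : ℝ}, 0 ≤ y → x ^ 4 ≤ y ^ 4 → |x| ≤ y := fun {x y} hy h =>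
    (pow_le_pow_iff_left₀ (abs_nonneg x) hy four_ne_zero).1 (by rwa [Even.pow_abs (by decide)])
  have hUk : ∀ k, |U k| ≤ 1 := fun k => by
    have h1 : U k ^ 4 ≤ 1 ^ 4 := by
      rw [one_pow]
      exact (Finset.single_le_sum (f := fun k => U k ^ 4) (fun k _ => by positivity)
        (Finset.mem_univ k)).trans hU1
    exact habs zero_le_one h1
  have hVk : ∀ k, |V k| ≤ |a| / 4 := fun k => by
    have h1 := (Finset.single_le_sum (f := fun k => V k ^ 4) (fun k _ => by positivity)
        (Finset.mem_univ k)).trans hV1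
    exact habs (by positivity) h1
  have hDk : ∀ k, |foldError X η₀ ψa est s w k| ≤ |a| / 4 := fun k => by
    have h1 := Finset.single_le_sum (f := fun k => |foldError X η₀ ψa est s w k|)
      (fun k _ => abs_nonneg _) (Finset.mem_univ k)
    refine h1.trans (le_trans ?_ hDa)
    have h2 : 0 ≤ ∑ k, |foldError X η₀ ψa est s w k| := Finset.sum_nonneg fun _ _ => abs_nonneg _
    -- Because K ≤ (c + 1)√n, the scaled average of the |Dᵃ_k| dominates, up to c + 1, their plain
    -- sum and hence each of them.
    have h3 : 1 ≤ (c + 1) * (√n * (K : ℝ)⁻¹) := by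
      rw [← mul_assoc, ← div_eq_mul_inv, le_div_iff₀ hK0]
      linarith
    calc _ = 1 * ∑ k, |foldError X η₀ ψa est s w k| := (one_mul _).symm
      _ ≤ (c + 1) * (√n * (K : ℝ)⁻¹) * ∑ k, |foldError X η₀ ψa est s w k| := by gcongr
      _ = _ := by ring
  have hne : ∀ k, a + V k + foldError X η₀ ψa est s w k ≠ 0 := fun k => by
    have h1 := abs_sub_abs_le_abs_sub a (-(V k + foldError X η₀ ψa est s w k))
    rw [abs_neg, sub_neg_eq_add, ← add_assoc] at h1
    have h2 := abs_add_le (V k) (foldError X η₀ ψa est s w k)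
    exact abs_pos.1 (by linarith [hVk k, hDk k])
  have hdml : dml1 X ψa ψb est s w - θ = (K : ℝ)⁻¹ * ∑ k,
      (U k + (foldError X η₀ ψb est s w k - θ * foldError X η₀ ψa est s w k)) /
      (a + V k + foldError X η₀ ψa est s w k) := by
    simp only [hU, hV] at hne ⊢
    exact dml1_sub_eq X η₀ ψa ψb est hs hK hq w θ hne
  have hmain := abs_mul_sum_ratio_sub_le (r := √n * (K : ℝ)⁻¹) (θ := θ)
    (Db := foldError X η₀ ψb est s w) (by positivity) ha hUk hVk hDk
  rw [hdml, ← mul_assoc]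
  have hr : a⁻¹ * ((√n)⁻¹ * ∑ i, moment ψa ψb (w i) θ (η₀ (X (w i)))) - (a ^ 2)⁻¹ * (c * E) =
      (a⁻¹ * (√n * (K : ℝ)⁻¹ * ∑ k, U k) -
        (a ^ 2)⁻¹ * (√n * (K : ℝ)⁻¹ * ∑ k, U k * V k)) - (a⁻¹ * R₁ - (a ^ 2)⁻¹ * R₂) := by
    rw [hR₁, hR₂]
    ring
  rw [hr, ← sub_add]
  refine (abs_add_le _ _).trans ?_
  rw [add_assoc (_ + _)]
  refine add_le_add hmain ((abs_sub _ _).trans (le_of_eq ?_))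
  rw [abs_mul, abs_mul, abs_inv, abs_of_pos (by positivity : 0 < (a ^ 2)⁻¹)]

variable [MeasurableSpace Ω] [MeasurableSpace 𝒲] [MeasurableSpace 𝒳]

/-- The scaled average of the products of fold means converges in probability. -/
theorem tendstoInMeasure_sum_foldMean_mul {P : Measure Ω} [IsProbabilityMeasure P] {F₀ : Measure 𝒲}
    [IsProbabilityMeasure F₀] {W : ℕ → Ω → 𝒲} {K : ℕ → ℕ} {S : (n : ℕ) → Ω → Fin n → Fin (K n)}
    {u v : 𝒲 → ℝ} {c : ℝ} (hW : ∀ i, Measurable (W i))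
    (hlaw : ∀ i, P.map (W i) = F₀) (hindep : iIndepFun W P) (hS : ∀ n, Measurable (S n))
    (hSbal : ∀ n ω, IsBalanced (S n ω))
    (hSindep : ∀ n, IndepFun (S n) (fun ω (i : ℕ) => W i ω) P) (hKn : ∀ n, K n ≤ n)
    (hK : Tendsto K atTop atTop) (hKc : Tendsto (fun n : ℕ => (K n : ℝ) / √n) atTop (𝓝 c))
    (hum : Measurable u) (hu : MemLp u 4 F₀) (hu0 : ∫ w, u w ∂F₀ = 0)
    (hvm : Measurable v) (hv : MemLp v 4 F₀) (hv0 : ∫ w, v w ∂F₀ = 0) :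
    TendstoInMeasure P (fun (n : ℕ) ω => √n * (K n : ℝ)⁻¹ *
      ∑ k, (foldMean (S n ω) k fun i => u (W i ω)) * (foldMean (S n ω) k fun i => v (W i ω)) -
        c * ∫ w, u w * v w ∂F₀) atTop 0 := by
  have hui : Integrable u F₀ := hu.integrable (by norm_num)
  have hvi : Integrable v F₀ := hv.integrable (by norm_num)
  have hu2 : MemLp u 2 F₀ := hu.mono_exponent (by norm_num)
  have hv2 : MemLp v 2 F₀ := hv.mono_exponent (by norm_num)
  -- Polarization: the result for squares is applied to u + v and u - v.
  have h1 := tendstoInMeasure_zero_abs (tendstoInMeasure_sum_foldMean_sq hW hlaw hindep hS hSbal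
    hSindep hKn hK hKc (hum.add hvm) (hu.add hv) (by
      simp only [Pi.add_apply]
      rw [integral_add hui hvi, hu0, hv0, add_zero]))
  have h2 := tendstoInMeasure_zero_abs (tendstoInMeasure_sum_foldMean_sq hW hlaw hindep hS hSbal
    hSindep hKn hK hKc (hum.sub hvm) (hu.sub hv) (by
      simp only [Pi.sub_apply]
      rw [integral_sub hui hvi, hu0, hv0, sub_zero]))
  simp only [Pi.add_apply, Pi.sub_apply, foldMean_add, foldMean_sub] at h1 h2
  have h3 := tendstoInMeasure_zero_add h1 h2
  refine tendstoInMeasure_zero_of_abs_le_mul h3 one_pos one_pos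
    (Eventually.of_forall fun n ω _ => ?_)
  have hpol : 4 * ∫ w, u w * v w ∂F₀ =
      ∫ w, (u w + v w) ^ 2 ∂F₀ - ∫ w, (u w - v w) ^ 2 ∂F₀ := by
    have hp : Integrable (fun w => (u w + v w) ^ 2) F₀ := (hu2.add hv2).integrable_sq
    have hs : Integrable (fun w => (u w - v w) ^ 2) F₀ := (hu2.sub hv2).integrable_sq
    rw [← integral_sub hp hs, ← integral_const_mul]
    congr 1
    funext w
    ring
  have hpol' : 4 * ∑ k, (foldMean (S n ω) k fun i => u (W i ω)) *
      (foldMean (S n ω) k fun i => v (W i ω)) =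
      ∑ k, ((foldMean (S n ω) k fun i => u (W i ω)) + foldMean (S n ω) k fun i => v (W i ω)) ^ 2 -
      ∑ k, ((foldMean (S n ω) k fun i => u (W i ω)) -
        foldMean (S n ω) k fun i => v (W i ω)) ^ 2 := by
    rw [Finset.mul_sum, ← Finset.sum_sub_distrib]
    exact Finset.sum_congr rfl fun k _ => by ring
  generalize ∑ k, ((foldMean (S n ω) k fun i => u (W i ω)) +
    foldMean (S n ω) k fun i => v (W i ω)) ^ 2 = A at *
  generalize ∑ k, ((foldMean (S n ω) k fun i => u (W i ω)) -
    foldMean (S n ω) k fun i => v (W i ω)) ^ 2 = B at *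
  generalize ∑ k, (foldMean (S n ω) k fun i => u (W i ω)) *
      (foldMean (S n ω) k fun i => v (W i ω)) = D at *
  generalize ∫ w, u w * v w ∂F₀ = E at *
  generalize ∫ w, (u w + v w) ^ 2 ∂F₀ = G at *
  generalize ∫ w, (u w - v w) ^ 2 ∂F₀ = H at *
  generalize √(n : ℝ) * (K n : ℝ)⁻¹ = r at *
  have hD : D = (A - B) / 4 := by linarith
  have hE : E = (G - H) / 4 := by linarith
  rw [one_mul, abs_of_nonneg (by positivity : 0 ≤ |r * A - c * G| + |r * B - c * H|), hD, hE,
    show r * ((A - B) / 4) - c * ((G - H) / 4) = ((r * A - c * G) - (r * B - c * H)) / 4 by ring,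
    abs_div, abs_of_pos (by norm_num : (0 : ℝ) < 4)]
  have := abs_sub (r * A - c * G) (r * B - c * H)
  have h5 := abs_nonneg (r * A - c * G)
  have h6 := abs_nonneg (r * B - c * H)
  linarith

theorem measurable_dml1 {n K : ℕ} {X : 𝒲 → 𝒳} (hX : Measurable X)
    {ψa ψb : 𝒲 → EuclideanSpace ℝ (Fin p) → ℝ} (hψa : Measurable (Function.uncurry ψa))
    (hψb : Measurable (Function.uncurry ψb)) {est : NuisanceEstimator 𝒲 𝒳 p n K}
    (hest : ∀ s k, Measurable (Function.uncurry (est s k))) (s : Fin n → Fin K) :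
    Measurable fun w => dml1 X ψa ψb est s w := by
  have h : ∀ {ψ : 𝒲 → EuclideanSpace ℝ (Fin p) → ℝ}, Measurable (Function.uncurry ψ) → ∀ k,
      Measurable fun w : Fin n → 𝒲 => foldMean s k fun i => ψ (w i) (crossFit X est s w i) := by
    intro ψ hψ k
    refine Measurable.const_mul (Finset.measurable_fun_sum _ fun i _ => ?_) _
    have h1 : Measurable fun w : Fin n → 𝒲 => (w i, crossFit X est s w i) :=
      (measurable_pi_apply _).prodMk (measurable_crossFit hX hest s i)
    have h2 := hψ.comp h1
    simp only [Function.comp_def, Function.uncurry_apply_pair] at h2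
    exact h2
  exact (Finset.measurable_fun_sum _ fun k _ => (h hψb k).div (h hψa k)).const_mul _

/-- The central limit theorem for an affine function of the sample mean of centred variables. -/
theorem tendstoInDistribution_affine {P : Measure Ω} [IsProbabilityMeasure P] {F₀ : Measure 𝒲}
    [IsProbabilityMeasure F₀] {W : ℕ → Ω → 𝒲} {u : 𝒲 → ℝ} (hW : ∀ i, Measurable (W i))
    (hlaw : ∀ i, P.map (W i) = F₀) (hindep : iIndepFun W P) (hum : Measurable u)
    (hu : MemLp u 2 F₀) (hu0 : ∫ w, u w ∂F₀ = 0) (α β : ℝ) :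
    TendstoInDistribution (fun (n : ℕ) ω => α * ((√n)⁻¹ * ∑ i : Fin n, u (W i ω)) + β) atTop
      (id : ℝ → ℝ) (fun _ => P) (gaussianReal β (α ^ 2 * ∫ w, u w ^ 2 ∂F₀).toNNReal) := by
  have hmp : ∀ i, MeasurePreserving (W i) P F₀ := fun i => ⟨hW i, hlaw i⟩
  have hmean : ∫ ω, u (W 0 ω) ∂P = 0 := by
    rw [← hu0, ← hlaw 0, integral_map (hW 0).aemeasurable hum.aestronglyMeasurable]
  have hvar : Var[fun ω => u (W 0 ω); P] = ∫ w, u w ^ 2 ∂F₀ := by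
    have hm0 : Measurable fun ω => u (W 0 ω) := hum.comp (hW 0)
    rw [variance_of_integral_eq_zero hm0.aemeasurable hmean, ← hlaw 0,
      integral_map (hW 0).aemeasurable (hum.pow_const 2).aestronglyMeasurable]
  have hclt := tendstoInDistribution_inv_sqrt_mul_sum_sub (P := P)
    (X := fun i ω => u (W i ω)) (Y := (id : ℝ → ℝ))
    (P' := gaussianReal 0 (Var[fun ω => u (W 0 ω); P]).toNNReal) ⟨aemeasurable_id, Measure.map_id⟩
    (hu.comp_measurePreserving (hmp 0)) (hindep.comp (fun _ => u) fun _ => hum) fun i =>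
      ⟨(hum.comp (hW i)).aemeasurable, (hum.comp (hW 0)).aemeasurable, by
        have h : ∀ j, P.map (fun ω => u (W j ω)) = F₀.map u := fun j => by
          rw [← hlaw j, Measure.map_map hum (hW j)]
          rfl
        rw [h i, h 0]⟩
  rw [hmean, hvar] at hclt
  have hg : Continuous fun x : ℝ => α * x + β := by fun_prop
  have h := hclt.continuous_comp hg
  have hlawg : HasLaw (fun x : ℝ => α * x + β)
      (gaussianReal β (α ^ 2 * ∫ w, u w ^ 2 ∂F₀).toNNReal)
      (gaussianReal 0 (∫ w, u w ^ 2 ∂F₀).toNNReal) := by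
    have hid : HasLaw (fun x : ℝ => x) (gaussianReal 0 (∫ w, u w ^ 2 ∂F₀).toNNReal)
      (gaussianReal 0 (∫ w, u w ^ 2 ∂F₀).toNNReal) := ⟨aemeasurable_id, Measure.map_id⟩
    convert gaussianReal_add_const (gaussianReal_const_mul hid α) β using 2
    · simp
    · rw [Real.toNNReal_mul (sq_nonneg α), Real.toNNReal_of_nonneg (sq_nonneg α)]
  refine tendstoInDistribution_id_of_hasLaw (Z := fun x : ℝ => α * x + β) ?_ hlawg
  -- The term n * 0 is the centring in the central limit theorem, with mean zero.
  have hfun : (fun (n : ℕ) ω => α * ((√n)⁻¹ * ∑ i : Fin n, u (W i ω)) + β) = fun (n : ℕ) =>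
      (fun x => α * x + β) ∘ fun ω => (√n)⁻¹ * (∑ k ∈ Finset.range n, u (W k ω) - n * 0) := by
    funext n ω
    simp [Finset.sum_range]
  rw [hfun]
  exact h

end AsymptoticExpansion

end DML

/-! ### The limit theorem for DML1. -/

theorem mainTheorem1
    {Ω 𝒲 𝒳 : Type*} [MeasurableSpace Ω] [MeasurableSpace 𝒲] [MeasurableSpace 𝒳]
    {p : ℕ}
    -- the data: an i.i.d. sample from `F₀`, with covariates `X`
    (P : Measure Ω) [IsProbabilityMeasure P] (F₀ : Measure 𝒲) [IsProbabilityMeasure F₀]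
    (W : ℕ → Ω → 𝒲) (hW : ∀ i, Measurable (W i)) (hlaw : ∀ i, P.map (W i) = F₀)
    (hindep : iIndepFun W P)
    (X : 𝒲 → 𝒳) (hX : Measurable X)
    -- the nuisance parameter, the moment function and the parameter of interest
    (T : Set (EuclideanSpace ℝ (Fin p))) (hT : Convex ℝ T) (hTint : (interior T).Nonempty)
    (η₀ : 𝒳 → EuclideanSpace ℝ (Fin p)) (hη₀ : Measurable η₀) (hη₀T : ∀ x, η₀ x ∈ T)
    (ψa ψb : 𝒲 → EuclideanSpace ℝ (Fin p) → ℝ) (θ₀ : ℝ)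
    (hθ₀ : ∫ w, DML.moment ψa ψb w θ₀ (η₀ (X w)) ∂F₀ = 0)
    -- the folds: random balanced splits, independent of the data
    (K : ℕ → ℕ) (S : (n : ℕ) → Ω → Fin n → Fin (K n)) (hS : ∀ n, Measurable (S n))
    (hSbal : ∀ n ω, DML.IsBalanced (S n ω))
    (hSindep : ∀ n, IndepFun (S n) (fun ω (i : ℕ) => W i ω) P)
    -- the nuisance estimators
    (est : (n : ℕ) → DML.NuisanceEstimator 𝒲 𝒳 p n (K n))
    (hest : ∀ n s k, Measurable (Function.uncurry (est n s k)))
    (hestT : ∀ n s k d x, est n s k d x ∈ T)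
    -- the two assumptions
    (φ₁ φ₂ : ℝ)
    (hA1 : DML.MomentAssumption F₀ X T η₀ ψa ψb)
    (hA2 : DML.ExpansionAssumption P F₀ X η₀ φ₁ φ₂ K W S est)
    -- the asymptotic regime
    (hKn : ∀ n, K n ≤ n) (hK : Tendsto K atTop atTop)
    (c : ℝ) (hc : 0 ≤ c)
    (hKc : Tendsto (fun n : ℕ => (K n : ℝ) / Real.sqrt n) atTop (𝓝 c))
    (hφ₁ : φ₁ ≤ 1 / 2) (hφ : 1 / 4 < min φ₁ φ₂) :
    TendstoInDistribution
      (fun (n : ℕ) ω =>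
        Real.sqrt n * (DML.dml1 X ψa ψb (est n) (S n ω) (fun i => W i ω) - θ₀))
      atTop (id : ℝ → ℝ) (fun _ => P)
      (gaussianReal (c * DML.biasCoeff F₀ X η₀ ψa ψb θ₀)
        (DML.asympVar F₀ X η₀ ψa ψb θ₀).toNNReal) := by
  obtain ⟨M, C₀, C₁, C₂, C₃, -, hC₀, hC₁, hC₂, -, haC, hRa, hRb⟩ := hA1
  obtain ⟨La, Ga, hGa⟩ := hRa.exists_isLinearization hX hT hTint hη₀T hC₁ hC₂
  obtain ⟨Lb, Gb, hGb⟩ := hRb.exists_isLinearization hX hT hTint hη₀T hC₁ hC₂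
  have hψm : ∀ {ψ : 𝒲 → EuclideanSpace ℝ (Fin p) → ℝ}, Measurable (Function.uncurry ψ) →
      Measurable fun w => ψ w (η₀ (X w)) := by
    intro ψ hψ
    have h1 : Measurable fun w => (w, η₀ (X w)) := measurable_id.prodMk (hη₀.comp hX)
    have h2 := hψ.comp h1
    simp only [Function.comp_def, Function.uncurry_apply_pair] at h2
    exact h2
  obtain ⟨a, ha⟩ : ∃ a, a = ∫ w, ψa w (η₀ (X w)) ∂F₀ := ⟨_, rfl⟩
  obtain ⟨u, hu⟩ : ∃ u : 𝒲 → ℝ, u = fun w => DML.moment ψa ψb w θ₀ (η₀ (X w)) := ⟨_, rfl⟩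
  obtain ⟨v, hv⟩ : ∃ v : 𝒲 → ℝ, v = fun w => ψa w (η₀ (X w)) - a := ⟨_, rfl⟩
  have ha0 : a ≠ 0 := by
    rw [ha]
    exact abs_pos.1 (hC₀.trans haC)
  have ha1 : 0 < |a| := abs_pos.2 ha0
  have hum : Measurable u := by
    rw [hu]
    exact (hψm hRb.measurable).sub ((hψm hRa.measurable).mul_const θ₀)
  have hvm : Measurable v := by
    rw [hv]
    exact (hψm hRa.measurable).sub_const a
  have huL : MemLp u 4 F₀ := by
    rw [hu]
    exact hRb.memLp.sub (hRa.memLp.mul_const θ₀)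
  have hvL : MemLp v 4 F₀ := by
    rw [hv]
    exact hRa.memLp.sub (memLp_const a)
  have hu0 : ∫ w, u w ∂F₀ = 0 := by rw [hu, hθ₀]
  have hv0 : ∫ w, v w ∂F₀ = 0 := by
    rw [hv, integral_sub (hRa.memLp.integrable (by norm_num)) (integrable_const _), ← ha]
    simp
  obtain ⟨E, hE⟩ : ∃ E, E = ∫ w, u w * v w ∂F₀ := ⟨_, rfl⟩
  -- As u has mean zero, its covariance with -ψᵃ is -E[uv].
  have hbias : DML.biasCoeff F₀ X η₀ ψa ψb θ₀ = -((a ^ 2)⁻¹ * E) := by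
    rw [DML.biasCoeff, ← ha, covariance, integral_neg, hθ₀, ← ha, hE, hu, hv, div_eq_inv_mul,
      ← mul_neg, ← integral_neg]
    congr 2
    funext w
    ring
  have hvar : DML.asympVar F₀ X η₀ ψa ψb θ₀ = a⁻¹ ^ 2 * ∫ w, u w ^ 2 ∂F₀ := by
    rw [DML.asympVar, ← ha, hu, div_eq_inv_mul, inv_pow]
  rw [hbias, hvar]
  -- the terms of the expansion
  have hR₁ := DML.tendstoInMeasure_zero_abs (DML.tendstoInMeasure_sum_foldMean_sub hW hlaw hindep
    hS hSbal hSindep hKn hK hKc hum (huL.mono_exponent (by norm_num)) hu0)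
  have hR₂ := DML.tendstoInMeasure_zero_abs (DML.tendstoInMeasure_sum_foldMean_mul hW hlaw hindep
    hS hSbal hSindep hKn hK hKc hum huL hu0 hvm hvL hv0)
  have hR₃ := DML.tendstoInMeasure_sum_abs_mul_sq hW hlaw hindep hS hSbal hSindep hKn hK hKc
    hum huL hu0 hvm hvL hv0
  have hY₁ := DML.tendstoInMeasure_sum_foldMean_pow_four hW hlaw hindep hS hSbal hSindep hKn hK hKc
    hum huL hu0
  have hY₂ := DML.tendstoInMeasure_sum_foldMean_pow_four hW hlaw hindep hS hSbal hSindep hKn hK hKc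
    hvm hvL hv0
  have hZa := hGa.tendstoInMeasure_foldError hW hlaw hindep hX hη₀ hRa.measurable hS hSbal hSindep
    hest hestT hA2 hKn hK hKc hφ
  have hZb := hGb.tendstoInMeasure_foldError hW hlaw hindep hX hη₀ hRb.measurable hS hSbal hSindep
    hest hestT hA2 hKn hK hKc hφ
  -- The seven error terms are nonnegative, so smallness of their sum bounds each of them.
  have hB := DML.tendstoInMeasure_zero_add (DML.tendstoInMeasure_zero_add
    (DML.tendstoInMeasure_zero_add (DML.tendstoInMeasure_zero_add (DML.tendstoInMeasure_zero_add
      (DML.tendstoInMeasure_zero_add hR₁ hR₂) hR₃) hY₁) hY₂) hZa) hZb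
  -- Slutsky: it remains to show that the estimator differs from the affine CLT statistic by o_p(1).
  refine tendstoInDistribution_of_tendstoInMeasure_sub _ _
    (DML.tendstoInDistribution_affine hW hlaw hindep hum (huL.mono_exponent (by norm_num)) hu0 a⁻¹
      (c * -((a ^ 2)⁻¹ * E))) ?_ fun n => ?_
  swap
  · exact ((DML.measurable_comp_split hW (hS n) fun s => DML.measurable_dml1 hX hRa.measurable
      hRb.measurable (hest n) s).sub_const θ₀).const_mul _ |>.aemeasurable
  -- The sum of the five coefficients in the error bound of the expansion.
  have hC : 0 < 2 / |a| + (2 / |a| * |θ₀| + 3 / a ^ 2) + 2 / |a| ^ 3 + |a|⁻¹ + (a ^ 2)⁻¹ := by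
    positivity
  -- The three thresholds are the smallness conditions of the expansion on the U_k, the V_k and the
  -- Dᵃ_k.
  have hδ : 0 < min 1 (min ((|a| / 4) ^ 4) (|a| / 4 / (c + 1))) := by positivity
  refine DML.tendstoInMeasure_zero_of_abs_le_mul hB hδ hC ?_
  filter_upwards [DML.eventually_fold_size hKn hK hKc] with n hn ω hω
  have hmain := DML.abs_sqrt_mul_dml1_sub_le X η₀ ψa ψb (est n) (hSbal n ω) hn.1 hn.2.1
    (fun i => W i ω) (c := c) (θ := θ₀) (E := E) ha0 hn.2.2.2.1 rfl rfl rfl rfl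
  have hue : ∀ w, DML.moment ψa ψb w θ₀ (η₀ (X w)) = u w := fun w => by rw [hu]
  have hve : ∀ w, ψa w (η₀ (X w)) - a = v w := fun w => by rw [hv]
  simp only [hue, hve] at hmain
  rw [← hE] at hω ⊢
  simp only [Pi.sub_apply]
  have hU4 : 0 ≤ ∑ k, (DML.foldMean (S n ω) k fun i => u (W i ω)) ^ 4 :=
    Finset.sum_nonneg fun _ _ => by positivity
  have hV4 : 0 ≤ ∑ k, (DML.foldMean (S n ω) k fun i => v (W i ω)) ^ 4 :=
    Finset.sum_nonneg fun _ _ => by positivity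
  have hza : 0 ≤ √n * (K n : ℝ)⁻¹ *
      ∑ k, |DML.foldError X η₀ ψa (est n) (S n ω) (fun i => W i ω) k| := by positivity
  have hzb : 0 ≤ √n * (K n : ℝ)⁻¹ *
      ∑ k, |DML.foldError X η₀ ψb (est n) (S n ω) (fun i => W i ω) k| := by positivity
  have hr3 : 0 ≤ √n * (K n : ℝ)⁻¹ * ∑ k, |DML.foldMean (S n ω) k fun i => u (W i ω)| *
      (DML.foldMean (S n ω) k fun i => v (W i ω)) ^ 2 := by positivity
  have hr1 := abs_nonneg (√n * (K n : ℝ)⁻¹ *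
      ∑ k, (DML.foldMean (S n ω) k fun i => u (W i ω)) - (√n)⁻¹ * ∑ i : Fin n, u (W i ω))
  have hr2 := abs_nonneg (√n * (K n : ℝ)⁻¹ * ∑ k, (DML.foldMean (S n ω) k fun i => u (W i ω)) *
      (DML.foldMean (S n ω) k fun i => v (W i ω)) - c * E)
  generalize |√n * (K n : ℝ)⁻¹ *
      ∑ k, (DML.foldMean (S n ω) k fun i => u (W i ω)) - (√n)⁻¹ * ∑ i : Fin n, u (W i ω)| = r₁ at *
  generalize |√n * (K n : ℝ)⁻¹ * ∑ k, (DML.foldMean (S n ω) k fun i => u (W i ω)) *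
      (DML.foldMean (S n ω) k fun i => v (W i ω)) - c * E| = r₂ at *
  generalize √n * (K n : ℝ)⁻¹ * ∑ k, |DML.foldMean (S n ω) k fun i => u (W i ω)| *
      (DML.foldMean (S n ω) k fun i => v (W i ω)) ^ 2 = r₃ at *
  generalize ∑ k, (DML.foldMean (S n ω) k fun i => u (W i ω)) ^ 4 = y₁ at *
  generalize ∑ k, (DML.foldMean (S n ω) k fun i => v (W i ω)) ^ 4 = y₂ at *
  generalize √n * (K n : ℝ)⁻¹ *
      ∑ k, |DML.foldError X η₀ ψa (est n) (S n ω) (fun i => W i ω) k| = za at *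
  generalize √n * (K n : ℝ)⁻¹ *
      ∑ k, |DML.foldError X η₀ ψb (est n) (S n ω) (fun i => W i ω) k| = zb at *
  have hsum : 0 ≤ r₁ + r₂ + r₃ + y₁ + y₂ + za + zb := by linarith
  rw [abs_of_nonneg hsum] at hω ⊢
  obtain ⟨h1, h2, h3⟩ : r₁ + r₂ + r₃ + y₁ + y₂ + za + zb < 1 ∧
      r₁ + r₂ + r₃ + y₁ + y₂ + za + zb < (|a| / 4) ^ 4 ∧
      r₁ + r₂ + r₃ + y₁ + y₂ + za + zb < |a| / 4 / (c + 1) := by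
    simpa only [lt_min_iff] using hω
  have h4 : (c + 1) * za ≤ |a| / 4 := by
    have h5 : za ≤ |a| / 4 / (c + 1) := by linarith
    rw [le_div_iff₀ (by positivity)] at h5
    linarith
  have h5 := hmain (by linarith) (by linarith) h4
  rw [show a⁻¹ * ((√n)⁻¹ * ∑ i : Fin n, u (W i ω)) + c * -((a ^ 2)⁻¹ * E) =
    a⁻¹ * ((√n)⁻¹ * ∑ i : Fin n, u (W i ω)) - (a ^ 2)⁻¹ * (c * E) by ring]
  refine h5.trans ?_
  have hle : ∀ {x : ℝ}, x ≤ r₁ + r₂ + r₃ + y₁ + y₂ + za + zb → ∀ {b : ℝ}, 0 ≤ b →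
      b * x ≤ b * (r₁ + r₂ + r₃ + y₁ + y₂ + za + zb) := fun hx _ hb =>
    mul_le_mul_of_nonneg_left hx hb
  have hm : 0 ≤ 2 / |a| * |θ₀| + 3 / a ^ 2 := by positivity
  generalize 2 / |a| * |θ₀| + 3 / a ^ 2 = m at *
  rw [add_mul, add_mul, add_mul, add_mul]
  refine add_le_add (add_le_add (add_le_add (add_le_add ?_ ?_) ?_) ?_) ?_
  all_goals exact hle (by linarith) (by positivity)
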